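/- Let $n\ge 1$, let $\mathbf a,\mathbf b\in\mathbb R^n$ have nonnegative entries, and let $\mathbf w\in\mathbb R^n$ satisfy $w_1\ge\dots\ge w_n\ge 0$. For a permutation $\sigma$ of $[n]$ and $\mathbf x\in\mathbb R^n$ put $\mathsf{cs}_{\mathbf w}(\mathbf x,\sigma)=\sum_i w_i x_{\sigma(i)}$ and $\mathsf{cs}^*_{\mathbf w}(\mathbf x)=\max_\sigma \mathsf{cs}_{\mathbf w}(\mathbf x,\sigma)$. Let $f(\alpha,\beta)$ be concave, strictly increasing in each coordinate and continuously differentiable on $S=[0,\infty)^2$. More generally, $S$ may be any upward closed set with $(0,\infty)^2\subseteq S\subseteq[0,\infty)^2$ (with $f=-\infty$ on the rest of $[0,\infty)^2$, as for $f=\log(\alpha\beta)$), provided that $(\mathsf{cs}_{\mathbf w}(\mathbf a,\sigma),\mathsf{cs}_{\mathbf w}(\mathbf b,\sigma))\in S$ for all $\sigma$. Derivatives at boundary points are one-sided. Let $f^*(\mu,\nu)=\sup_{(\alpha,\beta)\in S}\,(\mu\alpha+\nu\beta+f(\alpha,\beta))\in(-\infty,\infty]$. Consider the primal program $$\max f(\alpha,\beta)\quad\text{over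 }\pi_{ij}\ge 0,\ (\alpha,\beta)\in S,\quad \alpha\le\sum_{i,j}\pi_{ij}w_ia_j,\quad \beta\le\sum_{i,j}\pi_{ij}w_ib_j,\quad \sum_j\pi_{ij}\le 1\ (\forall i),\quad \sum_i\pi_{ij}\le 1\ (\forall j),$$ and the dual program $$\min \sum_i r_i+\sum_j c_j+f^*(-p,-q)\quad\text{over } r_i,c_j,p,q\ge 0,\quad r_i+c_j\ge w_i(pa_j+qb_j)\ (\forall i,j).$$ By a program we mean a fixed program, not depending on $n$ or on the data, of a random access machine with index registers and arrays (addition, truncated subtraction, halving, comparison) and real registers and arrays (exact field operations, comparison), given $n,\mathbf a,\mathbf b,\mathbf w$. It can query $f$ in three ways: the value $f(z)$ for $z\in S$; the gradient $\nabla f(z)$ for $z\in S$; and a crossing query, which for $z,z'\in S$ and $\lambda\in\mathbb R$ returns some $\mu\in[0,1]$ such that $\nabla f(\mu z+(1-\mu)z')$ lies on the line $\{q=\lambda p\}$, if such a $\mu$ exists. Each command, including a query, takes one unit of time. A randomized program may also draw a uniformly random element of $\{0,\dots,k\}$, for an index $k$, in unit time. The program solves the instance if it outputs permutations $\sigma,\tau$,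 a number $\mu\in[0,1]$, numbers $\alpha,\beta$, $p,q>0$, $\mathsf{OPT}$ and vectors $\mathbf r,\mathbf c$ such that $\pi=\mu\sigma+(1-\mu)\tau$ (permutation matrices) with $\alpha,\beta$ is optimal for the primal program, $(\mathbf r,\mathbf c,p,q)$ is optimal for the dual program, $(p,q)$ is a minimizer in $$\mathsf{OPT}=\min_{p,q>0}\ \mathsf{cs}^*_{\mathbf w}(p\mathbf a+q\mathbf b)+f^*(-p,-q),$$ and $\mathsf{OPT}$ is the optimal value of both programs. 1. There are a deterministic program and a constant $K$ such that for all instances as above in which the entries of $\mathbf a,\mathbf b$ are integers of absolute value at most $B$, where $B\ge 1$ is an integer, the program halts within $K\,n\log(n+1)\log(B+1)$ steps and solves the instance, using at most one crossing query. 2. There is a randomized program such that for all instances as above (with real $\mathbf a,\mathbf b$) its output, whenever it halts, solves the instance and uses at most one crossing query. Its expected running time is at most $K\,n\log^2(n+1)$ for a constant $K$; and for each $d\in\mathbb N$ there is a constant $K_d$ such that it halts within $K_d\,n\log^2(n+1)$ steps with probability at least $1-n^{-d}$. The constants do not depend on the instance. -/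

import Mathlib

open scoped ENNReal

namespace RankOpt

/-! ### Scores and objective functions -/

/-- Cumulative score of the scores `x` for the ranking `σ` (`σ i` is the item in position `i`). -/
def cs {n : ℕ} (w x : Fin n → ℝ) (σ : Equiv.Perm (Fin n)) : ℝ :=
  ∑ i, w i * x (σ i)

/-- The best cumulative score `max_σ cs w x σ` (a maximum over a finite nonempty set). -/
noncomputable def csStar {n : ℕ} (w x : Fin n → ℝ) : ℝ :=
  ⨆ σ : Equiv.Perm (Fin n), cs w x σ

/-- Position weights: nonnegative and weakly decreasing. -/
structure IsWeight {n : ℕ} (w : Fin n → ℝ) : Prop where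
  antitone : Antitone w
  nonneg : ∀ i, 0 ≤ w i

/-- `f` is an admissible combining function with domain `S`. The main case is `S = [0,∞)²`; the
domain may lack boundary points (where `f` counts as `-∞`), so that `log (α β)` is admissible. -/
structure IsObjective (S : Set (ℝ × ℝ)) (f : ℝ × ℝ → ℝ) : Prop where
  pos_subset : ∀ z : ℝ × ℝ, 0 < z.1 → 0 < z.2 → z ∈ S
  subset_nonneg : ∀ z ∈ S, 0 ≤ z.1 ∧ 0 ≤ z.2
  upper : IsUpperSet S
  concave : ConcaveOn ℝ S f
  strict_fst : ∀ x x' y : ℝ, (x, y) ∈ S → x < x' → f (x, y) < f (x', y)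
  strict_snd : ∀ x y y' : ℝ, (x, y) ∈ S → y < y' → f (x, y) < f (x, y')
  differentiable : DifferentiableOn ℝ f S
  continuous_deriv : ContinuousOn (fderivWithin ℝ f S) S

/-- The gradient of `f` (one-sided at boundary points of `S`). -/
noncomputable def gradient (S : Set (ℝ × ℝ)) (f : ℝ × ℝ → ℝ) (z : ℝ × ℝ) : ℝ × ℝ :=
  (fderivWithin ℝ f S z (1, 0), fderivWithin ℝ f S z (0, 1))

/-- The Fenchel dual `f*(μ,ν) = sup (μ α + ν β + f(α,β))`, with values in `(-∞, ∞]`. -/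
noncomputable def fenchel (S : Set (ℝ × ℝ)) (f : ℝ × ℝ → ℝ) (μ ν : ℝ) : EReal :=
  ⨆ z ∈ S, ((μ * z.1 + ν * z.2 + f z : ℝ) : EReal)

/-! ### The primal and the dual program -/

structure PrimalFeasible {n : ℕ} (S : Set (ℝ × ℝ)) (w a b : Fin n → ℝ)
    (P : Matrix (Fin n) (Fin n) ℝ) (α β : ℝ) : Prop where
  dom : (α, β) ∈ S
  nonneg_fst : 0 ≤ α
  nonneg_snd : 0 ≤ β
  nonneg : ∀ i j, 0 ≤ P i j
  le_fst : α ≤ ∑ i, ∑ j, P i j * w i * a j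
  le_snd : β ≤ ∑ i, ∑ j, P i j * w i * b j
  row : ∀ i, ∑ j, P i j ≤ 1
  col : ∀ j, ∑ i, P i j ≤ 1

structure DualFeasible {n : ℕ} (w a b : Fin n → ℝ) (r c : Fin n → ℝ) (p q : ℝ) : Prop where
  nonneg_r : ∀ i, 0 ≤ r i
  nonneg_c : ∀ j, 0 ≤ c j
  nonneg_p : 0 ≤ p
  nonneg_q : 0 ≤ q
  le : ∀ i j, w i * (p * a j + q * b j) ≤ r i + c j

noncomputable def dualValue {n : ℕ} (S : Set (ℝ × ℝ)) (f : ℝ × ℝ → ℝ)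
    (r c : Fin n → ℝ) (p q : ℝ) : EReal :=
  ((∑ i, r i + ∑ j, c j : ℝ) : EReal) + fenchel S f (-p) (-q)

/-- `Ψ(p,q) = cs*_w(p a + q b) + f*(-p,-q)`. -/
noncomputable def Psi {n : ℕ} (S : Set (ℝ × ℝ)) (f : ℝ × ℝ → ℝ) (w a b : Fin n → ℝ)
    (p q : ℝ) : EReal :=
  ((csStar w (fun j => p * a j + q * b j) : ℝ) : EReal) + fenchel S f (-p) (-q)

/-! ### Access to the combining function -/

/-- The answers that a program gets when it queries the combining function. -/
structure Oracle where
  val : ℝ × ℝ → ℝ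
  grad : ℝ × ℝ → ℝ × ℝ
  crossing : ℝ × ℝ → ℝ × ℝ → ℝ → ℝ

/-- The oracle answers correctly about `f`: values and gradients are exact at points of `S`. A
crossing query gives two points of `S` and a ratio `l`, and is answered by some `m ∈ [0,1]` at
which the gradient at `m z + (1 - m) z'` lies on the line `q = l p`, provided that there is one.
Nothing is assumed about other queries. -/
structure Oracle.Answers (O : Oracle) (S : Set (ℝ × ℝ)) (f : ℝ × ℝ → ℝ) : Prop where
  val : ∀ z ∈ S, O.val z = f z
  grad : ∀ z ∈ S, O.grad z = gradient S f z
  crossing : ∀ z ∈ S, ∀ z' ∈ S, ∀ l : ℝ,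
    (∃ m ∈ Set.Icc (0 : ℝ) 1, (gradient S f (m • z + (1 - m) • z')).2 =
      l * (gradient S f (m • z + (1 - m) • z')).1) →
    O.crossing z z' l ∈ Set.Icc (0 : ℝ) 1 ∧
      (gradient S f (O.crossing z z' l • z + (1 - O.crossing z z' l) • z')).2 =
        l * (gradient S f (O.crossing z z' l • z + (1 - O.crossing z z' l) • z')).1

/-! ### Random access machine over the reals

Programs of a small imperative language with index variables and arrays (natural numbers, with
addition, truncated subtraction and halving) and real variables and arrays (with field operations
and comparison). There is no conversion from reals to indices. Variables and arrays are named by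
natural numbers, so each program uses finitely many of them. -/

/-- Index expressions. -/
inductive IExpr
  | const (k : ℕ)
  | var (x : ℕ)
  | get (A : ℕ) (e : IExpr)
  | add (e e' : IExpr)
  | sub (e e' : IExpr)
  | half (e : IExpr)

/-- Real expressions. -/
inductive RExpr
  | const (k : ℚ)
  | var (x : ℕ)
  | get (A : ℕ) (e : IExpr)
  | add (e e' : RExpr)
  | sub (e e' : RExpr)
  | mul (e e' : RExpr)
  | div (e e' : RExpr)

/-- Tests. -/
inductive Test
  | ilt (e e' : IExpr)
  | rlt (e e' : RExpr)
  | not (t : Test)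
  | and (t t' : Test)

/-- Commands. -/
inductive Cmd
  | skip
  | iset (x : ℕ) (e : IExpr)
  | iput (A : ℕ) (i e : IExpr)
  | rset (x : ℕ) (e : RExpr)
  | rput (A : ℕ) (i : IExpr) (e : RExpr)
  | rand (x : ℕ) (e : IExpr)
  | qval (z : ℕ) (x y : RExpr)
  | qgrad (p q : ℕ) (x y : RExpr)
  | qcross (m : ℕ) (x y x' y' l : RExpr)
  | seq (c d : Cmd)
  | ite (t : Test) (c d : Cmd)
  | loop (t : Test) (c : Cmd)

/-- The program makes no random choices. -/
def Cmd.RandFree : Cmd → Prop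
  | .rand _ _ => False
  | .seq c d => c.RandFree ∧ d.RandFree
  | .ite _ c d => c.RandFree ∧ d.RandFree
  | .loop _ c => c.RandFree
  | _ => True

/-- Memory: index variables and arrays, real variables and arrays, and the number of crossing
queries made so far (which programs cannot read). -/
structure State where
  iv : ℕ → ℕ
  ia : ℕ → ℕ → ℕ
  rv : ℕ → ℝ
  ra : ℕ → ℕ → ℝ
  crossings : ℕ

def IExpr.eval (s : State) : IExpr → ℕ
  | .const k => k
  | .var x => s.iv x
  | .get A e => s.ia A (e.eval s)
  | .add e e' => e.eval s + e'.eval s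
  | .sub e e' => e.eval s - e'.eval s
  | .half e => e.eval s / 2

noncomputable def RExpr.eval (s : State) : RExpr → ℝ
  | .const k => (k : ℝ)
  | .var x => s.rv x
  | .get A e => s.ra A (e.eval s)
  | .add e e' => e.eval s + e'.eval s
  | .sub e e' => e.eval s - e'.eval s
  | .mul e e' => e.eval s * e'.eval s
  | .div e e' => e.eval s / e'.eval s

def Test.eval (s : State) : Test → Prop
  | .ilt e e' => e.eval s < e'.eval s
  | .rlt e e' => e.eval s < e'.eval s
  | .not t => ¬ t.eval s
  | .and t t' => t.eval s ∧ t'.eval s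

def State.setIv (s : State) (x v : ℕ) : State :=
  { s with iv := Function.update s.iv x v }

def State.setIa (s : State) (A i v : ℕ) : State :=
  { s with ia := Function.update s.ia A (Function.update (s.ia A) i v) }

noncomputable def State.setRv (s : State) (x : ℕ) (v : ℝ) : State :=
  { s with rv := Function.update s.rv x v }

noncomputable def State.setRa (s : State) (A i : ℕ) (v : ℝ) : State :=
  { s with ra := Function.update s.ra A (Function.update (s.ra A) i v) }

/-- A configuration: the commands still to be executed, and the memory. The machine has halted
when no command is left. -/
abbrev Config := List Cmd × State

open Classical in
/-- One step. `rand x e` stores a uniformly random element of `{0, …, e}` in `x`; all other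
commands are deterministic. -/
noncomputable def step (O : Oracle) : Config → PMF Config
  | ([], s) => PMF.pure ([], s)
  | (.skip :: L, s) => PMF.pure (L, s)
  | (.iset x e :: L, s) => PMF.pure (L, s.setIv x (e.eval s))
  | (.iput A i e :: L, s) => PMF.pure (L, s.setIa A (i.eval s) (e.eval s))
  | (.rset x e :: L, s) => PMF.pure (L, s.setRv x (e.eval s))
  | (.rput A i e :: L, s) => PMF.pure (L, s.setRa A (i.eval s) (e.eval s))
  | (.rand x e :: L, s) =>
      (PMF.uniformOfFinset (Finset.range (e.eval s + 1)) Finset.nonempty_range_add_one).map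
        (fun v => (L, s.setIv x v))
  | (.qval z x y :: L, s) => PMF.pure (L, s.setRv z (O.val (x.eval s, y.eval s)))
  | (.qgrad p q x y :: L, s) =>
      PMF.pure (L, (s.setRv p (O.grad (x.eval s, y.eval s)).1).setRv q
        (O.grad (x.eval s, y.eval s)).2)
  | (.qcross m x y x' y' l :: L, s) =>
      PMF.pure (L, { s.setRv m (O.crossing (x.eval s, y.eval s) (x'.eval s, y'.eval s)
        (l.eval s)) with crossings := s.crossings + 1 })
  | (.seq c d :: L, s) => PMF.pure (c :: d :: L, s)
  | (.ite t c d :: L, s) => PMF.pure (if t.eval s then (c :: L, s) else (d :: L, s))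
  | (.loop t c :: L, s) => PMF.pure (if t.eval s then (c :: .loop t c :: L, s) else (L, s))

/-- The distribution of the configuration after `t` steps. -/
noncomputable def run (O : Oracle) : ℕ → Config → PMF Config
  | 0, x => PMF.pure x
  | t + 1, x => (step O x).bind (run O t)

/-- The probability that the machine, started in `x`, has not halted after `t` steps. -/
noncomputable def probRunning (O : Oracle) (t : ℕ) (x : Config) : ℝ≥0∞ :=
  (run O t x).toOuterMeasure {y | y.1 ≠ []}

/-- The expected number of steps until the machine halts: `E T = ∑ t, P (T > t)`. -/
noncomputable def expectedTime (O : Oracle) (x : Config) : ℝ≥0∞ :=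
  ∑' t, probRunning O t x

/-! ### Input and output -/

/-- A vector as the contents of an array. -/
noncomputable def toArray {n : ℕ} (x : Fin n → ℝ) (i : ℕ) : ℝ :=
  if h : i < n then x ⟨i, h⟩ else 0

/-- Initially index variable `0` holds `n`, and real arrays `0`, `1`, `2` hold `a`, `b`, `w`;
everything else is zero. -/
noncomputable def start {n : ℕ} (prog : Cmd) (a b w : Fin n → ℝ) : Config :=
  ([prog],
    { iv := fun x => if x = 0 then n else 0
      ia := fun _ _ => 0
      rv := fun _ => 0
      ra := fun A => if A = 0 then toArray a else if A = 1 then toArray b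
        else if A = 2 then toArray w else fun _ => 0
      crossings := 0 })

/-- The memory holds an exact solution. Index arrays `0`, `1` hold rankings `σ`, `τ`; real
variables `0`, …, `5` hold `μ, α, β, p, q, OPT`; real arrays `3`, `4` hold `r`, `c`. The matrix
`π = μ σ + (1 - μ) τ` with `α, β` solves the primal program, `(r, c, p, q)` solves the dual
program, `(p, q)` minimizes `Ψ` over the open quadrant, and all three values are `OPT`. -/
structure Solves {n : ℕ} (S : Set (ℝ × ℝ)) (f : ℝ × ℝ → ℝ) (w a b : Fin n → ℝ)
    (s : State) (σ τ : Equiv.Perm (Fin n)) : Prop where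
  out_fst : ∀ i : Fin n, s.ia 0 i = σ i
  out_snd : ∀ i : Fin n, s.ia 1 i = τ i
  mix : s.rv 0 ∈ Set.Icc (0 : ℝ) 1
  primal_feasible : PrimalFeasible S w a b
    (s.rv 0 • σ.permMatrix ℝ + (1 - s.rv 0) • τ.permMatrix ℝ) (s.rv 1) (s.rv 2)
  primal_value : f (s.rv 1, s.rv 2) = s.rv 5
  primal_max : ∀ P α β, PrimalFeasible S w a b P α β → f (α, β) ≤ s.rv 5
  dual_feasible : DualFeasible w a b (fun i => s.ra 3 i) (fun j => s.ra 4 j) (s.rv 3) (s.rv 4)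
  dual_value : dualValue (n := n) S f (fun i => s.ra 3 i) (fun j => s.ra 4 j)
    (s.rv 3) (s.rv 4) = (s.rv 5 : EReal)
  dual_min : ∀ r c p q, DualFeasible w a b r c p q → (s.rv 5 : EReal) ≤ dualValue S f r c p q
  pos_p : 0 < s.rv 3
  pos_q : 0 < s.rv 4
  psi_value : Psi S f w a b (s.rv 3) (s.rv 4) = (s.rv 5 : EReal)
  psi_min : ∀ p q, 0 < p → 0 < q → (s.rv 5 : EReal) ≤ Psi S f w a b p q

/-- The memory holds an exact solution, found with at most one crossing query. -/
def Correct {n : ℕ} (S : Set (ℝ × ℝ)) (f : ℝ × ℝ → ℝ) (w a b : Fin n → ℝ) (s : State) : Prop :=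
  (∃ σ τ : Equiv.Perm (Fin n), Solves S f w a b s σ τ) ∧ s.crossings ≤ 1

/-- A problem instance: at least one item, nonnegative scores, decreasing weights, and an
admissible `f`, correctly answered about, that is defined at the score pair of each ranking. -/
structure Instance {n : ℕ} (S : Set (ℝ × ℝ)) (f : ℝ × ℝ → ℝ) (O : Oracle)
    (w a b : Fin n → ℝ) : Prop where
  pos : 1 ≤ n
  weight : IsWeight w
  nonneg_a : ∀ j, 0 ≤ a j
  nonneg_b : ∀ j, 0 ≤ b j
  objective : IsObjective S f
  answers : O.Answers S f
  scores_mem : ∀ σ : Equiv.Perm (Fin n), (cs w a σ, cs w b σ) ∈ S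

end RankOpt

/-! The problem reduces to finding one direction. Suppose that a point z on a segment between the
score pairs of two rankings maximizes, among all score pairs, the linear functional (p, q) = ∇f(z).
The tangent plane at z then bounds f on the whole feasible region, the conjugate at (-p, -q) is
attained at z, and weak duality closes every gap: z is primal optimal, (p, q) is dual optimal, and
all values equal f(z) (`solves_of_certificate`). The prices are explicit: once the items are sorted
by p a + q b, summation by parts splits each product of weight and score into a row part and a
column part, with equality on the diagonal (`price_add_price'`) and the right inequality off it
(`mul_le_price_add_price'`).

Directions are written as (1 - θ, θ). By the rearrangement inequality, sorting by (1 - θ) a + θ b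
gives a best ranking for θ, and comparing θ with q / (p + q) for the gradient (p, q) at its score
pair tells on which side to go on. `Bracket` records a lower end whose gradient points at or above
it and an upper end whose gradient points below it. As soon as the rankings σ, τ of the two ends are
both optimal for a common θ, `wp_chooseMix` finishes: either the gradient at σ points between the
lower end and θ, and σ is optimal for its own gradient; or the same holds for τ on the other side;
or the two gradients lie on different sides of θ, and by continuity some point of the segment has a
gradient along θ. The only crossing query finds this point.

To reach a common θ, note that the sorted order changes only at crossings, the directions in which
two items change places. For integer scores at most M these are fractions with denominators at most
2M, so distinct ones differ by at least 1 / (4M²), and bisection below this length suffices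
(`exists_common_sorts`). For real scores, the crossings inside the interval are the inversions
between the two sorted orders, so a stable merge sort counts them. Splitting at a uniformly random
crossing leaves on average at most three quarters of them (`four_mul_sum_numCross_le`). There are at
most n² at the start, so O(log n) rounds suffice, with a geometric tail (`probRunning_search_le`).
When none is left, a ranking sorted for the midpoint is sorted for both ends.

Deterministic code is treated by a program logic with exact step counts (`wp`); probabilities enter
only at the single random draw of each round. -/

namespace RankOpt

/-! ### Big-step semantics of deterministic commands -/

/-- `Exec O c s t s'`: started in `s`, the command `c` makes no random choice and ends in `s'`
after `t` steps. -/
inductive Exec (O : Oracle) : Cmd → State → ℕ → State → Prop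
  | skip (s) : Exec O .skip s 1 s
  | iset (x e s) : Exec O (.iset x e) s 1 (s.setIv x (e.eval s))
  | iput (A i e s) : Exec O (.iput A i e) s 1 (s.setIa A (i.eval s) (e.eval s))
  | rset (x e s) : Exec O (.rset x e) s 1 (s.setRv x (e.eval s))
  | rput (A i e s) : Exec O (.rput A i e) s 1 (s.setRa A (i.eval s) (e.eval s))
  | qval (z x y s) : Exec O (.qval z x y) s 1 (s.setRv z (O.val (x.eval s, y.eval s)))
  | qgrad (p q x y s) : Exec O (.qgrad p q x y) s 1
      ((s.setRv p (O.grad (x.eval s, y.eval s)).1).setRv q (O.grad (x.eval s, y.eval s)).2)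
  | qcross (m x y x' y' l s) : Exec O (.qcross m x y x' y' l) s 1
      { s.setRv m (O.crossing (x.eval s, y.eval s) (x'.eval s, y'.eval s) (l.eval s)) with
        crossings := s.crossings + 1 }
  | seq {c d s t s' u s''} : Exec O c s t s' → Exec O d s' u s'' →
      Exec O (.seq c d) s (t + u + 1) s''
  | ite_true {b c d s t s'} : b.eval s → Exec O c s t s' → Exec O (.ite b c d) s (t + 1) s'
  | ite_false {b c d s t s'} : ¬ b.eval s → Exec O d s t s' → Exec O (.ite b c d) s (t + 1) s'
  | loop_false {b c s} : ¬ b.eval s → Exec O (.loop b c) s 1 s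
  | loop_true {b c s t s' u s''} : b.eval s → Exec O c s t s' →
      Exec O (.loop b c) s' u s'' → Exec O (.loop b c) s (t + u + 1) s''

theorem run_succ (O : Oracle) (t : ℕ) (x : Config) :
    run O (t + 1) x = (step O x).bind (run O t) := rfl

/-- A deterministic stretch is a chain of point masses, so it can be peeled off the front of a run.
The continuation `L` and the remaining time `v` are arbitrary; the induction needs this for `seq`
and `loop`, and it lets deterministic blocks stand between random draws. -/
theorem Exec.run_eq {O : Oracle} {c : Cmd} {s : State} {t : ℕ} {s' : State}
    (h : Exec O c s t s') (L : List Cmd) (v : ℕ) :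
    run O (t + v) (c :: L, s) = run O v (L, s') := by
  induction h generalizing L v with
  | seq _ _ ih₁ ih₂ =>
    rename_i t s' u s'' _ _
    rw [show t + u + 1 + v = (t + (u + v)) + 1 by ring, run_succ]
    simp only [step, PMF.pure_bind]
    rw [ih₁, ih₂]
  | ite_true hb _ ih =>
    rename_i t s' _
    rw [show t + 1 + v = (t + v) + 1 by ring, run_succ]
    simp only [step, hb, if_true, PMF.pure_bind]
    exact ih _ _
  | ite_false hb _ ih =>
    rename_i t s' _
    rw [show t + 1 + v = (t + v) + 1 by ring, run_succ]
    simp only [step, hb, if_false, PMF.pure_bind]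
    exact ih _ _
  | loop_false hb =>
    rw [add_comm, run_succ]
    simp only [step, hb, if_false, PMF.pure_bind]
  | loop_true hb _ _ ih₁ ih₂ =>
    rename_i t s' u s'' _ _
    rw [show t + u + 1 + v = (t + (u + v)) + 1 by ring, run_succ]
    simp only [step, hb, if_true, PMF.pure_bind]
    rw [ih₁, ih₂]
  | _ =>
    rw [add_comm, run_succ]
    simp only [step, PMF.pure_bind]

/-! ### Variables that a command may change -/

/-- Boolean valued, so that for a concrete program the side conditions of `Frame` hold by `rfl`. -/
def Cmd.writesIv : Cmd → ℕ → Bool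
  | .iset x _, y => y == x
  | .rand x _, y => y == x
  | .seq c d, y => c.writesIv y || d.writesIv y
  | .ite _ c d, y => c.writesIv y || d.writesIv y
  | .loop _ c, y => c.writesIv y
  | _, _ => false

def Cmd.writesIa : Cmd → ℕ → Bool
  | .iput A _ _, y => y == A
  | .seq c d, y => c.writesIa y || d.writesIa y
  | .ite _ c d, y => c.writesIa y || d.writesIa y
  | .loop _ c, y => c.writesIa y
  | _, _ => false

def Cmd.writesRv : Cmd → ℕ → Bool
  | .rset x _, y => y == x
  | .qval z _ _, y => y == z
  | .qgrad p q _ _, y => y == p || y == q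
  | .qcross m _ _ _ _ _, y => y == m
  | .seq c d, y => c.writesRv y || d.writesRv y
  | .ite _ c d, y => c.writesRv y || d.writesRv y
  | .loop _ c, y => c.writesRv y
  | _, _ => false

def Cmd.writesRa : Cmd → ℕ → Bool
  | .rput A _ _, y => y == A
  | .seq c d, y => c.writesRa y || d.writesRa y
  | .ite _ c d, y => c.writesRa y || d.writesRa y
  | .loop _ c, y => c.writesRa y
  | _, _ => false

def Cmd.crosses : Cmd → Bool
  | .qcross _ _ _ _ _ _ => true
  | .seq c d => c.crosses || d.crosses
  | .ite _ c d => c.crosses || d.crosses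
  | .loop _ c => c.crosses
  | _ => false

/-- The states `s` and `s'` agree on everything that `c` does not write. -/
structure Frame (c : Cmd) (s s' : State) : Prop where
  iv : ∀ x, c.writesIv x = false → s'.iv x = s.iv x
  ia : ∀ x, c.writesIa x = false → s'.ia x = s.ia x
  rv : ∀ x, c.writesRv x = false → s'.rv x = s.rv x
  ra : ∀ x, c.writesRa x = false → s'.ra x = s.ra x
  crossings : c.crosses = false → s'.crossings = s.crossings

/-! ### Effect of updates on the memory -/

section
variable (s : State) (x y A B i v : ℕ) (r : ℝ)

@[simp] theorem State.setIv_iv : (s.setIv x v).iv y = if y = x then v else s.iv y := by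
  simp [State.setIv, Function.update_apply]
@[simp] theorem State.setIv_ia : (s.setIv x v).ia = s.ia := rfl
@[simp] theorem State.setIv_rv : (s.setIv x v).rv = s.rv := rfl
@[simp] theorem State.setIv_ra : (s.setIv x v).ra = s.ra := rfl
@[simp] theorem State.setIv_crossings : (s.setIv x v).crossings = s.crossings := rfl
@[simp] theorem State.setIa_ia : (s.setIa A i v).ia B =
    if B = A then Function.update (s.ia A) i v else s.ia B := by
  simp [State.setIa, Function.update_apply]
@[simp] theorem State.setIa_iv : (s.setIa A i v).iv = s.iv := rfl
@[simp] theorem State.setIa_rv : (s.setIa A i v).rv = s.rv := rfl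
@[simp] theorem State.setIa_ra : (s.setIa A i v).ra = s.ra := rfl
@[simp] theorem State.setIa_crossings : (s.setIa A i v).crossings = s.crossings := rfl
@[simp] theorem State.setRv_rv : (s.setRv x r).rv y = if y = x then r else s.rv y := by
  simp [State.setRv, Function.update_apply]
@[simp] theorem State.setRv_iv : (s.setRv x r).iv = s.iv := rfl
@[simp] theorem State.setRv_ia : (s.setRv x r).ia = s.ia := rfl
@[simp] theorem State.setRv_ra : (s.setRv x r).ra = s.ra := rfl
@[simp] theorem State.setRv_crossings : (s.setRv x r).crossings = s.crossings := rfl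
@[simp] theorem State.setRa_ra : (s.setRa A i r).ra B =
    if B = A then Function.update (s.ra A) i r else s.ra B := by
  simp [State.setRa, Function.update_apply]
@[simp] theorem State.setRa_iv : (s.setRa A i r).iv = s.iv := rfl
@[simp] theorem State.setRa_rv : (s.setRa A i r).rv = s.rv := rfl
@[simp] theorem State.setRa_ia : (s.setRa A i r).ia = s.ia := rfl
@[simp] theorem State.setRa_crossings : (s.setRa A i r).crossings = s.crossings := rfl
end

theorem Exec.frame {O : Oracle} {c : Cmd} {s : State} {t : ℕ} {s' : State}
    (h : Exec O c s t s') : Frame c s s' := by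
  induction h with
  | seq _ _ ih₁ ih₂ =>
    refine ⟨fun x => ?_, fun x => ?_, fun x => ?_, fun x => ?_, ?_⟩ <;>
      simp only [Cmd.writesIv, Cmd.writesIa, Cmd.writesRv, Cmd.writesRa, Cmd.crosses,
        Bool.or_eq_false_iff] <;> rintro ⟨h₁, h₂⟩
    · rw [ih₂.iv _ h₂, ih₁.iv _ h₁]
    · rw [ih₂.ia _ h₂, ih₁.ia _ h₁]
    · rw [ih₂.rv _ h₂, ih₁.rv _ h₁]
    · rw [ih₂.ra _ h₂, ih₁.ra _ h₁]
    · rw [ih₂.crossings h₂, ih₁.crossings h₁]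
  | ite_true _ _ ih =>
    refine ⟨fun x => ?_, fun x => ?_, fun x => ?_, fun x => ?_, ?_⟩ <;>
      simp only [Cmd.writesIv, Cmd.writesIa, Cmd.writesRv, Cmd.writesRa, Cmd.crosses,
        Bool.or_eq_false_iff] <;> rintro ⟨h₁, h₂⟩
    exacts [ih.iv _ h₁, ih.ia _ h₁, ih.rv _ h₁, ih.ra _ h₁, ih.crossings h₁]
  | ite_false _ _ ih =>
    refine ⟨fun x => ?_, fun x => ?_, fun x => ?_, fun x => ?_, ?_⟩ <;>
      simp only [Cmd.writesIv, Cmd.writesIa, Cmd.writesRv, Cmd.writesRa, Cmd.crosses,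
        Bool.or_eq_false_iff] <;> rintro ⟨h₁, h₂⟩
    exacts [ih.iv _ h₂, ih.ia _ h₂, ih.rv _ h₂, ih.ra _ h₂, ih.crossings h₂]
  | loop_false _ => exact ⟨fun _ _ => rfl, fun _ _ => rfl, fun _ _ => rfl, fun _ _ => rfl,
      fun _ => rfl⟩
  | loop_true _ _ _ ih₁ ih₂ =>
    refine ⟨fun x => ?_, fun x => ?_, fun x => ?_, fun x => ?_, ?_⟩ <;>
      simp only [Cmd.writesIv, Cmd.writesIa, Cmd.writesRv, Cmd.writesRa, Cmd.crosses] <;> intro h₁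
    · rw [ih₂.iv _ h₁, ih₁.iv _ h₁]
    · rw [ih₂.ia _ h₁, ih₁.ia _ h₁]
    · rw [ih₂.rv _ h₁, ih₁.rv _ h₁]
    · rw [ih₂.ra _ h₁, ih₁.ra _ h₁]
    · rw [ih₂.crossings h₁, ih₁.crossings h₁]
  | _ =>
    refine ⟨fun x => ?_, fun x => ?_, fun x => ?_, fun x => ?_, ?_⟩ <;>
      simp +contextual [Cmd.writesIv, Cmd.writesIa, Cmd.writesRv, Cmd.writesRa, Cmd.crosses]

/-! ### Total correctness with running times -/

/-- Started in `s`, the command `c` runs deterministically and ends after `t` steps in a state `s'`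
such that `Q t s'`. -/
def wp (O : Oracle) (c : Cmd) (s : State) (Q : ℕ → State → Prop) : Prop :=
  ∃ t s', Exec O c s t s' ∧ Q t s'

section
variable {O : Oracle} {s : State} {Q : ℕ → State → Prop}

/-- The frame comes for free here, so a specification need only describe what its command changes.
-/
theorem wp.mono {c : Cmd} {R : ℕ → State → Prop} (h : wp O c s Q)
    (H : ∀ t s', Frame c s s' → Q t s' → R t s') : wp O c s R := by
  obtain ⟨t, s', h, hQ⟩ := h
  exact ⟨t, s', h, H t s' h.frame hQ⟩

theorem wp_skip : Q 1 s → wp O .skip s Q := fun h => ⟨_, _, .skip s, h⟩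
theorem wp_iset {x e} : Q 1 (s.setIv x (e.eval s)) → wp O (.iset x e) s Q :=
  fun h => ⟨_, _, .iset x e s, h⟩
theorem wp_iput {A i e} : Q 1 (s.setIa A (i.eval s) (e.eval s)) → wp O (.iput A i e) s Q :=
  fun h => ⟨_, _, .iput A i e s, h⟩
theorem wp_rset {x e} : Q 1 (s.setRv x (e.eval s)) → wp O (.rset x e) s Q :=
  fun h => ⟨_, _, .rset x e s, h⟩
theorem wp_rput {A i e} : Q 1 (s.setRa A (i.eval s) (e.eval s)) → wp O (.rput A i e) s Q :=
  fun h => ⟨_, _, .rput A i e s, h⟩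
theorem wp_qval {z x y} : Q 1 (s.setRv z (O.val (x.eval s, y.eval s))) →
    wp O (.qval z x y) s Q :=
  fun h => ⟨_, _, .qval z x y s, h⟩
theorem wp_qgrad {p q x y} : Q 1 ((s.setRv p (O.grad (x.eval s, y.eval s)).1).setRv q
      (O.grad (x.eval s, y.eval s)).2) → wp O (.qgrad p q x y) s Q :=
  fun h => ⟨_, _, .qgrad p q x y s, h⟩
theorem wp_qcross {m x y x' y' l} : Q 1 { s.setRv m (O.crossing (x.eval s, y.eval s)
      (x'.eval s, y'.eval s) (l.eval s)) with crossings := s.crossings + 1 } →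
    wp O (.qcross m x y x' y' l) s Q :=
  fun h => ⟨_, _, .qcross m x y x' y' l s, h⟩

theorem wp_seq {c d} (h : wp O c s fun t s' => wp O d s' fun u s'' => Q (t + u + 1) s'') :
    wp O (.seq c d) s Q := by
  obtain ⟨t, s', h₁, u, s'', h₂, hQ⟩ := h
  exact ⟨_, _, .seq h₁ h₂, hQ⟩

theorem wp_ite {b c d} (h₁ : b.eval s → wp O c s fun t s' => Q (t + 1) s')
    (h₂ : ¬ b.eval s → wp O d s fun t s' => Q (t + 1) s') : wp O (.ite b c d) s Q := by
  by_cases hb : b.eval s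
  · obtain ⟨t, s', h, hQ⟩ := h₁ hb
    exact ⟨_, _, .ite_true hb h, hQ⟩
  · obtain ⟨t, s', h, hQ⟩ := h₂ hb
    exact ⟨_, _, .ite_false hb h, hQ⟩

/-- Loops with invariant `I` and a potential `φ` that pays for the running time. -/
theorem wp_loop {b c} (I : State → Prop) (φ : State → ℕ)
    (h : ∀ s, I s → b.eval s → wp O c s fun t s' => I s' ∧ φ s' + t + 1 ≤ φ s) (hs : I s) :
    wp O (.loop b c) s fun t s' => t ≤ φ s + 1 ∧ I s' ∧ ¬ b.eval s' := by
  induction hk : φ s using Nat.strong_induction_on generalizing s with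
  | _ k ih =>
    by_cases hb : b.eval s
    · obtain ⟨t, s', h₁, hI, hφ⟩ := h s hs hb
      obtain ⟨u, s'', h₂, hu, hI'⟩ := ih (φ s') (by omega) hI rfl
      exact ⟨_, _, .loop_true hb h₁ h₂, by omega, hI'⟩
    · exact ⟨_, _, .loop_false hb, by omega, hs, hb⟩

/-- `for x < n do c`, where `n` is index variable `0`. -/
def forN (x : ℕ) (c : Cmd) : Cmd :=
  .seq (.iset x (.const 0))
    (.loop (.ilt (.var x) (.var 0)) (.seq c (.iset x (.add (.var x) (.const 1)))))

/-- Each round costs the body plus 3 steps: loop test, sequencing and increment. The final 3 are the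
initialization, its sequencing and the failing test. The counter is changed outside the body, hence
`hI`. -/
theorem wp_forN {x n : ℕ} {c : Cmd} (C : ℕ) (I : ℕ → State → Prop) (hx : x ≠ 0)
    (hc : c.writesIv x = false) (hc₀ : c.writesIv 0 = false) (hn : s.iv 0 = n)
    (hI : ∀ k s v, I k s → I k (s.setIv x v))
    (h : ∀ k s, k < n → s.iv 0 = n → s.iv x = k → I k s →
      wp O c s fun t s' => t ≤ C ∧ I (k + 1) s') (hs : I 0 s) :
    wp O (forN x c) s fun t s' => t ≤ n * (C + 3) + 3 ∧ I n s' := by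
  refine wp_seq (wp_iset ?_)
  refine (wp_loop (fun s => s.iv 0 = n ∧ s.iv x ≤ n ∧ I (s.iv x) s)
    (fun s => (n - s.iv x) * (C + 3)) ?_ ?_).mono ?_
  · rintro s ⟨h₀, -, hIs⟩ hb
    simp only [Test.eval, IExpr.eval, h₀] at hb
    refine wp_seq ((h _ s hb h₀ rfl hIs).mono ?_)
    rintro t s' hF ⟨ht, hI'⟩
    refine wp_iset ?_
    have e₁ := hF.iv x hc
    have e₂ := hF.iv 0 hc₀
    simp only [IExpr.eval, State.setIv_iv, if_true, hx.symm, if_false, e₁, e₂, h₀, true_and]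
    refine ⟨⟨hb, hI _ _ _ hI'⟩, ?_⟩
    obtain ⟨d, hd⟩ : ∃ d, n - s.iv x = d + 1 := ⟨n - s.iv x - 1, by omega⟩
    rw [hd, show n - (s.iv x + 1) = d by omega]
    nlinarith
  · simpa [IExpr.eval, hx.symm, hn] using hI 0 s 0 hs
  · rintro t s' - ⟨ht, ⟨h₀, h₁, h₂⟩, hb⟩
    simp only [Test.eval, IExpr.eval, h₀] at hb
    have : s'.iv x = n := by omega
    rw [this] at h₂
    simp [IExpr.eval] at ht
    exact ⟨by omega, h₂⟩

end

/-! ### Array segments as lists -/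

/-- The entries `A a, …, A (b - 1)`. -/
def slice (A : ℕ → ℕ) (a b : ℕ) : List ℕ := (List.range' a (b - a)).map A

section slice
variable {A A' : ℕ → ℕ} {a b c k y : ℕ}

theorem slice_of_le (h : b ≤ a) : slice A a b = [] := by
  simp [slice, Nat.sub_eq_zero_of_le h]

theorem slice_cons (h : a < b) : slice A a b = A a :: slice A (a + 1) b := by
  obtain ⟨d, rfl⟩ := Nat.exists_eq_add_of_lt h
  simp [slice, show a + d + 1 - a = d + 1 by omega, show a + d + 1 - (a + 1) = d by omega,
    List.range'_succ]

theorem slice_append (h₁ : a ≤ b) (h₂ : b ≤ c) : slice A a b ++ slice A b c = slice A a c := by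
  rw [slice, slice, slice, ← List.map_append]
  obtain ⟨d, rfl⟩ := Nat.exists_eq_add_of_le h₁
  obtain ⟨e, rfl⟩ := Nat.exists_eq_add_of_le h₂
  simp [show a + d + e - a = d + e by omega]

theorem slice_succ (h : a ≤ b) : slice A a (b + 1) = slice A a b ++ [A b] := by
  rw [← slice_append h (Nat.le_succ b), slice_cons (Nat.lt_succ_self b), slice_of_le le_rfl]

theorem slice_congr (h : ∀ k, a ≤ k → k < b → A k = A' k) : slice A a b = slice A' a b := by
  refine List.map_congr_left fun k hk => ?_
  rw [List.mem_range'_1] at hk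
  exact h k hk.1 (by omega)

theorem mem_slice : y ∈ slice A a b ↔ ∃ k, a ≤ k ∧ k < b ∧ A k = y := by
  simp only [slice, List.mem_map, List.mem_range'_1]
  refine exists_congr fun k => ⟨?_, ?_⟩
  · rintro ⟨⟨h₁, h₂⟩, h₃⟩
    exact ⟨h₁, by omega, h₃⟩
  · rintro ⟨h₁, h₂, h₃⟩
    exact ⟨⟨h₁, by omega⟩, h₃⟩

theorem length_slice : (slice A a b).length = b - a := by simp [slice]

end slice

/-! ### Stable merging -/

/-- The order in which items with keys `K` are sorted: by decreasing key. -/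
noncomputable def desc (K : ℕ → ℝ) (x y : ℕ) : Bool := decide (K y ≤ K x)

/-- `l` is the stable sort of `l₀` by decreasing key. -/
structure StableSort (K : ℕ → ℝ) (l₀ l : List ℕ) : Prop where
  perm : l.Perm l₀
  pairwise : ∀ R : ℕ → ℕ → Prop, l₀.Pairwise R →
    l.Pairwise fun x y => K y < K x ∨ (K x = K y ∧ R x y)

/-- For each item of `R`, the number of items of `L` still to be merged at the moment when the
item is chosen from `R`. -/
noncomputable def mergeCount (K : ℕ → ℝ) (z : ℕ) : List ℕ → List ℕ → ℕ
  | [], _ => 0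
  | _ :: _, [] => 0
  | x :: L, y :: R =>
    if K y ≤ K x then mergeCount K z L (y :: R)
    else (if z = y then (x :: L).length else 0) + mergeCount K z (x :: L) R
  termination_by L R => L.length + R.length

/-- The number of items of `l` in front of the first `z` that have a smaller key than `z`. -/
noncomputable def invs (K : ℕ → ℝ) : List ℕ → ℕ → ℕ
  | [], _ => 0
  | x :: l, z => if x = z then 0 else (if K x < K z then 1 else 0) + invs K l z

theorem StableSort.sorted {K : ℕ → ℝ} {l₀ l : List ℕ} (h : StableSort K l₀ l) :
    l.Pairwise fun x y => K y ≤ K x :=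
  (h.pairwise (fun _ _ => True) (List.pairwise_of_forall fun _ _ => trivial)).imp
    fun h => h.elim le_of_lt fun h => h.1.ge

/-- An item of `M` overtakes an item of `L` only if its key is strictly larger, so `R` across the
two lists is needed only from `L` to `M`. -/
theorem pairwise_merge_of_cross {K : ℕ → ℝ} {R : ℕ → ℕ → Prop} {L M : List ℕ}
    (hL : L.Pairwise fun x y => K y < K x ∨ (K x = K y ∧ R x y))
    (hM : M.Pairwise fun x y => K y < K x ∨ (K x = K y ∧ R x y))
    (hLM : ∀ x ∈ L, ∀ y ∈ M, R x y) :
    (L.merge M (desc K)).Pairwise fun x y => K y < K x ∨ (K x = K y ∧ R x y) := by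
  induction L, M using mergeCount.induct K with
  | case1 M => simpa using hM
  | case2 x L => simpa using hL
  | case3 x L y M hxy ih =>
    rw [List.cons_merge_cons_pos _ _ _ (by simpa [desc] using hxy), List.pairwise_cons]
    rw [List.pairwise_cons] at hL
    refine ⟨fun z hz => ?_, ih hL.2 hM fun u hu => hLM u (List.mem_cons_of_mem _ hu)⟩
    rw [List.mem_merge] at hz
    obtain hz | hz := hz
    · exact hL.1 z hz
    · have hR := hLM x List.mem_cons_self z hz
      have hzy : K z ≤ K y := by
        obtain rfl | hz := List.mem_cons.1 hz
        · exact le_rfl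
        · exact ((List.pairwise_cons.1 hM).1 z hz).elim le_of_lt fun h => h.1.ge
      exact (hzy.trans hxy).lt_or_eq.imp_right fun h => ⟨h.symm, hR⟩
  | case4 x L y M hxy ih =>
    rw [List.cons_merge_cons_neg _ _ _ (by simpa [desc] using hxy), List.pairwise_cons]
    rw [List.pairwise_cons] at hM
    refine ⟨fun z hz => ?_, ih hL hM.2 fun u hu v hv => hLM u hu v (List.mem_cons_of_mem _ hv)⟩
    rw [List.mem_merge] at hz
    obtain hz | hz := hz
    · left
      refine lt_of_le_of_lt ?_ (not_le.1 hxy)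
      obtain rfl | hz := List.mem_cons.1 hz
      · exact le_rfl
      · exact ((List.pairwise_cons.1 hL).1 z hz).elim le_of_lt fun h => h.1.ge
    · exact hM.1 z hz

theorem StableSort.merge {K : ℕ → ℝ} {L₀ L M₀ M : List ℕ} (hL : StableSort K L₀ L)
    (hM : StableSort K M₀ M) : StableSort K (L₀ ++ M₀) (L.merge M (desc K)) where
  perm := (List.merge_perm_append _).trans (hL.perm.append hM.perm)
  pairwise R hR := by
    rw [List.pairwise_append] at hR
    exact pairwise_merge_of_cross (hL.pairwise R hR.1) (hM.pairwise R hR.2.1)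
      fun x hx y hy => hR.2.2 x (hL.perm.subset hx) y (hM.perm.subset hy)

theorem mergeCount_of_notMem {K : ℕ → ℝ} {L M : List ℕ} {z : ℕ} (hz : z ∉ M) :
    mergeCount K z L M = 0 := by
  induction L, M using mergeCount.induct K with
  | case1 M => simp [mergeCount]
  | case2 x L => simp [mergeCount]
  | case3 x L y M hxy ih => rw [mergeCount, if_pos hxy, ih hz]
  | case4 x L y M hxy ih =>
    rw [List.mem_cons, not_or] at hz
    rw [mergeCount, if_neg hxy, ih hz.2, if_neg hz.1]

/-- When `z` is chosen, the items of `L` already merged have keys at least `K z`, and those that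
remain lie below the head of the rest, whose key is smaller than `K z`. So the length of the rest is
the number wanted. -/
theorem mergeCount_eq {K : ℕ → ℝ} {L M : List ℕ} {z : ℕ}
    (hL : L.Pairwise fun x y => K y ≤ K x) (hM : M.Pairwise fun x y => K y ≤ K x)
    (hn : M.Nodup) (hz : z ∈ M) : mergeCount K z L M = L.countP fun x => decide (K x < K z) := by
  induction L, M using mergeCount.induct K with
  | case1 M => simp [mergeCount]
  | case2 x L => simp at hz
  | case3 x L y M hxy ih =>
    rw [mergeCount, if_pos hxy, ih hL.of_cons hM hn hz, List.countP_cons_of_neg]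
    have hzy : K z ≤ K y := by
      obtain rfl | hz := List.mem_cons.1 hz
      · exact le_rfl
      · exact (List.pairwise_cons.1 hM).1 z hz
    simpa using hzy.trans hxy
  | case4 x L y M hxy ih =>
    rw [mergeCount, if_neg hxy]
    obtain rfl | hz' := List.mem_cons.1 hz
    · rw [if_pos rfl, mergeCount_of_notMem (List.nodup_cons.1 hn).1, add_zero, eq_comm,
        List.countP_eq_length]
      intro u hu
      have : K u ≤ K x := by
        obtain rfl | hu := List.mem_cons.1 hu
        · exact le_rfl
        · exact (List.pairwise_cons.1 hL).1 u hu
      simpa using this.trans_lt (not_le.1 hxy)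
    · rw [if_neg, zero_add, ih hL hM.of_cons hn.of_cons hz']
      rintro rfl
      exact (List.nodup_cons.1 hn).1 hz'

theorem invs_append_of_mem {K : ℕ → ℝ} {L M : List ℕ} {z : ℕ} (hz : z ∈ L) :
    invs K (L ++ M) z = invs K L z := by
  induction L with
  | nil => simp at hz
  | cons x L ih =>
    rw [List.cons_append, invs, invs]
    split_ifs with h <;> try rfl
    all_goals rw [ih ((List.mem_cons.1 hz).resolve_left (Ne.symm h))]

theorem invs_append_of_notMem {K : ℕ → ℝ} {L M : List ℕ} {z : ℕ} (hz : z ∉ L) :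
    invs K (L ++ M) z = (L.countP fun x => decide (K x < K z)) + invs K M z := by
  induction L with
  | nil => simp
  | cons x L ih =>
    rw [List.mem_cons, not_or] at hz
    rw [List.cons_append, invs, if_neg (Ne.symm hz.1), ih hz.2, List.countP_cons]
    simp only [decide_eq_true_eq]
    ring

/-- In a list sorted by `K`, with ties sorted by `K'`, the pairs in the wrong order for `K'` are
those that are ordered differently by `K` and by `K'`. -/
theorem invs_eq_countP {K K' : ℕ → ℝ} {l : List ℕ} {z : ℕ}
    (hl : l.Pairwise fun x y => K y < K x ∨ (K x = K y ∧ K' y ≤ K' x)) (hz : z ∈ l)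
    (hn : l.Nodup) :
    invs K' l z = l.countP fun x => decide (K z < K x ∧ K' x < K' z) := by
  induction l with
  | nil => simp at hz
  | cons x l ih =>
    rw [List.pairwise_cons] at hl
    rw [List.nodup_cons] at hn
    rw [invs]
    split_ifs with hx hK
    · subst hx
      rw [eq_comm, List.countP_eq_zero]
      intro y hy
      simp only [decide_eq_true_eq, not_and]
      intro h
      obtain rfl | hy := List.mem_cons.1 hy
      · exact absurd h (lt_irrefl _)
      · obtain h' | h' := hl.1 y hy
        · exact absurd h h'.not_gt
        · exact absurd h h'.1.not_lt
    · have hz' := (List.mem_cons.1 hz).resolve_left (Ne.symm hx)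
      rw [List.countP_cons_of_pos, ih hl.2 hz' hn.2, add_comm]
      simp only [decide_eq_true_eq]
      exact ⟨(hl.1 z hz').resolve_right fun h => absurd hK h.2.not_gt, hK⟩
    · have hz' := (List.mem_cons.1 hz).resolve_left (Ne.symm hx)
      rw [List.countP_cons_of_neg, ih hl.2 hz' hn.2, zero_add]
      simp [hK]

/-! ### Bottom-up merge sort

The items in index array `2` are sorted by decreasing key (real array `5`). Index array `3` is
scratch space. For each item, the number of items that have a smaller key and were in front of it is
added to index array `4`. -/

def mergeStep : Cmd :=
  .seq
    (.ite (.and (.ilt (.var 5) (.var 3)) (.not (.and (.ilt (.var 6) (.var 4))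
        (.rlt (.get 5 (.get 2 (.var 5))) (.get 5 (.get 2 (.var 6)))))))
      (.seq (.iput 3 (.var 7) (.get 2 (.var 5))) (.iset 5 (.add (.var 5) (.const 1))))
      (.seq (.iput 4 (.get 2 (.var 6))
          (.add (.get 4 (.get 2 (.var 6))) (.sub (.var 3) (.var 5))))
        (.seq (.iput 3 (.var 7) (.get 2 (.var 6))) (.iset 6 (.add (.var 6) (.const 1))))))
    (.iset 7 (.add (.var 7) (.const 1)))

def mergeLoop : Cmd := .loop (.ilt (.var 7) (.var 4)) mergeStep

def copyLoop : Cmd := .loop (.ilt (.var 7) (.var 4))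
  (.seq (.iput 2 (.var 7) (.get 3 (.var 7))) (.iset 7 (.add (.var 7) (.const 1))))

/-- Merge the two blocks of length `h` (index variable `1`) that start at index variable `2`. -/
def mergeBlocks : Cmd :=
  .seq (.iset 3 (.sub (.var 0) (.sub (.var 0) (.add (.var 2) (.var 1)))))
  (.seq (.iset 4 (.sub (.var 0) (.sub (.var 0) (.add (.add (.var 2) (.var 1)) (.var 1)))))
  (.seq (.iset 5 (.var 2))
  (.seq (.iset 6 (.var 3))
  (.seq (.iset 7 (.var 2))
  (.seq mergeLoop
  (.seq (.iset 7 (.var 2))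
  (.seq copyLoop
  (.iset 2 (.var 4)))))))))

def mergePass : Cmd :=
  .seq (.iset 2 (.const 0))
  (.seq (.loop (.ilt (.var 2) (.var 0)) mergeBlocks)
  (.iset 1 (.add (.var 1) (.var 1))))

def mergeSort : Cmd :=
  .seq (.iset 1 (.const 1)) (.loop (.ilt (.var 1) (.var 0)) mergePass)

section
variable {O : Oracle} {K : ℕ → ℝ} {s : State}

/-- The invariant consists of two conservation laws: the output so far followed by the merge of the
two rests is constant, and so is each counter plus its future increments. -/
theorem wp_mergeLoop {a m e : ℕ} {P C : ℕ → ℕ} (ham : a ≤ m) (hme : m ≤ e)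
    (hK : s.ra 5 = K) (hP : s.ia 2 = P) (hC : s.ia 4 = C) (h₃ : s.iv 3 = m) (h₄ : s.iv 4 = e)
    (h₅ : s.iv 5 = a) (h₆ : s.iv 6 = m) (h₇ : s.iv 7 = a) :
    wp O mergeLoop s fun t s' => t ≤ (e - a) * 10 + 1 ∧
      slice (s'.ia 3) a e = (slice P a m).merge (slice P m e) (desc K) ∧
      ∀ z, s'.ia 4 z = C z + mergeCount K z (slice P a m) (slice P m e) := by
  refine (wp_loop (fun s => s.ra 5 = K ∧ s.ia 2 = P ∧ s.iv 3 = m ∧ s.iv 4 = e ∧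
      a ≤ s.iv 5 ∧ s.iv 5 ≤ m ∧ m ≤ s.iv 6 ∧ s.iv 6 ≤ e ∧ s.iv 7 + m = s.iv 5 + s.iv 6 ∧
      slice (s.ia 3) a (s.iv 7) ++ (slice P (s.iv 5) m).merge (slice P (s.iv 6) e) (desc K) =
        (slice P a m).merge (slice P m e) (desc K) ∧
      ∀ z, s.ia 4 z + mergeCount K z (slice P (s.iv 5) m) (slice P (s.iv 6) e) =
        C z + mergeCount K z (slice P a m) (slice P m e))
    (fun s => (e - s.iv 7) * 10) ?_ ?_).mono ?_
  · rintro s ⟨hK, hP, h₃, h₄, h₅, h₅', h₆, h₆', h₇, hQ, hC⟩ hb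
    simp only [Test.eval, IExpr.eval, h₄] at hb
    have hφ : (e - (s.iv 7 + 1)) * 10 + 9 + 1 ≤ (e - s.iv 7) * 10 := by omega
    refine wp_seq (wp_ite (fun ht => ?_) fun ht => ?_)
    all_goals
      simp only [Test.eval, IExpr.eval, RExpr.eval, hK, hP, h₃, h₄] at ht
    · refine wp_seq (wp_iput (wp_iset (wp_iset ?_)))
      have hi : s.iv 5 < m := ht.1
      simp only [IExpr.eval, State.setIv_iv, State.setIa_iv, State.setIv_ia, State.setIa_ia,
        State.setIv_ra, State.setIa_ra, hK, hP, h₃, h₄, Nat.reduceEqDiff,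
        if_true, if_false, true_and]
      refine ⟨⟨by omega, by omega, by omega, by omega, by omega, ?_, ?_⟩, by omega⟩
      · rw [← hQ, slice_succ (by omega), Function.update_self, List.append_assoc]
        congr 1
        · exact slice_congr fun k _ hk => Function.update_of_ne (by omega) _ _
        rw [slice_cons hi]
        by_cases hj : s.iv 6 < e
        · rw [slice_cons hj, List.cons_merge_cons_pos]
          · rfl
          · simpa [desc] using fun h => ht.2 ⟨hj, h⟩
        · rw [slice_of_le (a := s.iv 6) (by omega)]
          simp
      · intro z
        rw [← hC z, slice_cons hi]
        by_cases hj : s.iv 6 < e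
        · rw [slice_cons hj, mergeCount, if_pos]
          simpa using fun h => ht.2 ⟨hj, h⟩
        · rw [slice_of_le (a := s.iv 6) (by omega)]
          cases slice P (s.iv 5 + 1) m <;> simp [mergeCount]
    · refine wp_seq (wp_iput (wp_seq (wp_iput (wp_iset (wp_iset ?_)))))
      -- If the right block were exhausted, the left one would not be, and the test would have
      -- chosen it.
      have hj : s.iv 6 < e := by
        by_contra hj
        exact ht ⟨by omega, fun h => hj h.1⟩
      simp only [IExpr.eval, State.setIv_iv, State.setIa_iv, State.setIv_ia, State.setIa_ia,
        State.setIv_ra, State.setIa_ra, hK, hP, h₃, h₄, Nat.reduceEqDiff,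
        if_true, if_false, true_and]
      refine ⟨⟨by omega, by omega, by omega, by omega, by omega, ?_, ?_⟩, by omega⟩
      · rw [← hQ, slice_succ (by omega), Function.update_self, List.append_assoc]
        congr 1
        · exact slice_congr fun k _ hk => Function.update_of_ne (by omega) _ _
        rw [slice_cons hj]
        by_cases hi : s.iv 5 < m
        · rw [slice_cons hi, List.cons_merge_cons_neg]
          · rfl
          · simpa [desc] using not_not.1 fun h => ht ⟨hi, fun h' => h h'.2⟩
        · rw [slice_of_le (a := s.iv 5) (by omega)]
          simp
      · intro z
        rw [← hC z, slice_cons hj]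
        by_cases hi : s.iv 5 < m
        · have hlt : K (P (s.iv 5)) < K (P (s.iv 6)) :=
            not_not.1 fun h => ht ⟨hi, fun h' => h h'.2⟩
          rw [slice_cons hi, mergeCount, if_neg hlt.not_ge, Function.update_apply]
          simp only [List.length_cons, length_slice]
          split_ifs with hz
          · subst hz
            omega
          · omega
        · rw [slice_of_le (a := s.iv 5) (by omega), mergeCount, mergeCount,
            Function.update_apply]
          split_ifs with hz
          · subst hz
            omega
          · rfl
  · simp [hK, hP, hC, h₃, h₄, h₅, h₆, h₇, ham, hme, slice_of_le]
  · rintro t s' - ⟨ht, ⟨-, -, -, h₄, h₅, h₅', h₆, h₆', h₇', hQ, hC⟩, hb⟩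
    simp only [Test.eval, IExpr.eval, h₄] at hb
    have e₅ : s'.iv 5 = m := by omega
    have e₆ : s'.iv 6 = e := by omega
    have e₇ : s'.iv 7 = e := by omega
    simp only [e₅, e₆, e₇] at hQ hC
    rw [h₇] at ht
    refine ⟨ht, ?_, fun z => ?_⟩
    · simpa [slice_of_le] using hQ
    · simpa [slice_of_le, mergeCount] using hC z

theorem wp_copyLoop {a e : ℕ} {P Q : ℕ → ℕ} (hae : a ≤ e) (hP : s.ia 2 = P) (hQ : s.ia 3 = Q)
    (h₄ : s.iv 4 = e) (h₇ : s.iv 7 = a) :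
    wp O copyLoop s fun t s' => t ≤ (e - a) * 4 + 1 ∧
      s'.ia 2 = fun x => if a ≤ x ∧ x < e then Q x else P x := by
  refine (wp_loop (fun s => s.ia 3 = Q ∧ s.iv 4 = e ∧ a ≤ s.iv 7 ∧ s.iv 7 ≤ e ∧
      s.ia 2 = fun x => if a ≤ x ∧ x < s.iv 7 then Q x else P x)
    (fun s => (e - s.iv 7) * 4) ?_ ?_).mono ?_
  · rintro s ⟨hQ, h₄, h₇, h₇', hP⟩ hb
    simp only [Test.eval, IExpr.eval, h₄] at hb
    refine wp_seq (wp_iput (wp_iset ?_))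
    simp only [IExpr.eval, State.setIv_iv, State.setIa_iv, State.setIv_ia, State.setIa_ia,
      hQ, h₄, Nat.reduceEqDiff, if_true, if_false, true_and]
    refine ⟨⟨by omega, by omega, ?_⟩, by omega⟩
    ext x
    rw [Function.update_apply, hP]
    dsimp only
    split_ifs <;> first | rfl | (subst_vars; omega)
  · refine ⟨hQ, h₄, h₇.ge, by omega, ?_⟩
    ext x
    rw [hP, if_neg (by omega)]
  · rintro t s' - ⟨ht, ⟨-, h₄, h₇', h₇'', hP⟩, hb⟩
    simp only [Test.eval, IExpr.eval, h₄] at hb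
    rw [h₇] at ht
    rw [show s'.iv 7 = e by omega] at hP
    exact ⟨ht, hP⟩

theorem wp_mergeBlocks {n h a m e : ℕ} {P C : ℕ → ℕ} (hm : m = min (a + h) n)
    (he : e = min (a + h + h) n) (han : a ≤ n) (hK : s.ra 5 = K) (hP : s.ia 2 = P)
    (hC : s.ia 4 = C) (h₀ : s.iv 0 = n) (h₁ : s.iv 1 = h) (h₂ : s.iv 2 = a) :
    wp O mergeBlocks s fun t s' => t ≤ (e - a) * 14 + 17 ∧ s'.iv 2 = e ∧
      slice (s'.ia 2) a e = (slice P a m).merge (slice P m e) (desc K) ∧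
      (∀ x, ¬ (a ≤ x ∧ x < e) → s'.ia 2 x = P x) ∧
      ∀ z, s'.ia 4 z = C z + mergeCount K z (slice P a m) (slice P m e) := by
  -- With truncated subtraction `n - (n - x)` is `min x n`; this cuts off the last, incomplete
  -- blocks.
  have hm' : n - (n - (a + h)) = m := by omega
  have he' : n - (n - (a + h + h)) = e := by omega
  refine wp_seq (wp_iset (wp_seq (wp_iset (wp_seq (wp_iset (wp_seq (wp_iset (wp_seq (wp_iset
    (wp_seq ((wp_mergeLoop (K := K) (a := a) (m := m) (e := e) (P := P) (C := C) (by omega) (by omega)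
      ?_ ?_ ?_ ?_ ?_ ?_ ?_ ?_).mono ?_)))))))))))
  all_goals try (simp [IExpr.eval, hK, hP, hC, h₀, h₁, h₂, hm', he']; done)
  rintro t s' hF ⟨ht, hQ, hC'⟩
  refine wp_seq (wp_iset (wp_seq ((wp_copyLoop (a := a) (e := e) (P := P) (by omega)
    ?_ rfl ?_ ?_).mono ?_)))
  · simp [hF.ia 2 rfl, hP]
  · simp [hF.iv 4 rfl, IExpr.eval, h₀, h₁, h₂, he']
  · simp [hF.iv 2 rfl, IExpr.eval, h₂]
  rintro t' s'' hF' ⟨ht', hP'⟩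
  refine wp_iset ?_
  have e₄ : s''.iv 4 = e := by
    rw [hF'.iv 4 rfl]
    simp [hF.iv 4 rfl, IExpr.eval, h₀, h₁, h₂, he']
  simp only [State.setIv_iv, State.setIv_ia, if_true, IExpr.eval, e₄, true_and]
  refine ⟨by omega, ?_, ?_, ?_⟩
  · rw [← hQ, hP']
    exact slice_congr fun k h₁ h₂ => by simp [h₁, h₂]
  · intro x hx
    rw [hP']
    simp [hx]
  · intro z
    rw [hF'.ia 4 rfl]
    simpa using hC' z

/-- The block of positions `a, …, b - 1` is sorted (originally it held `P₀`), and its inversions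
have been added to the counters `C₀`. -/
structure BlockSorted (K : ℕ → ℝ) (P₀ C₀ P C : ℕ → ℕ) (a b : ℕ) : Prop where
  sort : StableSort K (slice P₀ a b) (slice P a b)
  count : ∀ z ∈ slice P₀ a b, C z = C₀ z + invs K (slice P₀ a b) z

variable {P₀ C₀ P C P' C' : ℕ → ℕ} {a m e n h : ℕ}

theorem BlockSorted.of_le (h : e ≤ a) : BlockSorted K P₀ C₀ P C a e := by
  constructor
  · rw [slice_of_le h, slice_of_le h]
    exact ⟨List.Perm.refl _, fun _ _ => List.Pairwise.nil⟩
  · simp [slice_of_le h]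

theorem BlockSorted.singleton : BlockSorted K P₀ C₀ P₀ C₀ a (a + 1) := by
  have : slice P₀ a (a + 1) = [P₀ a] := by
    rw [slice_cons (Nat.lt_succ_self a), slice_of_le le_rfl]
  constructor
  · rw [this]
    exact ⟨List.Perm.refl _, fun _ _ => List.pairwise_singleton _ _⟩
  · simp [this, invs]

theorem BlockSorted.congr (hb : BlockSorted K P₀ C₀ P C a e)
    (hP : ∀ x, a ≤ x → x < e → P' x = P x) (hC : ∀ z ∈ slice P₀ a e, C' z = C z) :
    BlockSorted K P₀ C₀ P' C' a e where
  sort := by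
    rw [slice_congr hP]
    exact hb.sort
  count z hz := by rw [hC z hz, hb.count z hz]

/-- Inversions refer to the original order `P₀`. Those inside a half have been counted already.
Those between the halves belong to items of the right half, and since they only count smaller keys
on the left, sorting the left half does not alter them. -/
theorem BlockSorted.merge (ham : a ≤ m) (hme : m ≤ e) (hn : (slice P₀ a e).Nodup)
    (h₁ : BlockSorted K P₀ C₀ P C a m) (h₂ : BlockSorted K P₀ C₀ P C m e)
    (hP : slice P' a e = (slice P a m).merge (slice P m e) (desc K))
    (hC : ∀ z, C' z = C z + mergeCount K z (slice P a m) (slice P m e)) :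
    BlockSorted K P₀ C₀ P' C' a e := by
  rw [← slice_append ham hme, List.nodup_append] at hn
  refine ⟨?_, fun z hz => ?_⟩
  · rw [hP, ← slice_append ham hme]
    exact h₁.sort.merge h₂.sort
  · rw [hC]
    rw [← slice_append ham hme] at hz ⊢
    by_cases hz₁ : z ∈ slice P₀ a m
    · have hz₂ : z ∉ slice P m e := fun h =>
        hn.2.2 z hz₁ z (h₂.sort.perm.subset h) rfl
      rw [invs_append_of_mem hz₁, h₁.count z hz₁, mergeCount_of_notMem hz₂, add_zero]
    · have hz₂ := (List.mem_append.1 hz).resolve_left hz₁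
      rw [invs_append_of_notMem hz₁, h₂.count z hz₂, mergeCount_eq h₁.sort.sorted h₂.sort.sorted
        (h₂.sort.perm.nodup_iff.2 hn.2.1) (h₂.sort.perm.symm.subset hz₂),
        h₁.sort.perm.countP_eq]
      ring

theorem notMem_slice_of_disjoint {a b c d : ℕ} (hn : (slice P 0 n).Nodup) (hb : b ≤ n)
    (hd : d ≤ n) (h : b ≤ c ∨ d ≤ a) {z : ℕ} (hz : z ∈ slice P a b) : z ∉ slice P c d := by
  rintro hz'
  obtain ⟨x, hx, hx', rfl⟩ := mem_slice.1 hz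
  obtain ⟨y, hy, hy', e⟩ := mem_slice.1 hz'
  rw [slice, List.nodup_map_iff_inj_on List.nodup_range'] at hn
  have := hn x (List.mem_range'_1.2 (by omega)) y (List.mem_range'_1.2 (by omega)) e.symm
  omega

/-- Behind the cursor all blocks of length `h + h` are finished, and from it on the blocks of length
`h` are still valid. Cutting block ends at `n` makes the statement meaningful for every `k`, since
blocks beyond the end are empty. -/
theorem wp_mergePass (hn : (slice P₀ 0 n).Nodup) (h₀ : s.iv 0 = n) (h₁ : s.iv 1 = h)
    (hpos : 0 < h) (hK : s.ra 5 = K)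
    (hs : ∀ k, BlockSorted K P₀ C₀ (s.ia 2) (s.ia 4) (min (k * h) n) (min ((k + 1) * h) n)) :
    wp O mergePass s fun t s' => t ≤ n * 32 + 5 ∧ s'.iv 1 = h + h ∧
      ∀ k, BlockSorted K P₀ C₀ (s'.ia 2) (s'.ia 4) (min (k * (h + h)) n)
        (min ((k + 1) * (h + h)) n) := by
  refine wp_seq (wp_iset (wp_seq ((wp_loop (fun s => s.iv 0 = n ∧ s.iv 1 = h ∧ s.ra 5 = K ∧
    ∃ m, s.iv 2 = min (m * (h + h)) n ∧
      (∀ k < m, BlockSorted K P₀ C₀ (s.ia 2) (s.ia 4) (min (k * (h + h)) n)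
        (min ((k + 1) * (h + h)) n)) ∧
      ∀ k ≥ m + m, BlockSorted K P₀ C₀ (s.ia 2) (s.ia 4) (min (k * h) n) (min ((k + 1) * h) n))
    (fun s => (n - s.iv 2) * 32) ?_ ?_).mono ?_)))
  · rintro s ⟨h₀, h₁, hK, m, h₂, hlt, hge⟩ hb
    simp only [Test.eval, IExpr.eval, h₀] at hb
    have e₂ : m * (h + h) = s.iv 2 := by omega
    refine (wp_mergeBlocks (K := K) (P := s.ia 2) (C := s.ia 4) rfl rfl hb.le hK rfl rfl h₀ h₁
      rfl).mono ?_
    rintro t s' hF ⟨ht, h₂', hM, hP, hC⟩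
    have b₁ := hge (m + m) le_rfl
    have b₂ := hge (m + m + 1) (by omega)
    rw [show (m + m) * h = s.iv 2 by rw [← e₂]; ring,
      show (m + m + 1) * h = s.iv 2 + h by rw [← e₂]; ring, min_eq_left hb.le] at b₁
    rw [show (m + m + 1) * h = s.iv 2 + h by rw [← e₂]; ring,
      show (m + m + 1 + 1) * h = s.iv 2 + h + h by rw [← e₂]; ring] at b₂
    have e₃ : (m + 1) * (h + h) = s.iv 2 + h + h := by rw [← e₂]; ring
    have b := BlockSorted.merge (by omega) (by omega)
      (hn.sublist (by
        rw [← slice_append (Nat.zero_le (s.iv 2)) hb.le, ← slice_append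
          (show s.iv 2 ≤ min (s.iv 2 + h + h) n by omega) (show _ ≤ n by omega)]
        exact (List.sublist_append_left _ _).trans (List.sublist_append_right _ _))) b₁ b₂ hM hC
    -- A merge raises only counters of items in its right half, and without repetitions these do not
    -- occur in other blocks.
    have hcnt : ∀ c d, d ≤ n → (d ≤ s.iv 2 ∨ min (s.iv 2 + h + h) n ≤ c) →
        ∀ z ∈ slice P₀ c d, s'.ia 4 z = s.ia 4 z := by
      intro c d hd hcd z hz
      rw [hC, mergeCount_of_notMem, add_zero]
      intro hz'
      exact notMem_slice_of_disjoint hn hd (min_le_right _ _) (by omega) hz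
        (b₂.sort.perm.subset hz')
    refine ⟨⟨by rw [hF.iv 0 rfl, h₀], by rw [hF.iv 1 rfl, h₁], by rw [hF.ra 5 rfl, hK], m + 1,
      by rw [h₂', e₃], fun k hk => ?_, fun k hk => ?_⟩, by omega⟩
    · obtain rfl | hk := (Nat.lt_succ_iff.1 hk).eq_or_lt
      · rw [e₃, e₂, min_eq_left hb.le]
        exact b
      · have hk' : (k + 1) * (h + h) ≤ s.iv 2 := by
          rw [← e₂]; exact Nat.mul_le_mul_right _ hk
        exact (hlt k hk).congr (fun x _ hx => hP x (by omega))
          (hcnt _ _ (min_le_right _ _) (by omega))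
    · have hk' : s.iv 2 + h + h ≤ k * h := by
        rw [← e₃, ← mul_two, ← mul_assoc, mul_right_comm]
        exact Nat.mul_le_mul_right _ (by omega)
      exact (hge k (by omega)).congr (fun x hx hx' => hP x (by omega))
        (hcnt _ _ (min_le_right _ _) (by omega))
  · simp only [State.setIv_iv, State.setIv_ra, State.setIv_ia, Nat.reduceEqDiff, if_true,
      if_false, IExpr.eval, h₀, h₁, hK, true_and]
    exact ⟨0, by simp, by simp, fun k _ => hs k⟩
  · rintro t s' - ⟨ht, ⟨h₀', h₁', -, m, h₂, hlt, -⟩, hb⟩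
    simp only [Test.eval, IExpr.eval, h₀'] at hb
    refine wp_iset ?_
    simp only [State.setIv_iv, State.setIv_ia, if_true, IExpr.eval, h₁', true_and] at ht ⊢
    refine ⟨by omega, fun k => ?_⟩
    by_cases hk : k < m
    · exact hlt k hk
    · have : m * (h + h) ≤ k * (h + h) := Nat.mul_le_mul_right _ (not_lt.1 hk)
      exact BlockSorted.of_le (by omega)

/-- Running time of `mergeSort`. -/
def sortTime (n : ℕ) : ℕ := (Nat.log 2 n + 1) * (n * 32 + 6) + 3

/-- The block length is always a power of two, and the potential pays for the doublings that remain.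
At the end block 0 covers everything. -/
theorem wp_mergeSort (hn : (slice (s.ia 2) 0 n).Nodup) (h₀ : s.iv 0 = n) :
    wp O mergeSort s fun t s' => t ≤ sortTime n ∧
      StableSort (s.ra 5) (slice (s.ia 2) 0 n) (slice (s'.ia 2) 0 n) ∧
      ∀ z ∈ slice (s.ia 2) 0 n,
        s'.ia 4 z = s.ia 4 z + invs (s.ra 5) (slice (s.ia 2) 0 n) z := by
  refine wp_seq (wp_iset ((wp_loop (fun s' => s'.iv 0 = n ∧ s'.ra 5 = s.ra 5 ∧
    (∃ r, s'.iv 1 = 2 ^ r) ∧ ∀ k, BlockSorted (s.ra 5) (s.ia 2) (s.ia 4) (s'.ia 2) (s'.ia 4)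
      (min (k * s'.iv 1) n) (min ((k + 1) * s'.iv 1) n))
    (fun s => (Nat.log 2 n + 1 - Nat.log 2 (s.iv 1)) * (n * 32 + 6)) ?_ ?_).mono ?_))
  · rintro s' ⟨h₀, hK, ⟨r, hr⟩, hblk⟩ hb
    simp only [Test.eval, IExpr.eval, h₀] at hb
    refine (wp_mergePass hn h₀ rfl (by rw [hr]; positivity) hK hblk).mono ?_
    rintro t s'' hF ⟨ht, h₁, hblk'⟩
    have h₁' : s''.iv 1 = 2 ^ (r + 1) := by rw [h₁, hr]; ring
    refine ⟨⟨by rw [hF.iv 0 rfl, h₀], by rw [hF.ra 5 rfl, hK], ⟨r + 1, h₁'⟩, ?_⟩, ?_⟩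
    · rw [h₁]
      exact hblk'
    · rw [h₁', hr, Nat.log_pow one_lt_two, Nat.log_pow one_lt_two]
      have : r ≤ Nat.log 2 n := Nat.le_log_of_pow_le one_lt_two (by rw [← hr]; exact hb.le)
      obtain ⟨d, hd⟩ := Nat.exists_eq_add_of_le this
      rw [hd, show r + d + 1 - r = d + 1 by omega, show r + d + 1 - (r + 1) = d by omega]
      nlinarith
  · simp only [State.setIv_iv, State.setIv_ra, State.setIv_ia, Nat.reduceEqDiff, if_true,
      if_false, IExpr.eval, h₀, true_and, mul_one]
    refine ⟨⟨0, rfl⟩, fun k => ?_⟩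
    by_cases hk : k < n
    · rw [min_eq_left hk.le, min_eq_left (by omega)]
      exact .singleton
    · exact .of_le (by omega)
  · rintro t s' - ⟨ht, ⟨h₀', -, -, hblk⟩, hb⟩
    simp only [Test.eval, IExpr.eval, h₀'] at hb
    have := hblk 0
    rw [zero_mul, Nat.zero_min, zero_add, one_mul, min_eq_right (not_lt.1 hb)] at this
    refine ⟨?_, this.sort, this.count⟩
    simp [IExpr.eval] at ht
    rw [sortTime]
    omega

end

/-! ### Gradients of admissible functions -/

section objective
variable {S : Set (ℝ × ℝ)} {f : ℝ × ℝ → ℝ}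

theorem fderivWithin_apply_eq_gradient (z d : ℝ × ℝ) :
    fderivWithin ℝ f S z d = d.1 * (gradient S f z).1 + d.2 * (gradient S f z).2 := by
  have : d = d.1 • ((1, 0) : ℝ × ℝ) + d.2 • ((0, 1) : ℝ × ℝ) := by ext <;> simp
  conv_lhs => rw [this]
  rw [map_add, map_smul, map_smul]
  rfl

/-- Along the segment from `z` to `z'`, which stays in `S`, the function is concave in one variable,
so its slope is at most its one-sided derivative at `z`. Hence boundary points of `S` are no
exception. -/
theorem IsObjective.le_gradient (h : IsObjective S f) {z z' : ℝ × ℝ} (hz : z ∈ S) (hz' : z' ∈ S) :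
    f z' ≤ f z + (z'.1 - z.1) * (gradient S f z).1 + (z'.2 - z.2) * (gradient S f z).2 := by
  have hc : ConcaveOn ℝ (Set.Icc (0 : ℝ) 1) (f ∘ AffineMap.lineMap z z') :=
    (h.concave.comp_affineMap (AffineMap.lineMap z z')).subset
      (fun t ht => h.concave.1.segment_subset hz hz' (by
        rw [segment_eq_image_lineMap]; exact ⟨t, ht, rfl⟩)) (convex_Icc 0 1)
  have hd : HasDerivWithinAt (f ∘ AffineMap.lineMap z z') (fderivWithin ℝ f S z (z' - z))
      (Set.Icc (0 : ℝ) 1) 0 := by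
    have h₁ : HasFDerivWithinAt f (fderivWithin ℝ f S z) S
        (AffineMap.lineMap z z' (0 : ℝ)) := by
      rw [AffineMap.lineMap_apply_zero]
      exact (h.differentiable z hz).hasFDerivWithinAt
    refine h₁.comp_hasDerivWithinAt (0 : ℝ) AffineMap.hasDerivAt_lineMap.hasDerivWithinAt ?_
    intro t ht
    exact h.concave.1.segment_subset hz hz' (by
      rw [segment_eq_image_lineMap]; exact ⟨t, ht, rfl⟩)
  have := hc.slope_le_of_hasDerivWithinAt (Set.left_mem_Icc.2 zero_le_one)
    (Set.right_mem_Icc.2 zero_le_one) zero_lt_one hd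
  rw [slope_def_field, fderivWithin_apply_eq_gradient] at this
  simp at this
  linarith

/-- A unit step along an axis strictly increases `f`, and by the tangent bound the increase is at
most the partial derivative. -/
theorem IsObjective.gradient_pos (h : IsObjective S f) {z : ℝ × ℝ} (hz : z ∈ S) :
    0 < (gradient S f z).1 ∧ 0 < (gradient S f z).2 := by
  constructor
  · have h₁ : ((z.1 + 1, z.2) : ℝ × ℝ) ∈ S :=
      h.upper (show z ≤ (z.1 + 1, z.2) from ⟨by simp, le_rfl⟩) hz
    have h₂ := h.le_gradient hz h₁
    have h₃ := h.strict_fst z.1 (z.1 + 1) z.2 hz (by simp)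
    simp at h₂
    linarith
  · have h₁ : ((z.1, z.2 + 1) : ℝ × ℝ) ∈ S :=
      h.upper (show z ≤ (z.1, z.2 + 1) from ⟨le_rfl, by simp⟩) hz
    have h₂ := h.le_gradient hz h₁
    have h₃ := h.strict_snd z.1 z.2 (z.2 + 1) hz (by simp)
    simp at h₂
    linarith

theorem IsObjective.continuousOn_gradient (h : IsObjective S f) :
    ContinuousOn (gradient S f) S :=
  (h.continuous_deriv.clm_apply continuousOn_const).prodMk
    (h.continuous_deriv.clm_apply continuousOn_const)

theorem IsObjective.combo_mem (h : IsObjective S f) {z z' : ℝ × ℝ} (hz : z ∈ S) (hz' : z' ∈ S)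
    {m : ℝ} (hm : m ∈ Set.Icc (0 : ℝ) 1) : m • z + (1 - m) • z' ∈ S :=
  h.concave.1 hz hz' hm.1 (by linarith [hm.2]) (by ring)

/-- If the gradients at the ends of a segment lie on different sides of the line `q = l p`, then
the gradient at some point of the segment lies on the line. -/
theorem IsObjective.exists_crossing (h : IsObjective S f) {z z' : ℝ × ℝ} (hz : z ∈ S)
    (hz' : z' ∈ S) {l : ℝ} (h₁ : l * (gradient S f z).1 ≤ (gradient S f z).2)
    (h₂ : (gradient S f z').2 ≤ l * (gradient S f z').1) :
    ∃ m ∈ Set.Icc (0 : ℝ) 1, (gradient S f (m • z + (1 - m) • z')).2 =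
      l * (gradient S f (m • z + (1 - m) • z')).1 := by
  have hc : ContinuousOn (fun m : ℝ => gradient S f (m • z + (1 - m) • z')) (Set.Icc 0 1) :=
    h.continuousOn_gradient.comp (by fun_prop) fun m hm => h.combo_mem hz hz' hm
  have hc' : ContinuousOn (fun m : ℝ => (gradient S f (m • z + (1 - m) • z')).2 -
      l * (gradient S f (m • z + (1 - m) • z')).1) (Set.Icc 0 1) :=
    hc.snd.sub (continuousOn_const.mul hc.fst)
  obtain ⟨m, hm, e⟩ := intermediate_value_Icc zero_le_one hc'
    (show (0 : ℝ) ∈ Set.Icc _ _ by constructor <;> simp <;> linarith)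
  exact ⟨m, hm, sub_eq_zero.1 e⟩

end objective

/-! ### Optimal rankings -/

section ranking
variable {n : ℕ} {w a b : Fin n → ℝ}

theorem cs_add (p q : ℝ) (σ : Equiv.Perm (Fin n)) :
    cs w (fun j => p * a j + q * b j) σ = p * cs w a σ + q * cs w b σ := by
  simp only [cs, Finset.mul_sum, ← Finset.sum_add_distrib]
  exact Finset.sum_congr rfl fun _ _ => by ring

/-- This is the rearrangement inequality for `w` and the reordered scores, which decrease together.
-/
theorem cs_le_of_antitone {x : Fin n → ℝ} {σ : Equiv.Perm (Fin n)} (hw : Antitone w)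
    (hx : Antitone fun i => x (σ i)) (τ : Equiv.Perm (Fin n)) : cs w x τ ≤ cs w x σ := by
  have : Monovary w (fun i => x (σ i)) := fun i j hij => by
    by_contra hlt
    exact hij.not_ge (hx (le_of_not_ge fun h => hlt (hw h)))
  simpa [cs] using this.sum_mul_comp_perm_le_sum_mul (σ := τ.trans σ.symm)

/-- The ranking `σ` sorts the items by decreasing `(1 - θ) a + θ b`. -/
def Sorts (a b : Fin n → ℝ) (θ : ℝ) (σ : Equiv.Perm (Fin n)) : Prop :=
  Antitone fun i => (1 - θ) * a (σ i) + θ * b (σ i)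

theorem Sorts.le {θ : ℝ} {σ : Equiv.Perm (Fin n)} (h : Sorts a b θ σ) (hw : Antitone w)
    (τ : Equiv.Perm (Fin n)) :
    (1 - θ) * cs w a τ + θ * cs w b τ ≤ (1 - θ) * cs w a σ + θ * cs w b σ := by
  rw [← cs_add, ← cs_add]
  exact cs_le_of_antitone (x := fun j => (1 - θ) * a j + θ * b j) hw h τ

/-- An affine function of the direction that is nonnegative at `l` and `h` is nonnegative at q / (p
+ q) between them. The sign of `v - u` decides which end gives the smaller value. -/
theorem affine_nonneg {u v l h p q : ℝ} (hpq : 0 < p + q) (hl : l * (p + q) ≤ q)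
    (hh : q ≤ h * (p + q)) (h₁ : 0 ≤ (1 - l) * u + l * v) (h₂ : 0 ≤ (1 - h) * u + h * v) :
    0 ≤ p * u + q * v := by
  rcases le_total u v with huv | huv
  · nlinarith [mul_nonneg hpq.le h₁, mul_nonneg (sub_nonneg.2 hl) (sub_nonneg.2 huv)]
  · nlinarith [mul_nonneg hpq.le h₂, mul_nonneg (sub_nonneg.2 hh) (sub_nonneg.2 huv)]

/-- A ranking that is optimal in two directions is optimal in the directions between them. -/
theorem Sorts.le_of_between {l h p q : ℝ} {σ τ : Equiv.Perm (Fin n)} (hw : Antitone w)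
    (hσ : Sorts a b l σ) (hτ : Sorts a b h τ) (ea : cs w a σ = cs w a τ)
    (eb : cs w b σ = cs w b τ) (hpq : 0 < p + q) (hl : l * (p + q) ≤ q) (hh : q ≤ h * (p + q))
    (ρ : Equiv.Perm (Fin n)) :
    p * cs w a ρ + q * cs w b ρ ≤ p * cs w a σ + q * cs w b σ := by
  have h₁ := hσ.le hw ρ
  have h₂ := hτ.le hw ρ
  rw [← ea, ← eb] at h₂
  have := affine_nonneg (u := cs w a σ - cs w a ρ) (v := cs w b σ - cs w b ρ) hpq hl hh
    (by linarith) (by linarith)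
  linarith

end ranking

/-! ### The dual solution -/

/-- Row prices for decreasing sequences `w`, `x` that vanish from `n` on. -/
noncomputable def price (n : ℕ) (w x : ℕ → ℝ) (k : ℕ) : ℝ :=
  ∑ l ∈ Finset.Ico k n, x l * (w l - w (l + 1))

/-- Column prices for decreasing sequences `w`, `x` that vanish from `n` on. -/
noncomputable def price' (n : ℕ) (w x : ℕ → ℝ) (k : ℕ) : ℝ :=
  ∑ l ∈ Finset.Ico k n, w (l + 1) * (x l - x (l + 1))

section price
variable {n : ℕ} {w x : ℕ → ℝ}

theorem price_succ (hx : ∀ k, n ≤ k → x k = 0) (k : ℕ) :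
    price n w x k = price n w x (k + 1) + x k * (w k - w (k + 1)) := by
  by_cases hk : k < n
  · rw [price, Finset.sum_eq_sum_Ico_succ_bot hk, add_comm]
    rfl
  · rw [price, price, Finset.Ico_eq_empty_of_le (not_lt.1 hk), hx k (not_lt.1 hk),
      Finset.Ico_eq_empty_of_le (by omega)]
    simp

theorem price'_succ (hw : ∀ k, n ≤ k → w k = 0) (k : ℕ) :
    price' n w x k = price' n w x (k + 1) + w (k + 1) * (x k - x (k + 1)) := by
  by_cases hk : k < n
  · rw [price', Finset.sum_eq_sum_Ico_succ_bot hk, add_comm]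
    rfl
  · rw [price', price', Finset.Ico_eq_empty_of_le (not_lt.1 hk), hw (k + 1) (by omega),
      Finset.Ico_eq_empty_of_le (by omega)]
    simp

theorem price_nonneg (hw : Antitone w) (hx : ∀ k, 0 ≤ x k) (k : ℕ) : 0 ≤ price n w x k :=
  Finset.sum_nonneg fun l _ => mul_nonneg (hx l) (sub_nonneg.2 (hw l.le_succ))

theorem price'_nonneg (hw : ∀ k, 0 ≤ w k) (hx : Antitone x) (k : ℕ) : 0 ≤ price' n w x k :=
  Finset.sum_nonneg fun l _ => mul_nonneg (hw _) (sub_nonneg.2 (hx l.le_succ))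

/-- Summation by parts: the increments of the two prices at `k` add up to `w k * x k - w (k + 1) * x
(k + 1)`, which telescopes to zero at `n`. -/
theorem price_add_price' (hw₀ : ∀ k, n ≤ k → w k = 0) (hx₀ : ∀ k, n ≤ k → x k = 0) {k : ℕ}
    (hk : k ≤ n) : price n w x k + price' n w x k = w k * x k := by
  induction hk using Nat.decreasingInduction with
  | self => simp [price, price', hw₀]
  | of_succ k hk ih => rw [price_succ hx₀, price'_succ hw₀]; linarith

/-- Start from equality on the diagonal and lower one index at a time. Lowering `i` below `k` adds
`(w i - w (i + 1)) * x k` on the left and the same with `x i ≥ x k` on the right; lowering `k` is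
the mirror image. -/
theorem mul_le_price_add_price' (hw : Antitone w) (hx : Antitone x) (hw₀ : ∀ k, n ≤ k → w k = 0)
    (hx₀ : ∀ k, n ≤ k → x k = 0) {i k : ℕ} (hi : i ≤ n) (hk : k ≤ n) :
    w i * x k ≤ price n w x i + price' n w x k := by
  rcases le_total i k with h | h
  · induction h using Nat.decreasingInduction with
    | self => exact (price_add_price' hw₀ hx₀ hk).ge
    | of_succ i h ih =>
      rw [price_succ hx₀]
      nlinarith [ih (by omega), mul_nonneg (sub_nonneg.2 (hw i.le_succ))
        (sub_nonneg.2 (hx h.le))]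
  · induction h using Nat.decreasingInduction with
    | self => exact (price_add_price' hw₀ hx₀ hi).ge
    | of_succ k h ih =>
      rw [price'_succ hw₀]
      nlinarith [ih (by omega), mul_nonneg (sub_nonneg.2 (hx k.le_succ))
        (sub_nonneg.2 (hw (show k + 1 ≤ i from h)))]

end price

/-! ### Certificates of optimality -/

section certificate
variable {n : ℕ} {w a b : Fin n → ℝ}

theorem sum_permMatrix_mul (σ : Equiv.Perm (Fin n)) (x : Fin n → ℝ) (i : Fin n) :
    ∑ j, σ.permMatrix ℝ i j * x j = x (σ i) := by
  simp [Equiv.Perm.permMatrix, PEquiv.toMatrix_apply, Equiv.toPEquiv_apply]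

theorem sum_mix_mul (m : ℝ) (σ τ : Equiv.Perm (Fin n)) (x : Fin n → ℝ) :
    ∑ i, ∑ j, (m • σ.permMatrix ℝ + (1 - m) • τ.permMatrix ℝ) i j * w i * x j =
      m * cs w x σ + (1 - m) * cs w x τ := by
  simp only [cs, Finset.mul_sum, ← Finset.sum_add_distrib]
  refine Finset.sum_congr rfl fun i _ => ?_
  rw [← sum_permMatrix_mul σ x i, ← sum_permMatrix_mul τ x i]
  simp only [Finset.mul_sum, ← Finset.sum_add_distrib]
  refine Finset.sum_congr rfl fun j _ => ?_
  simp only [Matrix.add_apply, Matrix.smul_apply, smul_eq_mul]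
  ring

theorem mix_mem_doublyStochastic {m : ℝ} (hm : m ∈ Set.Icc (0 : ℝ) 1)
    (σ τ : Equiv.Perm (Fin n)) :
    m • σ.permMatrix ℝ + (1 - m) • τ.permMatrix ℝ ∈ doublyStochastic ℝ (Fin n) :=
  convex_doublyStochastic permMatrix_mem_doublyStochastic permMatrix_mem_doublyStochastic
    hm.1 (by linarith [hm.2]) (by ring)

theorem cs_le_of_dualFeasible {r c : Fin n → ℝ} {p q : ℝ} (h : DualFeasible w a b r c p q)
    (σ : Equiv.Perm (Fin n)) : p * cs w a σ + q * cs w b σ ≤ ∑ i, r i + ∑ j, c j := by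
  rw [← cs_add, ← Equiv.sum_comp σ c, ← Finset.sum_add_distrib]
  exact Finset.sum_le_sum fun i _ => h.le i (σ i)

/-- Weak duality for the assignment part: average the dual constraints with the weights `P i j`.
Since the prices are nonnegative, row and column sums below 1 can be replaced by 1. -/
theorem le_of_primalFeasible {S : Set (ℝ × ℝ)} {P : Matrix (Fin n) (Fin n) ℝ} {α β : ℝ}
    {r c : Fin n → ℝ} {p q : ℝ} (hP : PrimalFeasible S w a b P α β)
    (h : DualFeasible w a b r c p q) : p * α + q * β ≤ ∑ i, r i + ∑ j, c j := by
  calc p * α + q * β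
      ≤ p * (∑ i, ∑ j, P i j * w i * a j) + q * ∑ i, ∑ j, P i j * w i * b j :=
        add_le_add (mul_le_mul_of_nonneg_left hP.le_fst h.nonneg_p)
          (mul_le_mul_of_nonneg_left hP.le_snd h.nonneg_q)
    _ = ∑ i, ∑ j, P i j * (w i * (p * a j + q * b j)) := by
        simp only [Finset.mul_sum, ← Finset.sum_add_distrib]
        exact Finset.sum_congr rfl fun _ _ => Finset.sum_congr rfl fun _ _ => by ring
    _ ≤ ∑ i, ∑ j, P i j * (r i + c j) := by
        gcongr with i _ j _
        · exact hP.nonneg i j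
        · exact h.le i j
    _ = ∑ i, (∑ j, P i j) * r i + ∑ j, (∑ i, P i j) * c j := by
        simp only [Finset.sum_mul, mul_add, Finset.sum_add_distrib]
        rw [Finset.sum_comm (f := fun i j => P i j * c j)]
    _ ≤ ∑ i, 1 * r i + ∑ j, 1 * c j := by
        gcongr with i _ j _
        · exact h.nonneg_r i
        · exact hP.row i
        · exact h.nonneg_c j
        · exact hP.col j
    _ = _ := by simp

theorem le_fenchel {S : Set (ℝ × ℝ)} {f : ℝ × ℝ → ℝ} {z : ℝ × ℝ} (hz : z ∈ S) (μ ν : ℝ) :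
    ((μ * z.1 + ν * z.2 + f z : ℝ) : EReal) ≤ fenchel S f μ ν :=
  le_iSup₂ (f := fun z (_ : z ∈ S) => ((μ * z.1 + ν * z.2 + f z : ℝ) : EReal)) z hz

/-- By the tangent bound, the supremum for the slopes of the tangent plane at `z` is attained at
`z`. -/
theorem fenchel_neg_gradient {S : Set (ℝ × ℝ)} {f : ℝ × ℝ → ℝ} (h : IsObjective S f)
    {z : ℝ × ℝ} (hz : z ∈ S) : fenchel S f (-(gradient S f z).1) (-(gradient S f z).2) =
      ((-(gradient S f z).1 * z.1 + -(gradient S f z).2 * z.2 + f z : ℝ) : EReal) := by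
  refine le_antisymm (iSup₂_le fun z' hz' => ?_) (le_fenchel hz _ _)
  exact EReal.coe_le_coe_iff.2 (by linarith [h.le_gradient hz hz'])

theorem csStar_eq {x : Fin n → ℝ} {v : ℝ} {σ : Equiv.Perm (Fin n)} (hσ : cs w x σ = v)
    (h : ∀ τ, cs w x τ ≤ v) : csStar w x = v :=
  le_antisymm (ciSup_le h) (hσ ▸ le_ciSup (Set.finite_range _).bddAbove σ)

/-- A point on a segment between the score pairs of two rankings that is optimal in the direction
of its gradient, and prices for this direction, give an exact solution. -/
theorem solves_of_certificate {S : Set (ℝ × ℝ)} {f : ℝ × ℝ → ℝ} {s : State}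
    {σ τ ρ : Equiv.Perm (Fin n)} (hf : IsObjective S f)
    (hS : ∀ σ : Equiv.Perm (Fin n), (cs w a σ, cs w b σ) ∈ S)
    (hσ : ∀ i : Fin n, s.ia 0 i = σ i) (hτ : ∀ i : Fin n, s.ia 1 i = τ i)
    (hm : s.rv 0 ∈ Set.Icc (0 : ℝ) 1)
    (hα : s.rv 1 = s.rv 0 * cs w a σ + (1 - s.rv 0) * cs w a τ)
    (hβ : s.rv 2 = s.rv 0 * cs w b σ + (1 - s.rv 0) * cs w b τ)
    (hp : s.rv 3 = (gradient S f (s.rv 1, s.rv 2)).1)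
    (hq : s.rv 4 = (gradient S f (s.rv 1, s.rv 2)).2) (hv : s.rv 5 = f (s.rv 1, s.rv 2))
    (hbest : ∀ ρ : Equiv.Perm (Fin n),
      s.rv 3 * cs w a ρ + s.rv 4 * cs w b ρ ≤ s.rv 3 * s.rv 1 + s.rv 4 * s.rv 2)
    (hd : DualFeasible w a b (fun i => s.ra 3 i) (fun j => s.ra 4 j) (s.rv 3) (s.rv 4))
    (hsum : ∑ i : Fin n, s.ra 3 i + ∑ j : Fin n, s.ra 4 j =
      s.rv 3 * cs w a ρ + s.rv 4 * cs w b ρ) : Solves S f w a b s σ τ := by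
  have hz : (s.rv 1, s.rv 2) ∈ S := by
    have := hf.combo_mem (hS σ) (hS τ) hm
    rw [hα, hβ]
    simpa using this
  have hds := mix_mem_doublyStochastic hm σ τ
  -- The solution point is a convex combination of two score pairs, so it inherits linear bounds
  -- that hold at all rankings.
  have hle₁ : ∀ x : ℝ, ∀ p q : ℝ, (∀ ρ, p * cs w a ρ + q * cs w b ρ ≤ x) →
      p * s.rv 1 + q * s.rv 2 ≤ x := by
    intro x p q h
    rw [hα, hβ]
    nlinarith [mul_le_mul_of_nonneg_left (h σ) hm.1,
      mul_le_mul_of_nonneg_left (h τ) (sub_nonneg.2 hm.2)]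
  have hopt : s.rv 3 * cs w a ρ + s.rv 4 * cs w b ρ = s.rv 3 * s.rv 1 + s.rv 4 * s.rv 2 :=
    (hbest ρ).antisymm (hle₁ _ _ _ fun ρ' => hsum ▸ cs_le_of_dualFeasible hd ρ')
  have hpos := hf.gradient_pos hz
  rw [← hp, ← hq] at hpos
  have hfen : fenchel S f (-s.rv 3) (-s.rv 4) =
      ((-s.rv 3 * s.rv 1 + -s.rv 4 * s.rv 2 + s.rv 5 : ℝ) : EReal) := by
    rw [hp, hq, hv]
    exact fenchel_neg_gradient hf hz
  -- Testing the conjugate at the solution point gives the lower bound for the dual program and for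
  -- `Psi` at once.
  have hlow : ∀ x p q : ℝ, (∀ ρ, p * cs w a ρ + q * cs w b ρ ≤ x) →
      (s.rv 5 : EReal) ≤ (x : EReal) + fenchel S f (-p) (-q) := by
    intro x p q h
    refine le_trans ?_ (add_le_add_right (le_fenchel hz (-p) (-q)) _)
    rw [← EReal.coe_add, EReal.coe_le_coe_iff, hv]
    linarith [hle₁ x p q h]
  refine ⟨hσ, hτ, hm, ⟨hz, (hf.subset_nonneg _ hz).1, (hf.subset_nonneg _ hz).2,
    fun i j => nonneg_of_mem_doublyStochastic hds, ?_, ?_,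
    fun i => (sum_row_of_mem_doublyStochastic hds i).le,
    fun j => (sum_col_of_mem_doublyStochastic hds j).le⟩, hv.symm, ?_, hd, ?_, ?_,
    hpos.1, hpos.2, ?_, ?_⟩
  · rw [sum_mix_mul, hα]
  · rw [sum_mix_mul, hβ]
  · intro P α β hP
    have h₁ := le_of_primalFeasible hP hd
    have h₂ := hf.le_gradient hz hP.dom
    rw [← hp, ← hq, ← hv] at h₂
    simp only at h₂
    linarith
  · rw [dualValue, hfen, ← EReal.coe_add, hsum, hopt]
    congr 1
    ring
  · intro r c p q h
    exact hlow _ p q (cs_le_of_dualFeasible h)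
  · rw [Psi, hfen, csStar_eq (σ := ρ) (v := s.rv 3 * s.rv 1 + s.rv 4 * s.rv 2)
      (by rw [cs_add, hopt]) (fun τ => by rw [cs_add]; exact hbest τ), ← EReal.coe_add]
    congr 1
    ring
  · intro p q _ _
    exact hlow _ p q fun ρ => by
      rw [← cs_add]
      exact le_ciSup (f := fun σ => cs w (fun j => p * a j + q * b j) σ)
        (Set.finite_range _).bddAbove ρ

end certificate

/-! ### Sorting by a linear combination of the scores -/

/-- All running times are measured in units of `n (⌊log₂ n⌋ + 1)`. -/
def unit (n : ℕ) : ℕ := n * (Nat.log 2 n + 1)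

theorem le_unit (n : ℕ) : n ≤ unit n := Nat.le_mul_of_pos_right n (Nat.succ_pos _)

theorem sortTime_le {n : ℕ} (hn : 1 ≤ n) : sortTime n ≤ 41 * unit n := by
  rw [sortTime, unit]
  have : 1 ≤ n * (Nat.log 2 n + 1) := Nat.mul_pos hn (Nat.succ_pos _)
  have h₂ : Nat.log 2 n + 1 ≤ n * (Nat.log 2 n + 1) := Nat.le_mul_of_pos_left _ hn
  nlinarith

theorem StableSort.congr {K K' : ℕ → ℝ} {l₀ l : List ℕ} (h : StableSort K l₀ l)
    (hK : ∀ x ∈ l₀, K x = K' x) : StableSort K' l₀ l where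
  perm := h.perm
  pairwise R hR := (h.pairwise R hR).imp_of_mem fun {x y} hx hy hxy => by
    rwa [← hK x (h.perm.subset hx), ← hK y (h.perm.subset hy)]

theorem invs_congr {K K' : ℕ → ℝ} {l : List ℕ} {z : ℕ} (hK : ∀ x ∈ l, K x = K' x) (hz : z ∈ l) :
    invs K l z = invs K' l z := by
  induction l with
  | nil => rfl
  | cons x l ih =>
    rw [invs, invs]
    split_ifs with h₁ h₂ h₃ h₃ <;> try rfl
    all_goals
      rw [hK x List.mem_cons_self, hK z hz] at h₂
    · rw [ih (fun x hx => hK x (List.mem_cons_of_mem _ hx))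
        ((List.mem_cons.1 hz).resolve_left (Ne.symm h₁))]
    · exact absurd h₂ h₃
    · exact absurd h₃ h₂
    · rw [ih (fun x hx => hK x (List.mem_cons_of_mem _ hx))
        ((List.mem_cons.1 hz).resolve_left (Ne.symm h₁))]

theorem slice_zero (P : ℕ → ℕ) (n : ℕ) : slice P 0 n = (List.range n).map P := by
  rw [slice, List.range_eq_range', Nat.sub_zero]

theorem lt_of_pairwise_slice {P : ℕ → ℕ} {n : ℕ} {R : ℕ → ℕ → Prop}
    (h : (slice P 0 n).Pairwise R) {i j : ℕ} (hij : i < j) (hj : j < n) : R (P i) (P j) := by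
  rw [slice_zero, List.pairwise_map, List.pairwise_iff_getElem] at h
  have := h i j (by rw [List.length_range]; omega) (by rw [List.length_range]; omega) hij
  rwa [List.getElem_range, List.getElem_range] at this

theorem exists_perm_of_slice_perm {P : ℕ → ℕ} {n : ℕ} (h : (slice P 0 n).Perm (List.range n)) :
    ∃ σ : Equiv.Perm (Fin n), ∀ i : Fin n, P i = σ i := by
  have hlt : ∀ i : Fin n, P i < n := fun i =>
    List.mem_range.1 (h.subset (mem_slice.2 ⟨i, Nat.zero_le _, i.2, rfl⟩))
  have hinj : Function.Injective fun i : Fin n => (⟨P i, hlt i⟩ : Fin n) := by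
    intro i j hij
    have hn := h.nodup_iff.2 List.nodup_range
    rw [slice_zero, List.nodup_map_iff_inj_on List.nodup_range] at hn
    exact Fin.ext (hn i (List.mem_range.2 i.2) j (List.mem_range.2 j.2) (Fin.ext_iff.1 hij))
  exact ⟨Equiv.ofBijective _ (Finite.injective_iff_bijective.1 hinj), fun i => rfl⟩

/-- The input is still in its place. -/
structure Loaded {n : ℕ} (w a b : Fin n → ℝ) (s : State) : Prop where
  iv : s.iv 0 = n
  ra₀ : s.ra 0 = toArray a
  ra₁ : s.ra 1 = toArray b
  ra₂ : s.ra 2 = toArray w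

def Cmd.keepsInput (c : Cmd) : Bool :=
  !(c.writesIv 0 || c.writesRa 0 || c.writesRa 1 || c.writesRa 2)

theorem Loaded.frame {n : ℕ} {w a b : Fin n → ℝ} {s s' : State} {c : Cmd} (h : Loaded w a b s)
    (hF : Frame c s s') (hc : c.keepsInput = true) : Loaded w a b s' := by
  simp only [Cmd.keepsInput, Bool.not_eq_true', Bool.or_eq_false_iff] at hc
  obtain ⟨⟨⟨h₀, h₁⟩, h₂⟩, h₃⟩ := hc
  exact ⟨by rw [hF.iv 0 h₀, h.iv], by rw [hF.ra 0 h₁, h.ra₀], by rw [hF.ra 1 h₂, h.ra₁],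
    by rw [hF.ra 2 h₃, h.ra₂]⟩

theorem Loaded.setRv {n : ℕ} {w a b : Fin n → ℝ} {s : State} (h : Loaded w a b s) (x : ℕ)
    (v : ℝ) : Loaded w a b (s.setRv x v) := ⟨h.iv, h.ra₀, h.ra₁, h.ra₂⟩

theorem Loaded.setIv {n : ℕ} {w a b : Fin n → ℝ} {s : State} (h : Loaded w a b s) {x : ℕ}
    (hx : x ≠ 0) (v : ℕ) : Loaded w a b (s.setIv x v) :=
  ⟨by simp [h.iv, hx.symm], h.ra₀, h.ra₁, h.ra₂⟩

@[simp] theorem toArray_apply {n : ℕ} (x : Fin n → ℝ) (i : Fin n) : toArray x i = x i := by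
  simp [toArray]

/-- The list of items starts as `0, …, n - 1`. -/
def resetItems : Cmd := forN 8 (.iput 2 (.var 8) (.var 8))

/-- Compute the keys `p a + q b`, where `p`, `q` are real variables `21`, `22`. -/
def setKeys : Cmd := forN 8 (.rput 5 (.var 8)
  (.add (.mul (.var 21) (.get 0 (.var 8))) (.mul (.var 22) (.get 1 (.var 8)))))

/-- Sort the items by `p a + q b`. -/
def sortBy (p q : RExpr) : Cmd :=
  .seq (.rset 21 p) (.seq (.rset 22 q) (.seq setKeys mergeSort))

/-- The combined score of item `k`. -/
noncomputable def key {n : ℕ} (a b : Fin n → ℝ) (p q : ℝ) (k : ℕ) : ℝ :=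
  p * toArray a k + q * toArray b k

section
variable {O : Oracle} {s : State} {n : ℕ} {w a b : Fin n → ℝ}

theorem wp_resetItems (h₀ : s.iv 0 = n) : wp O resetItems s fun t s' =>
    t ≤ n * 4 + 3 ∧ slice (s'.ia 2) 0 n = List.range n := by
  refine (wp_forN 1 (fun k s => ∀ i < k, s.ia 2 i = i) (by decide) rfl rfl h₀
    (fun k s v h => h) ?_ (by simp)).mono ?_
  · intro k s _ _ h₈ hI
    refine wp_iput ⟨le_rfl, fun i hi => ?_⟩
    simp only [State.setIa_ia, if_true, IExpr.eval, h₈, Function.update_apply]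
    split_ifs with h
    · exact h.symm
    · exact hI i (by omega)
  · rintro t s' - ⟨ht, h⟩
    refine ⟨ht, ?_⟩
    rw [slice_zero]
    exact (List.map_congr_left fun i hi => h i (List.mem_range.1 hi)).trans (List.map_id _)

/-- The initial order may be any permutation, so that stable sorts can be chained. The state in `hq`
is modified because `p` has been stored by the time `q` is evaluated. -/
theorem wp_sortBy {p q : RExpr} {u v : ℝ} (hl : Loaded w a b s) (hn : 1 ≤ n)
    (hp : p.eval s = u) (hq : q.eval (s.setRv 21 u) = v)
    (hs : (slice (s.ia 2) 0 n).Perm (List.range n)) :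
    wp O (sortBy p q) s fun t s' => t ≤ 54 * unit n ∧
      StableSort (key a b u v) (slice (s.ia 2) 0 n) (slice (s'.ia 2) 0 n) ∧
      ∀ z < n, s'.ia 4 z = s.ia 4 z + invs (key a b u v) (slice (s.ia 2) 0 n) z := by
  refine wp_seq (wp_rset (wp_seq (wp_rset (wp_seq ?_))))
  rw [hp, hq]
  refine (wp_forN (n := n) 1 (fun k s => s.rv 21 = u ∧ s.rv 22 = v ∧ s.ra 0 = toArray a ∧
    s.ra 1 = toArray b ∧ ∀ i < k, s.ra 5 i = key a b u v i) (by decide) rfl rfl ?_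
    (fun k s v h => h) ?_ ?_).mono ?_
  · simp [hl.iv]
  · rintro k s _ _ h₈ ⟨h₁, h₂, h₃, h₄, h₅⟩
    refine wp_rput ⟨le_rfl, h₁, h₂, ?_, ?_, fun i hi => ?_⟩
    · simpa using h₃
    · simpa using h₄
    · simp only [State.setRa_ra, if_true, IExpr.eval, RExpr.eval, h₁, h₂, h₃, h₄, h₈,
        Function.update_apply]
      split_ifs with h
      · rw [h, key]
      · exact h₅ i (by omega)
  · simp [hl.ra₀, hl.ra₁]
  · rintro t s' hF ⟨ht, -, -, -, -, hk⟩
    have e₂ : s'.ia 2 = s.ia 2 := hF.ia 2 rfl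
    have e₄ : s'.ia 4 = s.ia 4 := hF.ia 4 rfl
    have e₀ : s'.iv 0 = n := (hF.iv 0 rfl).trans hl.iv
    rw [← e₂] at hs
    refine (wp_mergeSort (hs.nodup_iff.2 List.nodup_range) e₀).mono ?_
    rintro t' s'' - ⟨ht', hsort, hcount⟩
    rw [e₂] at hsort hs
    rw [e₂, e₄] at hcount
    have hK : ∀ x ∈ slice (s.ia 2) 0 n, s'.ra 5 x = key a b u v x := fun x hx =>
      hk x (List.mem_range.1 (hs.subset hx))
    refine ⟨?_, hsort.congr hK, fun z hz => ?_⟩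
    · have := sortTime_le hn
      have := le_unit n
      omega
    · have hz' := hs.symm.subset (List.mem_range.2 hz)
      rw [hcount z hz', invs_congr hK hz']

theorem sorts_of_sorted {P : ℕ → ℕ} {θ : ℝ} {σ : Equiv.Perm (Fin n)}
    (h : (slice P 0 n).Pairwise fun x y => key a b (1 - θ) θ y ≤ key a b (1 - θ) θ x)
    (hσ : ∀ i : Fin n, P i = σ i) : Sorts a b θ σ := by
  intro i j hij
  obtain rfl | hij := hij.eq_or_lt
  · exact le_rfl
  · have := lt_of_pairwise_slice h hij j.2
    rw [hσ, hσ] at this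
    simpa [key] using this

/-! ### Probing a direction -/

/-- The score pair of the ranking in index array `2`. -/
def score : Cmd :=
  .seq (.rset 17 (.const 0)) (.seq (.rset 18 (.const 0)) (forN 8
    (.seq (.rset 17 (.add (.var 17) (.mul (.get 2 (.var 8)) (.get 0 (.get 2 (.var 8))))))
      (.rset 18 (.add (.var 18) (.mul (.get 2 (.var 8)) (.get 1 (.get 2 (.var 8)))))))))

theorem wp_score {σ : Equiv.Perm (Fin n)} (hl : Loaded w a b s)
    (hσ : ∀ i : Fin n, s.ia 2 i = σ i) :
    wp O score s fun t s' => t ≤ n * 6 + 7 ∧ s'.rv 17 = cs w a σ ∧ s'.rv 18 = cs w b σ := by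
  have hsum : ∀ x : Fin n → ℝ,
      cs w x σ = ∑ i ∈ Finset.range n, toArray w i * toArray x (s.ia 2 i) := by
    intro x
    rw [← Fin.sum_univ_eq_sum_range (fun i => toArray w i * toArray x (s.ia 2 i))]
    exact Finset.sum_congr rfl fun i _ => by rw [hσ, toArray_apply, toArray_apply]
  refine wp_seq (wp_rset (wp_seq (wp_rset ?_)))
  refine (wp_forN (n := n) 3 (fun k s' => Loaded w a b s' ∧ s'.ia 2 = s.ia 2 ∧
    s'.rv 17 = ∑ i ∈ Finset.range k, toArray w i * toArray a (s.ia 2 i) ∧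
    s'.rv 18 = ∑ i ∈ Finset.range k, toArray w i * toArray b (s.ia 2 i))
    (by decide) rfl rfl ?_ ?_ ?_ ?_).mono ?_
  · simp [hl.iv]
  · rintro k s v ⟨h₁, h₂⟩
    exact ⟨h₁.setIv (by decide) v, h₂⟩
  · rintro k s' _ _ h₈ ⟨h₁, h₂, h₃, h₄⟩
    refine wp_seq (wp_rset (wp_rset ⟨le_rfl, (h₁.setRv _ _).setRv _ _, h₂, ?_, ?_⟩))
    · simp [RExpr.eval, IExpr.eval, h₁.ra₀, h₁.ra₂, h₂, h₃, h₈, Finset.sum_range_succ]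
    · simp [RExpr.eval, IExpr.eval, h₁.ra₁, h₁.ra₂, h₂, h₄, h₈, Finset.sum_range_succ]
  · exact ⟨(hl.setRv _ _).setRv _ _, rfl, by simp [RExpr.eval], by simp [RExpr.eval]⟩
  · rintro t s' - ⟨ht, -, -, h₁, h₂⟩
    refine ⟨by omega, ?_, ?_⟩
    · rw [h₁, hsum]
    · rw [h₂, hsum]

end

/-- A direction `θ`, with a ranking that is optimal for it, the score pair of this ranking and the
gradient there, as kept for the two ends of the search interval. -/
structure Side where
  items : ℕ → ℕ
  dir : ℝ
  fst : ℝ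
  snd : ℝ
  dfst : ℝ
  dsnd : ℝ

/-- Index array `0` is also the output array for `σ`, and index array `1` of `State.hi` that for
`τ`, so the rankings of the final interval need no copying. -/
def State.lo (s : State) : Side := ⟨s.ia 0, s.rv 6, s.rv 9, s.rv 10, s.rv 11, s.rv 12⟩

def State.hi (s : State) : Side := ⟨s.ia 1, s.rv 7, s.rv 13, s.rv 14, s.rv 15, s.rv 16⟩

structure Side.Valid {n : ℕ} (S : Set (ℝ × ℝ)) (f : ℝ × ℝ → ℝ) (w a b : Fin n → ℝ)
    (D : Side) (σ : Equiv.Perm (Fin n)) : Prop where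
  items : ∀ i : Fin n, D.items i = σ i
  sorts : Sorts a b D.dir σ
  fst : D.fst = cs w a σ
  snd : D.snd = cs w b σ
  dfst : D.dfst = (gradient S f (D.fst, D.snd)).1
  dsnd : D.dsnd = (gradient S f (D.fst, D.snd)).2

def keepLo : Cmd :=
  .seq (.rset 6 (.var 8)) (.seq (.rset 9 (.var 17)) (.seq (.rset 10 (.var 18))
  (.seq (.rset 11 (.var 19)) (.seq (.rset 12 (.var 20)) (forN 8 (.iput 0 (.var 8)
    (.get 2 (.var 8))))))))

def keepHi : Cmd :=
  .seq (.rset 7 (.var 8)) (.seq (.rset 13 (.var 17)) (.seq (.rset 14 (.var 18))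
  (.seq (.rset 15 (.var 19)) (.seq (.rset 16 (.var 20)) (forN 8 (.iput 1 (.var 8)
    (.get 2 (.var 8))))))))

/-- Replace one end of the search interval by real variable `8`. -/
def probe : Cmd :=
  .seq resetItems
  (.seq (sortBy (.sub (.const 1) (.var 8)) (.var 8))
  (.seq score
  (.seq (.qgrad 19 20 (.var 17) (.var 18))
  (.ite (.rlt (.var 20) (.mul (.var 8) (.add (.var 19) (.var 20)))) keepHi keepLo))))

section
variable {O : Oracle} {s : State} {n : ℕ} {w a b : Fin n → ℝ} {S : Set (ℝ × ℝ)} {f : ℝ × ℝ → ℝ}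

theorem wp_keepLo (h₀ : s.iv 0 = n) : wp O keepLo s fun t s' => t ≤ n * 4 + 13 ∧
    (∀ i < n, s'.lo.items i = s.ia 2 i) ∧ s'.lo.dir = s.rv 8 ∧ s'.lo.fst = s.rv 17 ∧
    s'.lo.snd = s.rv 18 ∧ s'.lo.dfst = s.rv 19 ∧ s'.lo.dsnd = s.rv 20 := by
  refine wp_seq (wp_rset (wp_seq (wp_rset (wp_seq (wp_rset (wp_seq (wp_rset (wp_seq (wp_rset
    ?_)))))))))
  refine (wp_forN (n := n) 1 (fun k s' => s'.ia 2 = s.ia 2 ∧ ∀ i < k, s'.ia 0 i = s.ia 2 i)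
    (by decide) rfl rfl ?_ (fun k s v h => h) ?_ ?_).mono ?_
  · simpa using h₀
  · rintro k s' _ _ h₈ ⟨h₂, h₁⟩
    refine wp_iput ⟨le_rfl, by simpa using h₂, fun i hi => ?_⟩
    simp only [State.setIa_ia, if_true, IExpr.eval, h₈, h₂, Function.update_apply]
    split_ifs with h
    · rw [h]
    · exact h₁ i (by omega)
  · simp
  · rintro t s' hF ⟨ht, -, h₁⟩
    refine ⟨by omega, h₁, ?_⟩
    simp [State.lo, hF.rv 6 rfl, hF.rv 9 rfl, hF.rv 10 rfl, hF.rv 11 rfl, hF.rv 12 rfl, RExpr.eval]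

theorem wp_keepHi (h₀ : s.iv 0 = n) : wp O keepHi s fun t s' => t ≤ n * 4 + 13 ∧
    (∀ i < n, s'.hi.items i = s.ia 2 i) ∧ s'.hi.dir = s.rv 8 ∧ s'.hi.fst = s.rv 17 ∧
    s'.hi.snd = s.rv 18 ∧ s'.hi.dfst = s.rv 19 ∧ s'.hi.dsnd = s.rv 20 := by
  refine wp_seq (wp_rset (wp_seq (wp_rset (wp_seq (wp_rset (wp_seq (wp_rset (wp_seq (wp_rset
    ?_)))))))))
  refine (wp_forN (n := n) 1 (fun k s' => s'.ia 2 = s.ia 2 ∧ ∀ i < k, s'.ia 1 i = s.ia 2 i)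
    (by decide) rfl rfl ?_ (fun k s v h => h) ?_ ?_).mono ?_
  · simpa using h₀
  · rintro k s' _ _ h₈ ⟨h₂, h₁⟩
    refine wp_iput ⟨le_rfl, by simpa using h₂, fun i hi => ?_⟩
    simp only [State.setIa_ia, if_true, IExpr.eval, h₈, h₂, Function.update_apply]
    split_ifs with h
    · rw [h]
    · exact h₁ i (by omega)
  · simp
  · rintro t s' hF ⟨ht, -, h₁⟩
    refine ⟨by omega, h₁, ?_⟩
    simp [State.hi, hF.rv 7 rfl, hF.rv 13 rfl, hF.rv 14 rfl, hF.rv 15 rfl, hF.rv 16 rfl,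
      RExpr.eval]

/-- If the gradient at the best score pair points below the probed direction, this direction becomes
the upper end, otherwise the lower end. The other end is untouched, so each inequality of the
bracket survives. -/
theorem wp_probe (hI : Instance S f O w a b) (hl : Loaded w a b s) :
    wp O probe s fun t s' => t ≤ 100 * unit n ∧ Loaded w a b s' ∧
      ((∃ σ, s'.lo.Valid S f w a b σ ∧ s'.lo.dir = s.rv 8 ∧
          s'.lo.dir * (s'.lo.dfst + s'.lo.dsnd) ≤ s'.lo.dsnd ∧ s'.hi = s.hi) ∨
        ∃ σ, s'.hi.Valid S f w a b σ ∧ s'.hi.dir = s.rv 8 ∧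
          s'.hi.dsnd < s'.hi.dir * (s'.hi.dfst + s'.hi.dsnd) ∧ s'.lo = s.lo) := by
  have hu := le_unit n
  have hn := hI.pos
  refine wp_seq ((wp_resetItems hl.iv).mono ?_)
  rintro t₁ s₁ hF₁ ⟨ht₁, hs₁⟩
  have hl₁ := hl.frame hF₁ rfl
  have e₈ : s₁.rv 8 = s.rv 8 := hF₁.rv 8 rfl
  refine wp_seq ((wp_sortBy (u := 1 - s.rv 8) (v := s.rv 8) hl₁ hn (by simp [RExpr.eval, e₈])
    (by simp [RExpr.eval, e₈]) (by rw [hs₁])).mono ?_)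
  rintro t₂ s₂ hF₂ ⟨ht₂, hs₂, -⟩
  have hl₂ := hl₁.frame hF₂ rfl
  rw [hs₁] at hs₂
  obtain ⟨σ, hσ⟩ := exists_perm_of_slice_perm hs₂.perm
  have hsort := sorts_of_sorted hs₂.sorted hσ
  refine wp_seq ((wp_score hl₂ hσ).mono ?_)
  rintro t₃ s₃ hF₃ ⟨ht₃, hα, hβ⟩
  have hl₃ := hl₂.frame hF₃ rfl
  have hσ₃ : ∀ i : Fin n, s₃.ia 2 i = σ i := by rw [hF₃.ia 2 rfl]; exact hσ
  have e₈' : s₃.rv 8 = s.rv 8 := by rw [hF₃.rv 8 rfl, hF₂.rv 8 rfl, e₈]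
  have hmem := hI.scores_mem σ
  refine wp_seq (wp_qgrad ?_)
  simp only [RExpr.eval, hα, hβ]
  rw [hI.answers.grad _ hmem]
  set s₄ := (s₃.setRv 19 (gradient S f (cs w a σ, cs w b σ)).1).setRv 20
    (gradient S f (cs w a σ, cs w b σ)).2 with hs₄
  have hl₄ : Loaded w a b s₄ := (hl₃.setRv _ _).setRv _ _
  have hlo : s₄.lo = s.lo := by
    simp [hs₄, State.lo, hF₃.rv 6 rfl, hF₂.rv 6 rfl, hF₁.rv 6 rfl, hF₃.rv 9 rfl, hF₂.rv 9 rfl,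
      hF₁.rv 9 rfl, hF₃.rv 10 rfl, hF₂.rv 10 rfl, hF₁.rv 10 rfl, hF₃.rv 11 rfl, hF₂.rv 11 rfl,
      hF₁.rv 11 rfl, hF₃.rv 12 rfl, hF₂.rv 12 rfl, hF₁.rv 12 rfl, hF₃.ia 0 rfl, hF₂.ia 0 rfl,
      hF₁.ia 0 rfl]
  have hhi : s₄.hi = s.hi := by
    simp [hs₄, State.hi, hF₃.rv 7 rfl, hF₂.rv 7 rfl, hF₁.rv 7 rfl, hF₃.rv 13 rfl, hF₂.rv 13 rfl,
      hF₁.rv 13 rfl, hF₃.rv 14 rfl, hF₂.rv 14 rfl, hF₁.rv 14 rfl, hF₃.rv 15 rfl, hF₂.rv 15 rfl,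
      hF₁.rv 15 rfl, hF₃.rv 16 rfl, hF₂.rv 16 rfl, hF₁.rv 16 rfl, hF₃.ia 1 rfl, hF₂.ia 1 rfl,
      hF₁.ia 1 rfl]
  refine wp_ite (fun hb => ?_) fun hb => ?_
  all_goals simp only [Test.eval, RExpr.eval] at hb
  · refine (wp_keepHi hl₄.iv).mono ?_
    rintro t₅ s₅ hF₅ ⟨ht₅, hit, hd, h₁, h₂, h₃, h₄⟩
    refine ⟨by omega, hl₄.frame hF₅ rfl, Or.inr ⟨σ, ⟨?_, ?_, ?_, ?_, ?_, ?_⟩, ?_, ?_, ?_⟩⟩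
    · exact fun i => (hit i i.2).trans (by simpa [hs₄] using hσ₃ i)
    · rw [hd]; simpa [hs₄, e₈'] using hsort
    · rw [h₁]; simpa [hs₄] using hα
    · rw [h₂]; simpa [hs₄] using hβ
    · rw [h₁, h₂, h₃]; simp [hs₄, hα, hβ]
    · rw [h₁, h₂, h₄]; simp [hs₄, hα, hβ]
    · rw [hd]; simp [hs₄, e₈']
    · rw [hd, h₃, h₄]; exact hb
    · rw [← hlo]
      simp [State.lo, hF₅.rv 6 rfl, hF₅.rv 9 rfl, hF₅.rv 10 rfl, hF₅.rv 11 rfl, hF₅.rv 12 rfl,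
        hF₅.ia 0 rfl]
  · refine (wp_keepLo hl₄.iv).mono ?_
    rintro t₅ s₅ hF₅ ⟨ht₅, hit, hd, h₁, h₂, h₃, h₄⟩
    refine ⟨by omega, hl₄.frame hF₅ rfl, Or.inl ⟨σ, ⟨?_, ?_, ?_, ?_, ?_, ?_⟩, ?_, ?_, ?_⟩⟩
    · exact fun i => (hit i i.2).trans (by simpa [hs₄] using hσ₃ i)
    · rw [hd]; simpa [hs₄, e₈'] using hsort
    · rw [h₁]; simpa [hs₄] using hα
    · rw [h₂]; simpa [hs₄] using hβ
    · rw [h₁, h₂, h₃]; simp [hs₄, hα, hβ]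
    · rw [h₁, h₂, h₄]; simp [hs₄, hα, hβ]
    · rw [hd]; simp [hs₄, e₈']
    · rw [hd, h₃, h₄]; exact not_lt.1 hb
    · rw [← hhi]
      simp [State.hi, hF₅.rv 7 rfl, hF₅.rv 13 rfl, hF₅.rv 14 rfl, hF₅.rv 15 rfl, hF₅.rv 16 rfl,
        hF₅.ia 1 rfl]

end

/-! ### Counting and choosing crossings -/

section
variable {n : ℕ} (a b : Fin n → ℝ) (l h : ℝ)

/-- Item `i` is in front of item `j` in direction `l`, and behind it in direction `h`. -/
def Crosses (i j : ℕ) : Prop :=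
  key a b (1 - l) l j < key a b (1 - l) l i ∧ key a b (1 - h) h i < key a b (1 - h) h j

open Classical in
/-- The items below `k` that cross item `j` between the directions `l` and `h`. -/
noncomputable def crossers (k j : ℕ) : Finset ℕ :=
  (Finset.range k).filter fun i => Crosses a b l h i j

/-- The number of crossings between the directions `l` and `h`. -/
noncomputable def numCross : ℕ := ∑ j ∈ Finset.range n, (crossers a b l h n j).card

end

/-- Count the crossings in the search interval: for each item in index array `4`, and all of them
in index variable `9`. -/
def count : Cmd :=
  .seq resetItems
  (.seq (sortBy (.sub (.const 1) (.var 7)) (.var 7))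
  (.seq (sortBy (.sub (.const 1) (.var 6)) (.var 6))
  (.seq (forN 8 (.iput 4 (.var 8) (.const 0)))
  (.seq (sortBy (.sub (.const 1) (.var 7)) (.var 7))
  (.seq (.iset 9 (.const 0))
  (forN 8 (.iset 9 (.add (.var 9) (.get 4 (.var 8))))))))))

structure Counted {n : ℕ} (a b : Fin n → ℝ) (s : State) : Prop where
  count : ∀ j < n, s.ia 4 j = (crossers a b (s.rv 6) (s.rv 7) n j).card
  total : s.iv 9 = numCross a b (s.rv 6) (s.rv 7)

section
variable {O : Oracle} {s : State} {n : ℕ} {w a b : Fin n → ℝ}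

theorem State.lo_eq_of_frame {c : Cmd} {s s' : State} (hF : Frame c s s')
    (h : (c.writesIa 0 || c.writesRv 6 || c.writesRv 9 || c.writesRv 10 || c.writesRv 11 ||
      c.writesRv 12) = false) : s'.lo = s.lo := by
  simp only [Bool.or_eq_false_iff] at h
  obtain ⟨⟨⟨⟨⟨h₁, h₂⟩, h₃⟩, h₄⟩, h₅⟩, h₆⟩ := h
  simp [State.lo, hF.ia _ h₁, hF.rv _ h₂, hF.rv _ h₃, hF.rv _ h₄, hF.rv _ h₅, hF.rv _ h₆]

theorem State.hi_eq_of_frame {c : Cmd} {s s' : State} (hF : Frame c s s')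
    (h : (c.writesIa 1 || c.writesRv 7 || c.writesRv 13 || c.writesRv 14 || c.writesRv 15 ||
      c.writesRv 16) = false) : s'.hi = s.hi := by
  simp only [Bool.or_eq_false_iff] at h
  obtain ⟨⟨⟨⟨⟨h₁, h₂⟩, h₃⟩, h₄⟩, h₅⟩, h₆⟩ := h
  simp [State.hi, hF.ia _ h₁, hF.rv _ h₂, hF.rv _ h₃, hF.rv _ h₄, hF.rv _ h₅, hF.rv _ h₆]

theorem countP_eq_card_filter {l : List ℕ} (hl : l.Perm (List.range n)) (p : ℕ → Prop)
    [DecidablePred p] : (l.countP fun i => decide (p i)) = ((Finset.range n).filter p).card := by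
  rw [hl.countP_eq, List.countP_eq_length_filter]
  rfl

/-- Sorting by the upper direction and then stably by the lower one gives the lexicographic order:
ties at the lower end already have the order of the upper end and create no inversions. After the
counters are cleared, sorting again by the upper direction therefore counts exactly the strictly
reversed pairs. -/
theorem wp_count (hn : 1 ≤ n) (hl : Loaded w a b s) :
    wp O count s fun t s' => t ≤ 190 * unit n ∧ Counted a b s' := by
  classical
  have hu := le_unit n
  refine wp_seq ((wp_resetItems hl.iv).mono ?_)
  rintro t₁ s₁ hF₁ ⟨ht₁, hs₁⟩
  have hl₁ := hl.frame hF₁ rfl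
  have e₁ : s₁.rv 6 = s.rv 6 := hF₁.rv 6 rfl
  have e₁' : s₁.rv 7 = s.rv 7 := hF₁.rv 7 rfl
  refine wp_seq ((wp_sortBy (u := 1 - s.rv 7) (v := s.rv 7) hl₁ hn (by simp [RExpr.eval, e₁'])
    (by simp [RExpr.eval, e₁']) (by rw [hs₁])).mono ?_)
  rintro t₂ s₂ hF₂ ⟨ht₂, hs₂, -⟩
  have hl₂ := hl₁.frame hF₂ rfl
  have e₂ : s₂.rv 6 = s.rv 6 := by rw [hF₂.rv 6 rfl, e₁]
  have e₂' : s₂.rv 7 = s.rv 7 := by rw [hF₂.rv 7 rfl, e₁']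
  rw [hs₁] at hs₂
  refine wp_seq ((wp_sortBy (u := 1 - s.rv 6) (v := s.rv 6) hl₂ hn (by simp [RExpr.eval, e₂])
    (by simp [RExpr.eval, e₂]) hs₂.perm).mono ?_)
  rintro t₃ s₃ hF₃ ⟨ht₃, hs₃, -⟩
  have hl₃ := hl₂.frame hF₃ rfl
  have e₃ : s₃.rv 6 = s.rv 6 := by rw [hF₃.rv 6 rfl, e₂]
  have e₃' : s₃.rv 7 = s.rv 7 := by rw [hF₃.rv 7 rfl, e₂']
  have hp₃ := hs₃.perm.trans hs₂.perm
  have hlex := hs₃.pairwise _ hs₂.sorted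
  refine wp_seq ((wp_forN (n := n) 1 (fun k s => ∀ i < k, s.ia 4 i = 0) (by decide) rfl rfl hl₃.iv
    (fun k s v h => h) ?_ (by simp)).mono ?_)
  · intro k s _ _ h₈ hz
    refine wp_iput ⟨le_rfl, fun i hi => ?_⟩
    simp only [State.setIa_ia, if_true, IExpr.eval, h₈, Function.update_apply]
    split_ifs with h
    · rfl
    · exact hz i (by omega)
  rintro t₄ s₄ hF₄ ⟨ht₄, hz₄⟩
  have hl₄ := hl₃.frame hF₄ rfl
  have e₄ : s₄.rv 6 = s.rv 6 := by rw [hF₄.rv 6 rfl, e₃]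
  have e₄' : s₄.rv 7 = s.rv 7 := by rw [hF₄.rv 7 rfl, e₃']
  have ei₄ : s₄.ia 2 = s₃.ia 2 := hF₄.ia 2 rfl
  refine wp_seq ((wp_sortBy (u := 1 - s.rv 7) (v := s.rv 7) hl₄ hn (by simp [RExpr.eval, e₄'])
    (by simp [RExpr.eval, e₄']) (by rw [ei₄]; exact hp₃)).mono ?_)
  rintro t₅ s₅ hF₅ ⟨ht₅, -, hc₅⟩
  have hl₅ := hl₄.frame hF₅ rfl
  have e₅ : s₅.rv 6 = s.rv 6 := by rw [hF₅.rv 6 rfl, e₄]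
  have e₅' : s₅.rv 7 = s.rv 7 := by rw [hF₅.rv 7 rfl, e₄']
  have hcnt : ∀ j < n, s₅.ia 4 j = (crossers a b (s.rv 6) (s.rv 7) n j).card := by
    intro j hj
    rw [hc₅ j hj, hz₄ j hj, zero_add, ei₄, invs_eq_countP hlex
      (hp₃.symm.subset (List.mem_range.2 hj)) (hp₃.nodup_iff.2 List.nodup_range), crossers,
      ← countP_eq_card_filter hp₃]
    exact List.countP_congr fun x _ => by rw [decide_eq_true_iff, decide_eq_true_iff]; rfl
  refine wp_seq (wp_iset ((wp_forN (x := 8) (n := n) 1 (fun k s => s.ia 4 = s₅.ia 4 ∧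
    s.iv 9 = ∑ j ∈ Finset.range k, s₅.ia 4 j) (by decide) rfl rfl ?_ ?_ ?_ ?_).mono ?_))
  · simpa using hl₅.iv
  · rintro k s v ⟨h₁, h₂⟩
    exact ⟨h₁, by simpa using h₂⟩
  · rintro k s _ _ h₈ ⟨h₁, h₂⟩
    exact wp_iset ⟨le_rfl, h₁, by simp [IExpr.eval, h₈, h₁, h₂, Finset.sum_range_succ]⟩
  · simp [IExpr.eval]
  · rintro t₆ s₆ hF₆ ⟨ht₆, h₁, h₂⟩
    have e₆ : s₆.rv 6 = s.rv 6 := by rw [hF₆.rv 6 rfl]; exact e₅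
    have e₆' : s₆.rv 7 = s.rv 7 := by rw [hF₆.rv 7 rfl]; exact e₅'
    refine ⟨by omega, ⟨fun j hj => ?_, ?_⟩⟩
    · rw [h₁, e₆, e₆', hcnt j hj]
    · rw [h₂, e₆, e₆', numCross]
      exact Finset.sum_congr rfl fun j hj => hcnt j (Finset.mem_range.1 hj)

end

/-! ### Choosing a crossing -/

/-- The combined score of the item in index variable `x`, for the direction in real variable
`d`. -/
def keyExpr (d x : ℕ) : RExpr :=
  .add (.mul (.sub (.const 1) (.var d)) (.get 0 (.var x))) (.mul (.var d) (.get 1 (.var x)))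

def crossTest : Test :=
  .and (.rlt (keyExpr 6 11) (keyExpr 6 12)) (.rlt (keyExpr 7 12) (keyExpr 7 11))

/-- Find the crossing whose number is in index variable `10`, and put its direction in real
variable `8`. -/
def pick : Cmd :=
  .seq (.iset 11 (.const 0))
  (.seq (.loop (.not (.ilt (.var 10) (.get 4 (.var 11))))
    (.seq (.iset 10 (.sub (.var 10) (.get 4 (.var 11)))) (.iset 11 (.add (.var 11) (.const 1)))))
  (.seq (.iset 12 (.const 0))
  (.seq (.loop (.not (.and crossTest (.ilt (.var 10) (.const 1))))
    (.seq (.ite crossTest (.iset 10 (.sub (.var 10) (.const 1))) .skip)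
      (.iset 12 (.add (.var 12) (.const 1)))))
  (.rset 8 (.div (.sub (.get 0 (.var 12)) (.get 0 (.var 11)))
    (.sub (.sub (.get 0 (.var 12)) (.get 0 (.var 11)))
      (.sub (.get 1 (.var 12)) (.get 1 (.var 11)))))))))

/-- The direction in which the items `i` and `j` have the same combined score. -/
noncomputable def crossDir {n : ℕ} (a b : Fin n → ℝ) (i j : ℕ) : ℝ :=
  (toArray a i - toArray a j) / ((toArray a i - toArray a j) - (toArray b i - toArray b j))

section
variable {O : Oracle} {s : State} {n : ℕ} {w a b : Fin n → ℝ}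

open Classical in
theorem card_crossers_succ (l h : ℝ) (k j : ℕ) : (crossers a b l h (k + 1) j).card =
    (crossers a b l h k j).card + if Crosses a b l h k j then 1 else 0 := by
  rw [crossers, Finset.range_add_one, Finset.filter_insert]
  split_ifs with hc
  · rw [Finset.card_insert_of_notMem (by simp)]
    rfl
  · rfl

open Classical in
theorem card_crossers_mono (l h : ℝ) {k k' : ℕ} (hk : k ≤ k') (j : ℕ) :
    (crossers a b l h k j).card ≤ (crossers a b l h k' j).card :=
  Finset.card_le_card (Finset.filter_subset_filter _ (Finset.range_subset_range.2 hk))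

theorem mem_crossers {l h : ℝ} {k i j : ℕ} :
    i ∈ crossers a b l h k j ↔ i < k ∧ Crosses a b l h i j := by
  simp [crossers]

theorem crossTest_eval (hl : Loaded w a b s) :
    crossTest.eval s ↔ Crosses a b (s.rv 6) (s.rv 7) (s.iv 12) (s.iv 11) := by
  simp [crossTest, Test.eval, keyExpr, RExpr.eval, IExpr.eval, Crosses, key, hl.ra₀, hl.ra₁]

/-- Crossings are numbered by `j` and then by `i`. The first loop subtracts the counts of whole
items, the second runs through the crossers of the item found; `hv` keeps both below `n`. The
formula for the number shows later that distinct numbers give distinct crossings. -/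
theorem wp_pick (hl : Loaded w a b s) (hc : Counted a b s)
    (hv : s.iv 10 < numCross a b (s.rv 6) (s.rv 7)) :
    wp O pick s fun t s' => t ≤ 10 * n + 12 ∧
      ∃ j < n, ∃ i < n, Crosses a b (s.rv 6) (s.rv 7) i j ∧
        s.iv 10 = ∑ j' ∈ Finset.range j, (crossers a b (s.rv 6) (s.rv 7) n j').card +
          (crossers a b (s.rv 6) (s.rv 7) i j).card ∧ s'.rv 8 = crossDir a b i j := by
  set l := s.rv 6 with hl₆
  set h := s.rv 7 with hl₇
  set v := s.iv 10 with hv₁₀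
  have hmono : ∀ j j', j ≤ j' → ∑ j' ∈ Finset.range j, (crossers a b l h n j').card ≤
      ∑ j' ∈ Finset.range j', (crossers a b l h n j').card := fun j j' hj =>
    Finset.sum_le_sum_of_subset (Finset.range_subset_range.2 hj)
  refine wp_seq (wp_iset (wp_seq ((wp_loop
    (fun s' => s'.ia 4 = s.ia 4 ∧
      s'.iv 10 + ∑ j' ∈ Finset.range (s'.iv 11), (crossers a b l h n j').card = v)
    (fun s' => (n - s'.iv 11) * 5) ?_ ?_).mono ?_)))
  · rintro s' ⟨h₄, hsum⟩ hb
    simp only [Test.eval, IExpr.eval, not_lt] at hb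
    have hj : s'.iv 11 < n := by
      by_contra hj
      have := hmono n _ (not_lt.1 hj)
      rw [numCross] at hv
      omega
    rw [h₄, hc.count _ hj] at hb
    refine wp_seq (wp_iset (wp_iset ?_))
    simp only [IExpr.eval, State.setIv_iv, State.setIv_ia, h₄, Nat.reduceEqDiff, if_true, if_false,
      Finset.sum_range_succ, true_and, hc.count _ hj, ← hl₆, ← hl₇] at hb ⊢
    exact ⟨by omega, by omega⟩
  · simp [IExpr.eval, hv₁₀]
  rintro t₁ s₁ hF₁ ⟨ht₁, ⟨h₄, hsum⟩, hb⟩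
  simp only [Test.eval, IExpr.eval, not_lt, not_le] at hb
  have hj : s₁.iv 11 < n := by
    by_contra hj
    have := hmono n _ (not_lt.1 hj)
    rw [numCross] at hv
    omega
  rw [h₄, hc.count _ hj, ← hl₆, ← hl₇] at hb
  have hl₁ : Loaded w a b s₁ := (hl.setIv (x := 11) (by decide) _).frame hF₁ rfl
  have e₆ : s₁.rv 6 = l := hF₁.rv 6 rfl
  have e₇ : s₁.rv 7 = h := hF₁.rv 7 rfl
  refine wp_seq (wp_iset (wp_seq ((wp_loop
    (fun s' => Loaded w a b s' ∧ s'.rv 6 = l ∧ s'.rv 7 = h ∧ s'.iv 11 = s₁.iv 11 ∧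
      s'.iv 10 + (crossers a b l h (s'.iv 12) (s₁.iv 11)).card = s₁.iv 10)
    (fun s' => (n - s'.iv 12) * 5) ?_ ?_).mono ?_)))
  · rintro s' ⟨hl', h₆, h₇, h₁₁, h₁₀⟩ hb'
    have hi : s'.iv 12 < n := by
      by_contra hi
      have : (crossers a b l h n (s₁.iv 11)).card ≤
          (crossers a b l h (s'.iv 12) (s₁.iv 11)).card :=
        card_crossers_mono l h (not_lt.1 hi) _
      omega
    have hcs := card_crossers_succ (a := a) (b := b) l h (s'.iv 12) (s₁.iv 11)
    simp only [Test.eval, IExpr.eval, crossTest_eval hl', h₆, h₇, h₁₁] at hb'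
    refine wp_seq (wp_ite (fun hx => wp_iset (wp_iset ?_)) fun hx => wp_skip (wp_iset ?_))
    · rw [crossTest_eval hl', h₆, h₇, h₁₁] at hx
      rw [if_pos hx] at hcs
      have : ¬ s'.iv 10 < 1 := fun h => hb' ⟨hx, h⟩
      simp only [IExpr.eval, State.setIv_iv, State.setIv_rv, Nat.reduceEqDiff, if_true, if_false,
        h₆, h₇, h₁₁, hcs, true_and]
      exact ⟨⟨(hl'.setIv (by decide) _).setIv (by decide) _, by omega⟩, by omega⟩
    · rw [crossTest_eval hl', h₆, h₇, h₁₁] at hx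
      rw [if_neg hx] at hcs
      simp only [IExpr.eval, State.setIv_iv, State.setIv_rv, Nat.reduceEqDiff, if_true, if_false,
        h₆, h₇, h₁₁, hcs, true_and]
      exact ⟨⟨hl'.setIv (by decide) _, by omega⟩, by omega⟩
  · refine ⟨hl₁.setIv (by decide) _, e₆, e₇, by simp, ?_⟩
    simp [IExpr.eval, crossers]
  · rintro t₂ s₂ - ⟨ht₂, ⟨hl₂, h₆, h₇, h₁₁, h₁₀⟩, hb₂⟩
    simp only [Test.eval, IExpr.eval, crossTest_eval hl₂, h₆, h₇, h₁₁, not_not] at hb₂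
    refine wp_rset ⟨?_, s₁.iv 11, hj, s₂.iv 12, ?_, hb₂.1, ?_, ?_⟩
    · simp only [State.setIv_iv, if_true, IExpr.eval] at ht₁ ht₂
      omega
    · by_contra hi
      have : (crossers a b l h n (s₁.iv 11)).card ≤
          (crossers a b l h (s₂.iv 12) (s₁.iv 11)).card :=
        card_crossers_mono l h (not_lt.1 hi) _
      omega
    · omega
    · simp [RExpr.eval, IExpr.eval, crossDir, hl₂.ra₀, hl₂.ra₁, h₁₁]

end

/-! ### The search interval -/

section
variable {n : ℕ} {w a b : Fin n → ℝ}

/-- The lead of `i` over `j` is affine in the direction, positive at `l` and negative at `h`. So it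
decreases strictly, and its zero lies strictly inside. -/
theorem Crosses.crossDir_mem {l h : ℝ} {i j : ℕ} (hlh : l < h) (hc : Crosses a b l h i j) :
    l < crossDir a b i j ∧ crossDir a b i j < h := by
  obtain ⟨h₁, h₂⟩ := hc
  simp only [key] at h₁ h₂
  set u := toArray a i - toArray a j with hu
  set v := toArray b i - toArray b j with hv
  have h₁' : l * (u - v) < u := by linarith
  have h₂' : u < h * (u - v) := by linarith
  have hpos : 0 < u - v := by
    by_contra hneg
    nlinarith [not_lt.1 hneg]
  rw [crossDir, ← hu, ← hv]
  exact ⟨(lt_div_iff₀ hpos).2 h₁', (div_lt_iff₀ hpos).2 h₂'⟩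

/-- An affine lead that is positive at `l` and negative at `m` stays negative beyond `m`. -/
theorem Crosses.of_left {l m h : ℝ} {i j : ℕ} (hlm : l < m) (hmh : m < h)
    (hc : Crosses a b l m i j) : Crosses a b l h i j ∧ crossDir a b i j < m := by
  refine ⟨⟨hc.1, ?_⟩, (hc.crossDir_mem hlm).2⟩
  obtain ⟨h₁, h₂⟩ := hc
  simp only [key] at *
  nlinarith

theorem Crosses.of_right {l m h : ℝ} {i j : ℕ} (hlm : l < m) (hmh : m < h)
    (hc : Crosses a b m h i j) : Crosses a b l h i j ∧ m < crossDir a b i j := by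
  refine ⟨⟨?_, hc.2⟩, (hc.crossDir_mem hmh).1⟩
  obtain ⟨h₁, h₂⟩ := hc
  simp only [key] at *
  nlinarith

theorem not_crosses_of_numCross_eq_zero {l h : ℝ} (h₀ : numCross a b l h = 0) {i j : ℕ}
    (hi : i < n) (hj : j < n) : ¬ Crosses a b l h i j := by
  intro hc
  rw [numCross, Finset.sum_eq_zero_iff] at h₀
  have := Finset.card_eq_zero.1 (h₀ j (Finset.mem_range.2 hj))
  exact Finset.notMem_empty i (this ▸ mem_crossers.2 ⟨hi, hc⟩)

/-- Without crossings between `l` and `h`, a ranking that is sorted for a direction between them is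
sorted for `l` and for `h`. -/
theorem Sorts.of_numCross_eq_zero {l m h : ℝ} (h₀ : numCross a b l h = 0) (hlm : l < m)
    (hmh : m < h) {σ : Equiv.Perm (Fin n)} (hσ : Sorts a b m σ) :
    Sorts a b l σ ∧ Sorts a b h σ := by
  have key_le : ∀ i j : Fin n, i ≤ j → _ := fun i j hij => hσ hij
  constructor <;> intro i j hij <;> by_contra hlt <;> have hm := key_le i j hij <;>
    simp only [not_le] at hlt hm
  · refine not_crosses_of_numCross_eq_zero h₀ (σ j).2 (σ i).2 ⟨?_, ?_⟩ <;>
      simp only [key, toArray_apply]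
    · linarith
    · nlinarith
  · refine not_crosses_of_numCross_eq_zero h₀ (σ i).2 (σ j).2 ⟨?_, ?_⟩ <;>
      simp only [key, toArray_apply]
    · nlinarith
    · linarith

end

/-- The invariant of the search. -/
structure Bracket {n : ℕ} (S : Set (ℝ × ℝ)) (f : ℝ × ℝ → ℝ) (w a b : Fin n → ℝ) (s : State)
    (σ τ : Equiv.Perm (Fin n)) : Prop where
  loaded : Loaded w a b s
  lo : s.lo.Valid S f w a b σ
  hi : s.hi.Valid S f w a b τ
  lo_le : s.lo.dir * (s.lo.dfst + s.lo.dsnd) ≤ s.lo.dsnd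
  lt_hi : s.hi.dsnd < s.hi.dir * (s.hi.dfst + s.hi.dsnd)
  lt : s.lo.dir < s.hi.dir
  crossings : s.crossings = 0

section
variable {O : Oracle} {s : State} {n : ℕ} {w a b : Fin n → ℝ} {S : Set (ℝ × ℝ)} {f : ℝ × ℝ → ℝ}

theorem Bracket.frame {c : Cmd} {s' : State} {σ τ : Equiv.Perm (Fin n)}
    (h : Bracket S f w a b s σ τ) (hF : Frame c s s') (hl : s'.lo = s.lo) (hh : s'.hi = s.hi)
    (hc : c.keepsInput = true) (hx : c.crosses = false) : Bracket S f w a b s' σ τ where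
  loaded := h.loaded.frame hF hc
  lo := hl ▸ h.lo
  hi := hh ▸ h.hi
  lo_le := hl ▸ h.lo_le
  lt_hi := hh ▸ h.lt_hi
  lt := hl ▸ hh ▸ h.lt
  crossings := (hF.crossings hx).trans h.crossings

/-- Probing a direction in the search interval halves the interval there. -/
theorem Bracket.wp_probe {σ τ : Equiv.Perm (Fin n)} (hI : Instance S f O w a b)
    (hB : Bracket S f w a b s σ τ) (h₁ : s.rv 6 < s.rv 8) (h₂ : s.rv 8 < s.rv 7) :
    wp O probe s fun t s' => t ≤ 100 * unit n ∧ ∃ ρ, Sorts a b (s.rv 8) ρ ∧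
      ((Bracket S f w a b s' ρ τ ∧ s'.rv 6 = s.rv 8 ∧ s'.rv 7 = s.rv 7) ∨
        (Bracket S f w a b s' σ ρ ∧ s'.rv 6 = s.rv 6 ∧ s'.rv 7 = s.rv 8)) := by
  refine (RankOpt.wp_probe hI hB.loaded).mono ?_
  rintro t s' hF ⟨ht, hl, h⟩
  refine ⟨ht, ?_⟩
  obtain ⟨ρ, hρ, hd, hle, he⟩ | ⟨ρ, hρ, hd, hle, he⟩ := h
  · exact ⟨ρ, hd ▸ hρ.sorts, Or.inl ⟨⟨hl, hρ, he ▸ hB.hi, hle, he ▸ hB.lt_hi,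
      by rw [hd, he]; exact h₂, (hF.crossings rfl).trans hB.crossings⟩, hd,
      congrArg Side.dir he⟩⟩
  · exact ⟨ρ, hd ▸ hρ.sorts, Or.inr ⟨⟨hl, he ▸ hB.lo, hρ, he ▸ hB.lo_le, hle,
      by rw [hd, he]; exact h₁, (hF.crossings rfl).trans hB.crossings⟩,
      congrArg Side.dir he, hd⟩⟩

/-- Probe both axes. -/
def initBracket : Cmd :=
  .seq (.rset 8 (.const 0)) (.seq probe (.seq (.rset 8 (.const 1)) probe))

theorem Side.Valid.pos {D : Side} {σ : Equiv.Perm (Fin n)} (hI : Instance S f O w a b)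
    (h : D.Valid S f w a b σ) : 0 < D.dfst ∧ 0 < D.dsnd := by
  rw [h.dfst, h.dsnd, h.fst, h.snd]
  exact hI.objective.gradient_pos (hI.scores_mem σ)

/-- Gradients have positive coordinates, so direction 0 can only become the lower end and direction
1 only the upper end. -/
theorem wp_initBracket (hI : Instance S f O w a b) (hl : Loaded w a b s)
    (hx : s.crossings = 0) :
    wp O initBracket s fun t s' => t ≤ 205 * unit n ∧ s'.rv 6 = 0 ∧ s'.rv 7 = 1 ∧
      ∃ σ τ, Bracket S f w a b s' σ τ := by
  have hu := le_unit n
  have hn := hI.pos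
  refine wp_seq (wp_rset (wp_seq ((RankOpt.wp_probe hI (hl.setRv _ _)).mono ?_)))
  rintro t s₁ hF₁ ⟨ht, hl₁, h⟩
  simp only [State.setRv_rv, if_true, RExpr.eval, Rat.cast_zero] at h
  obtain ⟨σ, hσ, hd, hle, -⟩ | ⟨ρ, hρ, hd, hle, -⟩ := h
  swap
  · have := hρ.pos hI
    rw [hd] at hle
    linarith
  refine wp_seq (wp_rset ((RankOpt.wp_probe hI (hl₁.setRv _ _)).mono ?_))
  rintro t' s₂ hF₂ ⟨ht', hl₂, h'⟩
  simp only [State.setRv_rv, if_true, RExpr.eval, Rat.cast_one] at h'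
  obtain ⟨ρ, hρ, hd', hle', -⟩ | ⟨τ, hτ, hd', hle', he⟩ := h'
  · have := hρ.pos hI
    rw [hd'] at hle'
    linarith
  have he' : s₂.lo = s₁.lo := he
  refine ⟨by omega, ?_, hd', σ, τ, hl₂, he' ▸ hσ, hτ, he' ▸ hle, hle', ?_, ?_⟩
  · exact (congrArg Side.dir he').trans hd
  · rw [he', hd, hd']
    exact one_pos
  · rw [hF₂.crossings rfl]
    exact (hF₁.crossings rfl).trans hx

end

/-! ### From the search interval to the solution -/

/-- Find the weight of the ranking in index array `0` in the solution. -/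
def chooseMix : Cmd :=
  .seq (.rset 23 (.sub (.var 9) (.var 13)))
  (.seq (.rset 24 (.sub (.var 23) (.sub (.var 10) (.var 14))))
  (.ite (.rlt (.const 0) (.var 24))
    (.seq (.rset 25 (.div (.var 23) (.var 24)))
    (.ite (.not (.rlt (.mul (.var 25) (.add (.var 11) (.var 12))) (.var 12)))
      (.rset 0 (.const 1))
      (.ite (.not (.rlt (.var 16) (.mul (.var 25) (.add (.var 15) (.var 16)))))
        (.rset 0 (.const 0))
        (.qcross 0 (.var 9) (.var 10) (.var 13) (.var 14)
          (.div (.var 25) (.sub (.const 1) (.var 25)))))))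
    (.rset 0 (.const 1))))

/-- The prices for the sorted items, from the last to the first. -/
def setPrices : Cmd :=
  .seq (.rset 26 (.const 0)) (.seq (.rset 27 (.const 0)) (.seq (.rset 28 (.const 0))
  (.seq (.rset 29 (.const 0)) (forN 8
    (.seq (.iset 13 (.sub (.sub (.var 0) (.const 1)) (.var 8)))
    (.seq (.rset 30 (.add (.mul (.var 3) (.get 0 (.get 2 (.var 13))))
      (.mul (.var 4) (.get 1 (.get 2 (.var 13))))))
    (.seq (.rset 26 (.add (.var 26) (.mul (.var 30) (.sub (.get 2 (.var 13)) (.var 28)))))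
    (.seq (.rset 27 (.add (.var 27) (.mul (.var 28) (.sub (.var 30) (.var 29)))))
    (.seq (.rput 3 (.var 13) (.var 26))
    (.seq (.rput 4 (.get 2 (.var 13)) (.var 27))
    (.seq (.rset 28 (.get 2 (.var 13))) (.rset 29 (.var 30)))))))))))))

def finish : Cmd :=
  .seq chooseMix
  (.seq (.rset 1 (.add (.mul (.var 0) (.var 9)) (.mul (.sub (.const 1) (.var 0)) (.var 13))))
  (.seq (.rset 2 (.add (.mul (.var 0) (.var 10)) (.mul (.sub (.const 1) (.var 0)) (.var 14))))
  (.seq (.qgrad 3 4 (.var 1) (.var 2))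
  (.seq (.qval 5 (.var 1) (.var 2))
  (.seq resetItems (.seq (sortBy (.var 3) (.var 4)) setPrices))))))

section
variable {O : Oracle} {s : State} {n : ℕ} {w a b : Fin n → ℝ} {S : Set (ℝ × ℝ)} {f : ℝ × ℝ → ℝ}

/-- The ranking `σ` is optimal for all directions from the lower end to `θ`, and `τ` from `θ` to the
upper end. If neither range contains the gradient of its own ranking, the two gradients lie on
different sides of `θ`, and the whole segment is optimal for `θ`. The program does not know `θ`, but
recovers it from the score pairs unless they coincide. -/
theorem wp_chooseMix {σ τ : Equiv.Perm (Fin n)} {θ : ℝ} (hI : Instance S f O w a b)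
    (hB : Bracket S f w a b s σ τ) (hσ : Sorts a b θ σ) (hτ : Sorts a b θ τ) :
    wp O chooseMix s fun t s' => t ≤ 10 ∧ s'.crossings ≤ 1 ∧ s'.rv 0 ∈ Set.Icc (0 : ℝ) 1 ∧
      ∀ z, z = s'.rv 0 • (cs w a σ, cs w b σ) + (1 - s'.rv 0) • (cs w a τ, cs w b τ) →
      ∀ ρ : Equiv.Perm (Fin n),
        (gradient S f z).1 * cs w a ρ + (gradient S f z).2 * cs w b ρ ≤
          (gradient S f z).1 * z.1 + (gradient S f z).2 * z.2 := by
  have hw := hI.weight.antitone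
  have e₉ : s.rv 9 = cs w a σ := hB.lo.fst
  have e₁₀ : s.rv 10 = cs w b σ := hB.lo.snd
  have e₁₃ : s.rv 13 = cs w a τ := hB.hi.fst
  have e₁₄ : s.rv 14 = cs w b τ := hB.hi.snd
  have e₁₁ : s.rv 11 = (gradient S f (cs w a σ, cs w b σ)).1 := by
    rw [← e₉, ← e₁₀]; exact hB.lo.dfst
  have e₁₂ : s.rv 12 = (gradient S f (cs w a σ, cs w b σ)).2 := by
    rw [← e₉, ← e₁₀]; exact hB.lo.dsnd
  have e₁₅ : s.rv 15 = (gradient S f (cs w a τ, cs w b τ)).1 := by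
    rw [← e₁₃, ← e₁₄]; exact hB.hi.dfst
  have e₁₆ : s.rv 16 = (gradient S f (cs w a τ, cs w b τ)).2 := by
    rw [← e₁₃, ← e₁₄]; exact hB.hi.dsnd
  obtain ⟨hp, hq⟩ := hI.objective.gradient_pos (hI.scores_mem σ)
  obtain ⟨hp', hq'⟩ := hI.objective.gradient_pos (hI.scores_mem τ)
  have hlo := hB.lo.sorts
  have hhi := hB.hi.sorts
  have hlt : s.rv 6 < s.rv 7 := hB.lt
  have hlo_le : s.rv 6 * (s.rv 11 + s.rv 12) ≤ s.rv 12 := hB.lo_le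
  have hlt_hi : s.rv 16 < s.rv 7 * (s.rv 15 + s.rv 16) := hB.lt_hi
  change Sorts a b (s.rv 6) σ at hlo
  change Sorts a b (s.rv 7) τ at hhi
  have k₁ := hlo.le hw τ
  have k₂ := hhi.le hw σ
  -- Two rankings optimal for `θ` have the same score there; solving for `θ` gives the quotient that
  -- the program computes.
  have k₃ : cs w a σ - cs w a τ = θ * ((cs w a σ - cs w a τ) - (cs w b σ - cs w b τ)) := by
    have h₁ := hσ.le hw τ
    have h₂ := hτ.le hw σ
    linarith
  rw [e₁₁, e₁₂] at hlo_le
  rw [e₁₅, e₁₆] at hlt_hi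
  refine wp_seq (wp_rset (wp_seq (wp_rset (wp_ite (fun hb => ?_) fun hb => ?_))))
  all_goals
    simp only [Test.eval, RExpr.eval, State.setRv_rv, Nat.reduceEqDiff, if_true, if_false,
      Rat.cast_zero, e₉, e₁₀, e₁₃, e₁₄, not_lt] at hb
  · have hθ : (cs w a σ - cs w a τ) / ((cs w a σ - cs w a τ) - (cs w b σ - cs w b τ)) = θ := by
      rw [div_eq_iff hb.ne']; exact k₃
    refine wp_seq (wp_rset (wp_ite (fun hb₁ => wp_rset ?_) fun hb₁ =>
      wp_ite (fun hb₂ => wp_rset ?_) fun hb₂ => wp_qcross ?_))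
    all_goals
      simp only [Test.eval, RExpr.eval, State.setRv_rv, State.setRv_crossings, Nat.reduceEqDiff,
        if_true, if_false, Rat.cast_zero, Rat.cast_one, e₉, e₁₀, e₁₃, e₁₄, e₁₁, e₁₂, e₁₅, e₁₆,
        not_lt, not_le, hθ, hB.crossings] at *
    · refine ⟨by norm_num, by norm_num, by norm_num, fun z hz ρ => ?_⟩
      simp only [one_smul, sub_self, zero_smul, add_zero] at hz
      subst hz
      exact hlo.le_of_between hw hσ rfl rfl (by linarith) hlo_le hb₁ ρ
    · refine ⟨by norm_num, by norm_num, by norm_num, fun z hz ρ => ?_⟩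
      simp only [one_smul, sub_zero, zero_smul, zero_add] at hz
      subst hz
      exact hτ.le_of_between hw hhi rfl rfl (by linarith) hb₂ hlt_hi.le ρ
    -- The failed test says that the gradient at `σ` points strictly above `θ`. It has a positive
    -- first coordinate, so `θ` is below 1 and the slope of the query is defined.
    · have hθ1 : 0 < 1 - θ := by nlinarith
      have hcr := hI.answers.crossing _ (hI.scores_mem σ) _ (hI.scores_mem τ) (θ / (1 - θ))
        (hI.objective.exists_crossing (hI.scores_mem σ) (hI.scores_mem τ)
          (by rw [div_mul_eq_mul_div, div_le_iff₀ hθ1]; linarith)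
          (by rw [div_mul_eq_mul_div, le_div_iff₀ hθ1]; linarith))
      refine ⟨by norm_num, by norm_num, hcr.1, fun z hz ρ => ?_⟩
      rw [← hz] at hcr
      have hm := hcr.1
      set m := O.crossing (cs w a σ, cs w b σ) (cs w a τ, cs w b τ) (θ / (1 - θ)) with hm_def
      have hmem : z ∈ S := by
        rw [hz]; exact hI.objective.combo_mem (hI.scores_mem σ) (hI.scores_mem τ) hm
      have hg := hI.objective.gradient_pos hmem
      have hz₁ : z.1 = m * cs w a σ + (1 - m) * cs w a τ := by rw [hz]; simp
      have hz₂ : z.2 = m * cs w b σ + (1 - m) * cs w b τ := by rw [hz]; simp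
      have h₁ := hσ.le hw ρ
      have h₂ := hτ.le hw ρ
      have h₃ : (1 - θ) * cs w a ρ + θ * cs w b ρ ≤ (1 - θ) * z.1 + θ * z.2 := by
        rw [hz₁, hz₂]
        nlinarith [mul_le_mul_of_nonneg_left h₁ hm.1,
          mul_le_mul_of_nonneg_left h₂ (sub_nonneg.2 hm.2)]
      have h₄ := mul_le_mul_of_nonneg_left h₃ (div_nonneg hg.1.le hθ1.le)
      -- On the line of the query the gradient is a positive multiple of (1 - θ, θ), so optimality
      -- for `θ` is optimality for the gradient.
      have h₅ : ∀ x y : ℝ, (gradient S f z).1 / (1 - θ) * ((1 - θ) * x + θ * y) =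
          (gradient S f z).1 * x + (gradient S f z).2 * y := by
        intro x y
        rw [hcr.2]
        field_simp
      rwa [h₅, h₅] at h₄
  · have hD : (cs w a σ - cs w a τ) - (cs w b σ - cs w b τ) = 0 := by
      -- Optimality of `σ` at the lower end and of `τ` at the upper end makes this difference
      -- nonnegative, so here it is zero. Then the score pairs coincide, and `σ` is optimal on the
      -- whole interval.
      refine le_antisymm hb ?_
      nlinarith
    rw [hD, mul_zero] at k₃
    have ea : cs w a σ = cs w a τ := by linarith
    have eb : cs w b σ = cs w b τ := by linarith
    refine wp_rset ?_
    simp only [RExpr.eval, State.setRv_rv, State.setRv_crossings, if_true, Rat.cast_one,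
      hB.crossings]
    refine ⟨by norm_num, by norm_num, by norm_num, fun z hz ρ => ?_⟩
    simp only [one_smul, sub_self, zero_smul, add_zero] at hz
    subst hz
    refine hlo.le_of_between hw hhi ea eb (by linarith) hlo_le ?_ ρ
    rw [ea, eb]
    exact hlt_hi.le

/-! ### Dual prices for the final gradient -/

theorem antitone_toArray (hw : IsWeight w) : Antitone (toArray w) := by
  intro i j hij
  rw [toArray, toArray]
  split_ifs with h₁ h₂ h₂
  · exact hw.antitone hij
  · omega
  · exact hw.nonneg _
  · exact le_rfl

theorem toArray_of_le {x : Fin n → ℝ} {k : ℕ} (hk : n ≤ k) : toArray x k = 0 :=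
  dif_neg (not_lt.2 hk)

/-- The combined score of the item in position `k`. -/
noncomputable def rankedKey (a b : Fin n → ℝ) (p q : ℝ) (P : ℕ → ℕ) (k : ℕ) : ℝ :=
  if k < n then key a b p q (P k) else 0

/-- The loop runs the recursions `price_succ` and `price'_succ` downwards from zero at `n`, with the
previous weight and key in real variables `28` and `29`. Row prices are stored by position, column
prices by item. -/
theorem wp_setPrices {ρ : Equiv.Perm (Fin n)} {p q : ℝ} (hl : Loaded w a b s)
    (hρ : ∀ i : Fin n, s.ia 2 i = ρ i) (hp : s.rv 3 = p) (hq : s.rv 4 = q) :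
    wp O setPrices s fun t s' => t ≤ n * 20 + 15 ∧ ∀ i : Fin n,
      s'.ra 3 i = price n (toArray w) (rankedKey a b p q (s.ia 2)) i ∧
      s'.ra 4 (ρ i) = price' n (toArray w) (rankedKey a b p q (s.ia 2)) i := by
  set P := s.ia 2 with hP
  set W := toArray w with hW
  set X := rankedKey a b p q P with hX
  have hW₀ : ∀ k, n ≤ k → W k = 0 := fun k hk => toArray_of_le hk
  have hX₀ : ∀ k, n ≤ k → X k = 0 := fun k hk => if_neg (not_lt.2 hk)
  have hPinj : ∀ i j, i < n → j < n → P i = P j → i = j := by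
    intro i j hi hj hij
    rw [hρ ⟨i, hi⟩, hρ ⟨j, hj⟩] at hij
    simpa using ρ.injective (Fin.ext hij)
  refine wp_seq (wp_rset (wp_seq (wp_rset (wp_seq (wp_rset (wp_seq (wp_rset ?_)))))))
  refine (wp_forN (x := 8) (n := n) 16 (fun k s' => Loaded w a b s' ∧ s'.ia 2 = P ∧ s'.rv 3 = p ∧
    s'.rv 4 = q ∧ s'.rv 26 = price n W X (n - k) ∧ s'.rv 27 = price' n W X (n - k) ∧
    s'.rv 28 = W (n - k) ∧ s'.rv 29 = X (n - k) ∧ ∀ l, n - k ≤ l → l < n →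
      s'.ra 3 l = price n W X l ∧ s'.ra 4 (P l) = price' n W X l)
    (by decide) rfl rfl ?_ ?_ ?_ ?_).mono ?_
  · simpa using hl.iv
  · rintro k s' v ⟨h, h'⟩
    exact ⟨h.setIv (by decide) v, h'⟩
  · rintro k s' hk h₀ h₈ ⟨hl', hP', h₃, h₄, h₂₆, h₂₇, h₂₈, h₂₉, hr⟩
    have ei : n - 1 - k = n - (k + 1) := by omega
    have ei' : n - k = n - (k + 1) + 1 := by omega
    have hin : n - (k + 1) < n := by omega
    have hXi : X (n - (k + 1)) = p * toArray a (P (n - (k + 1))) +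
        q * toArray b (P (n - (k + 1))) := by
      rw [hX, rankedKey, if_pos hin, key]
    have hp₁ := price_succ (w := W) hX₀ (n - (k + 1))
    have hp₂ := price'_succ (x := X) hW₀ (n - (k + 1))
    rw [← ei'] at hp₁ hp₂
    refine wp_seq (wp_iset (wp_seq (wp_rset (wp_seq (wp_rset (wp_seq (wp_rset (wp_seq (wp_rput
      (wp_seq (wp_rput (wp_seq (wp_rset (wp_rset ?_))))))))))))))
    simp only [RExpr.eval, IExpr.eval, State.setIv_iv, State.setIv_ia, State.setIv_rv,
      State.setIv_ra, State.setRv_iv, State.setRv_ia, State.setRv_rv, State.setRv_ra,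
      State.setRa_iv, State.setRa_ia, State.setRa_rv, State.setRa_ra, Nat.reduceEqDiff, if_true,
      if_false, hl'.ra₀, hl'.ra₁, hl'.ra₂, hP', h₃, h₄, h₂₆, h₂₇, h₂₈, h₂₉, h₀, h₈, ei, ← hXi,
      ← hW, true_and]
    refine ⟨by norm_num, ⟨?_, ?_, ?_, ?_⟩, ?_, ?_, fun l hl₁ hl₂ => ?_⟩
    · simpa using h₀
    · simpa using hl'.ra₀
    · simpa using hl'.ra₁
    · simpa using hl'.ra₂
    · rw [hp₁]
    · rw [hp₂, ei']
    · obtain rfl | hl₁ := hl₁.eq_or_lt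
      · rw [Function.update_self, Function.update_self, hp₁, hp₂, ei']
        exact ⟨rfl, rfl⟩
      · rw [Function.update_of_ne hl₁.ne', Function.update_of_ne fun h =>
          hl₁.ne' (hPinj _ _ hl₂ hin h)]
        exact hr l (by omega) hl₂
  · refine ⟨(((hl.setRv _ _).setRv _ _).setRv _ _).setRv _ _, ?_⟩
    simp [RExpr.eval, hp, hq, price, price', hW₀, hX₀]
    exact ⟨hP.symm, fun l h₁ h₂ => absurd h₂ (not_lt.2 h₁)⟩
  · rintro t s' - ⟨ht, -, -, -, -, -, -, -, -, hr⟩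
    refine ⟨by omega, fun i => ?_⟩
    rw [← hρ i]
    exact hr i (by omega) i.2

/-- The rankings at the ends need not be sorted for the gradient found. A third ranking `ρ`, sorted
for it, serves only to compute the prices. -/
theorem wp_finish {σ τ : Equiv.Perm (Fin n)} {θ : ℝ} (hI : Instance S f O w a b)
    (hB : Bracket S f w a b s σ τ) (hσ : Sorts a b θ σ) (hτ : Sorts a b θ τ) :
    wp O finish s fun t s' => t ≤ 130 * unit n ∧ Correct S f w a b s' := by
  have hn := hI.pos
  have hu := le_unit n
  have e₉ : s.rv 9 = cs w a σ := hB.lo.fst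
  have e₁₀ : s.rv 10 = cs w b σ := hB.lo.snd
  have e₁₃ : s.rv 13 = cs w a τ := hB.hi.fst
  have e₁₄ : s.rv 14 = cs w b τ := hB.hi.snd
  refine wp_seq ((wp_chooseMix hI hB hσ hτ).mono ?_)
  rintro t₁ s₁ hF₁ ⟨ht₁, hx, hm, hbest⟩
  have hl₁ := hB.loaded.frame hF₁ rfl
  refine wp_seq (wp_rset (wp_seq (wp_rset (wp_seq (wp_qgrad (wp_seq (wp_qval (wp_seq ?_))))))))
  simp only [RExpr.eval, State.setRv_rv, Nat.reduceEqDiff, if_true, if_false, Rat.cast_one,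
    hF₁.rv 9 rfl, hF₁.rv 10 rfl, hF₁.rv 13 rfl, hF₁.rv 14 rfl, e₉, e₁₀, e₁₃, e₁₄]
  set α := s₁.rv 0 * cs w a σ + (1 - s₁.rv 0) * cs w a τ with hα
  set β := s₁.rv 0 * cs w b σ + (1 - s₁.rv 0) * cs w b τ with hβ
  have hz : ((α, β) : ℝ × ℝ) =
      s₁.rv 0 • (cs w a σ, cs w b σ) + (1 - s₁.rv 0) • (cs w a τ, cs w b τ) := by simp [hα, hβ]
  have hmem : (α, β) ∈ S := by
    rw [hz]; exact hI.objective.combo_mem (hI.scores_mem σ) (hI.scores_mem τ) hm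
  have hbest' := hbest _ hz
  have hpos := hI.objective.gradient_pos hmem
  rw [hI.answers.val _ hmem, hI.answers.grad _ hmem]
  set p := (gradient S f (α, β)).1 with hp
  set q := (gradient S f (α, β)).2 with hq
  set s₂ := ((((s₁.setRv 1 α).setRv 2 β).setRv 3 p).setRv 4 q).setRv 5 (f (α, β)) with hs₂
  have hl₂ : Loaded w a b s₂ :=
    ((((hl₁.setRv _ _).setRv _ _).setRv _ _).setRv _ _).setRv _ _
  refine (wp_resetItems hl₂.iv).mono ?_
  rintro t₃ s₃ hF₃ ⟨ht₃, hid⟩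
  have hl₃ := hl₂.frame hF₃ rfl
  refine wp_seq ((wp_sortBy (u := p) (v := q) hl₃ hn ?_ ?_ (by rw [hid])).mono ?_)
  · simp [RExpr.eval, hF₃.rv 3 rfl, hs₂]
  · simp [RExpr.eval, hF₃.rv 4 rfl, hs₂]
  rintro t₄ s₄ hF₄ ⟨ht₄, hsort, -⟩
  have hl₄ := hl₃.frame hF₄ rfl
  rw [hid] at hsort
  obtain ⟨ρ, hρ⟩ := exists_perm_of_slice_perm hsort.perm
  refine (wp_setPrices (p := p) (q := q) hl₄ hρ (by simp [hF₄.rv 3 rfl, hF₃.rv 3 rfl, hs₂])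
    (by simp [hF₄.rv 4 rfl, hF₃.rv 4 rfl, hs₂])).mono ?_
  rintro t₅ s₅ hF₅ ⟨ht₅, hpr⟩
  have hrv : ∀ x < 6, s₅.rv x = s₂.rv x := by
    intro x hx
    interval_cases x <;> rw [hF₅.rv _ rfl, hF₄.rv _ rfl, hF₃.rv _ rfl]
  have r₀ : s₅.rv 0 = s₁.rv 0 := by rw [hrv 0 (by norm_num)]; simp [hs₂]
  have r₁ : s₅.rv 1 = α := by rw [hrv 1 (by norm_num)]; simp [hs₂]
  have r₂ : s₅.rv 2 = β := by rw [hrv 2 (by norm_num)]; simp [hs₂]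
  have r₃ : s₅.rv 3 = p := by rw [hrv 3 (by norm_num)]; simp [hs₂]
  have r₄ : s₅.rv 4 = q := by rw [hrv 4 (by norm_num)]; simp [hs₂]
  have r₅ : s₅.rv 5 = f (α, β) := by rw [hrv 5 (by norm_num)]; simp [hs₂]
  have hia₀ : s₅.ia 0 = s.ia 0 := by
    rw [hF₅.ia 0 rfl, hF₄.ia 0 rfl, hF₃.ia 0 rfl]
    exact hF₁.ia 0 rfl
  have hia₁ : s₅.ia 1 = s.ia 1 := by
    rw [hF₅.ia 1 rfl, hF₄.ia 1 rfl, hF₃.ia 1 rfl]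
    exact hF₁.ia 1 rfl
  have hcr : s₅.crossings ≤ 1 := by
    rw [hF₅.crossings rfl, hF₄.crossings rfl, hF₃.crossings rfl]
    exact hx
  set P := s₄.ia 2 with hP
  set X := rankedKey a b p q P with hX
  have hkey : ∀ k : Fin n, key a b p q k = p * a k + q * b k := fun k => by simp [key]
  have hXk : ∀ k : Fin n, X k = p * a (ρ k) + q * b (ρ k) := fun k => by
    rw [hX, rankedKey, if_pos k.2, hρ, hkey]
  have hkey₀ : ∀ k : Fin n, 0 ≤ p * a k + q * b k := fun k =>
    add_nonneg (mul_nonneg hpos.1.le (hI.nonneg_a k)) (mul_nonneg hpos.2.le (hI.nonneg_b k))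
  have hX_nonneg : ∀ k, 0 ≤ X k := by
    intro k
    by_cases hk : k < n
    · have := hkey₀ (ρ ⟨k, hk⟩)
      rwa [← hXk] at this
    · rw [hX, rankedKey, if_neg hk]
  have hXanti : Antitone X := by
    intro i j hij
    by_cases hj : j < n
    · obtain rfl | hij := hij.eq_or_lt
      · exact le_rfl
      · rw [hX, rankedKey, rankedKey, if_pos hj, if_pos (hij.trans hj)]
        exact lt_of_pairwise_slice hsort.sorted hij hj
    · rw [show X j = 0 from if_neg hj]
      exact hX_nonneg i
  have hX₀ : ∀ k, n ≤ k → X k = 0 := fun k hk => if_neg (not_lt.2 hk)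
  have hW := antitone_toArray hI.weight
  have hW₀ : ∀ k, n ≤ k → toArray w k = 0 := fun k hk => toArray_of_le hk
  have hW_nonneg : ∀ k, 0 ≤ toArray w k := by
    intro k
    rw [← hW₀ (max n k) (le_max_left _ _)]
    exact hW (le_max_right _ _)
  have hdual : DualFeasible w a b (fun i => s₅.ra 3 i) (fun j => s₅.ra 4 j) p q := by
    refine ⟨fun i => ?_, fun j => ?_, hpos.1.le, hpos.2.le, fun i j => ?_⟩
    · rw [(hpr i).1]
      exact price_nonneg hW hX_nonneg _
    · have := (hpr (ρ.symm j)).2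
      rw [Equiv.apply_symm_apply] at this
      rw [this]
      exact price'_nonneg hW_nonneg hXanti _
    · have h₂ := (hpr (ρ.symm j)).2
      rw [Equiv.apply_symm_apply] at h₂
      have h₃ := hXk (ρ.symm j)
      rw [Equiv.apply_symm_apply] at h₃
      rw [(hpr i).1, h₂, ← h₃, ← toArray_apply w i]
      exact mul_le_price_add_price' hW hXanti hW₀ hX₀ i.2.le (ρ.symm j).2.le
  have hsum : ∑ i : Fin n, s₅.ra 3 i + ∑ j : Fin n, s₅.ra 4 j =
      p * cs w a ρ + q * cs w b ρ := by
    rw [← Equiv.sum_comp ρ (fun j : Fin n => s₅.ra 4 j), ← Finset.sum_add_distrib, ← cs_add]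
    refine Finset.sum_congr rfl fun i _ => ?_
    rw [(hpr i).1, (hpr i).2, price_add_price' hW₀ hX₀ i.2.le, toArray_apply, hXk]
  refine ⟨by omega, ⟨σ, τ, solves_of_certificate (ρ := ρ) hI.objective hI.scores_mem
    (fun i => ?_) (fun i => ?_) ?_ ?_ ?_ ?_ ?_ ?_ ?_ ?_ ?_⟩, hcr⟩
  · rw [hia₀]; exact hB.lo.items i
  · rw [hia₁]; exact hB.hi.items i
  · rw [r₀]; exact hm
  · rw [r₀, r₁]
  · rw [r₀, r₂]
  · rw [r₁, r₂, r₃]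
  · rw [r₁, r₂, r₄]
  · rw [r₁, r₂, r₅]
  · rw [r₁, r₂, r₃, r₄]; exact hbest'
  · rw [r₃, r₄]; exact hdual
  · rw [r₃, r₄]; exact hsum

end

/-! ### Integer scores: bisection -/

/-- The largest score, or `1` if that is larger. -/
def maxScore : Cmd :=
  .seq (.rset 31 (.const 1)) (forN 8
    (.seq (.ite (.rlt (.var 31) (.get 0 (.var 8))) (.rset 31 (.get 0 (.var 8))) .skip)
      (.ite (.rlt (.var 31) (.get 1 (.var 8))) (.rset 31 (.get 1 (.var 8))) .skip)))

/-- The interval must become shorter than 1 / (4M²), the least distance between distinct crossings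
of integer scores at most M. Here M is real variable `31`. -/
def bisect : Cmd :=
  .loop (.not (.rlt (.mul (.sub (.var 7) (.var 6)) (.mul (.const 4) (.mul (.var 31) (.var 31))))
      (.const 1)))
    (.seq (.rset 8 (.div (.add (.var 6) (.var 7)) (.const 2))) probe)

def exactProgram : Cmd :=
  .seq initBracket (.seq maxScore (.seq bisect finish))

section
variable {O : Oracle} {s : State} {n : ℕ} {w a b : Fin n → ℝ} {S : Set (ℝ × ℝ)} {f : ℝ × ℝ → ℝ}

/-- The program is not given `B`. Its stopping rule uses the actual maximum, and the upper bound by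
`B` enters only the running time. -/
theorem wp_maxScore (hl : Loaded w a b s) {B : ℝ} (hB : 1 ≤ B) (ha : ∀ j, a j ≤ B)
    (hb : ∀ j, b j ≤ B) :
    wp O maxScore s fun t s' => t ≤ n * 8 + 5 ∧ 1 ≤ s'.rv 31 ∧ s'.rv 31 ≤ B ∧
      (∀ j, a j ≤ s'.rv 31) ∧ ∀ j, b j ≤ s'.rv 31 := by
  refine wp_seq (wp_rset ((wp_forN (x := 8) (n := n) 5 (fun k s' => s'.ra 0 = toArray a ∧
    s'.ra 1 = toArray b ∧ 1 ≤ s'.rv 31 ∧ s'.rv 31 ≤ B ∧ ∀ i < k, toArray a i ≤ s'.rv 31 ∧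
      toArray b i ≤ s'.rv 31) (by decide) rfl rfl ?_ (fun k s v h => h) ?_ ?_).mono ?_))
  · simpa using hl.iv
  · rintro k s hk - h₈ ⟨h₀, h₁, h1, hM, hi⟩
    have hak : toArray a k ≤ B := (toArray_apply a ⟨k, hk⟩).le.trans (ha _)
    have hbk : toArray b k ≤ B := (toArray_apply b ⟨k, hk⟩).le.trans (hb _)
    have hi' : ∀ i < k + 1, ∀ M : ℝ, s.rv 31 ≤ M → toArray a k ≤ M → toArray b k ≤ M →
        toArray a i ≤ M ∧ toArray b i ≤ M := by
      intro i hik M h₁ h₂ h₃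
      obtain rfl | hik := (Nat.lt_succ_iff.1 hik).eq_or_lt
      · exact ⟨h₂, h₃⟩
      · exact ⟨(hi i hik).1.trans h₁, (hi i hik).2.trans h₁⟩
    refine wp_seq (wp_ite (fun c₁ => wp_rset (wp_ite (fun c₂ => wp_rset ?_) fun c₂ => wp_skip ?_))
      fun c₁ => wp_skip (wp_ite (fun c₂ => wp_rset ?_) fun c₂ => wp_skip ?_))
    all_goals
      simp only [Test.eval, RExpr.eval, IExpr.eval, State.setRv_rv, State.setRv_ra,
        State.setRv_iv, if_true, h₀, h₁, h₈, not_lt] at c₁ c₂ ⊢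
    · exact ⟨by norm_num, trivial, trivial, by linarith, hbk,
        fun i h => hi' i h _ (by linarith) (by linarith) (by linarith)⟩
    · exact ⟨by norm_num, trivial, trivial, by linarith, hak,
        fun i h => hi' i h _ (by linarith) (by linarith) (by linarith)⟩
    · exact ⟨by norm_num, trivial, trivial, by linarith, hbk,
        fun i h => hi' i h _ (by linarith) (by linarith) (by linarith)⟩
    · exact ⟨by norm_num, trivial, trivial, by linarith, hM,
        fun i h => hi' i h _ (by linarith) (by linarith) (by linarith)⟩
  · simp [RExpr.eval, hl.ra₀, hl.ra₁, hB]
  · rintro t s' - ⟨ht, -, -, h₁, h₂, h₃⟩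
    refine ⟨by omega, h₁, h₂, fun j => ?_, fun j => ?_⟩
    · simpa using (h₃ j j.2).1
    · simpa using (h₃ j j.2).2

/-- In a short interval, all pairs of items with integer scores cross in the same direction. -/
theorem exists_common_crossing {a b : Fin n → ℤ} {M l h : ℝ} (hM : 1 ≤ M) (ha₀ : ∀ j, 0 ≤ (a j : ℝ))
    (hb₀ : ∀ j, 0 ≤ (b j : ℝ)) (ha : ∀ j, (a j : ℝ) ≤ M) (hb : ∀ j, (b j : ℝ) ≤ M) (hlh : l < h)
    (hgap : (h - l) * (4 * (M * M)) < 1) :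
    ∃ θ ∈ Set.Icc l h, ∀ i j, ∀ θ' ∈ Set.Icc l h,
      (a i - a j : ℝ) - (b i - b j) ≠ 0 → (a i - a j : ℝ) = θ' * ((a i - a j) - (b i - b j)) →
      θ' = θ := by
  by_cases hex : ∃ i j, ∃ θ ∈ Set.Icc l h, (a i - a j : ℝ) - (b i - b j) ≠ 0 ∧
      (a i - a j : ℝ) = θ * ((a i - a j) - (b i - b j))
  · obtain ⟨i, j, θ, hθ, hD, hu⟩ := hex
    refine ⟨θ, hθ, fun i' j' θ' hθ' hD' hu' => ?_⟩
    have habs : ∀ i j, |(a i - a j : ℝ) - (b i - b j)| ≤ 2 * M := fun i j => by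
      rw [abs_le]
      constructor <;> linarith [ha₀ i, ha₀ j, hb₀ i, hb₀ j, ha i, ha j, hb i, hb j]
    set D := (a i - a j : ℝ) - (b i - b j) with hD_def
    set D' := (a i' - a j' : ℝ) - (b i' - b j') with hD'_def
    -- The difference of two fractions times both denominators is an integer, and the short interval
    -- makes its absolute value smaller than 1.
    have hint : (θ' - θ) * (D * D') = (((a i' - a j') * ((a i - a j) - (b i - b j)) -
        (a i - a j) * ((a i' - a j') - (b i' - b j')) : ℤ) : ℝ) := by
      push_cast
      rw [← hD_def, ← hD'_def, hu, hu']
      ring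
    have hlt : |(θ' - θ) * (D * D')| < 1 := by
      refine lt_of_le_of_lt ?_ hgap
      rw [abs_mul, abs_mul]
      have h₁ : |θ' - θ| ≤ h - l := by
        rw [abs_le]
        constructor <;> linarith [hθ.1, hθ.2, hθ'.1, hθ'.2]
      have h₂ : |D| * |D'| ≤ 4 * (M * M) := by
        calc |D| * |D'| ≤ (2 * M) * (2 * M) :=
              mul_le_mul (habs i j) (habs i' j') (abs_nonneg _) (by linarith)
          _ = _ := by ring
      exact mul_le_mul h₁ h₂ (by positivity) (by linarith)
    rw [hint, ← Int.cast_abs] at hlt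
    have hzero : ((a i' - a j') * ((a i - a j) - (b i - b j)) -
        (a i - a j) * ((a i' - a j') - (b i' - b j'))) = 0 :=
      Int.abs_lt_one_iff.1 (by exact_mod_cast hlt)
    rw [hzero, Int.cast_zero] at hint
    have := (mul_eq_zero.1 hint).resolve_right (mul_ne_zero hD hD')
    linarith
  -- Without any crossing the choice is free.
  · exact ⟨l, ⟨le_rfl, hlh.le⟩, fun i j θ' hθ' hD hu => absurd ⟨i, j, θ', hθ', hD, hu⟩ hex⟩

/-- Take the only possible crossing direction `θ`. If a ranking sorted at one end were not sorted
for `θ`, some pair would change its order before `θ` is reached, at the direction `u / D` of the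
interval, which differs from `θ`. -/
theorem exists_common_sorts {a b : Fin n → ℤ} {M l h : ℝ} (hM : 1 ≤ M) (ha₀ : ∀ j, 0 ≤ (a j : ℝ))
    (hb₀ : ∀ j, 0 ≤ (b j : ℝ)) (ha : ∀ j, (a j : ℝ) ≤ M) (hb : ∀ j, (b j : ℝ) ≤ M) (hlh : l < h)
    (hgap : (h - l) * (4 * (M * M)) < 1) {σ τ : Equiv.Perm (Fin n)}
    (hσ : Sorts (fun j => (a j : ℝ)) (fun j => (b j : ℝ)) l σ)
    (hτ : Sorts (fun j => (a j : ℝ)) (fun j => (b j : ℝ)) h τ) :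
    ∃ θ, Sorts (fun j => (a j : ℝ)) (fun j => (b j : ℝ)) θ σ ∧
      Sorts (fun j => (a j : ℝ)) (fun j => (b j : ℝ)) θ τ := by
  obtain ⟨θ, hθ, huniq⟩ := exists_common_crossing hM ha₀ hb₀ ha hb hlh hgap
  refine ⟨θ, fun i j hij => ?_, fun i j hij => ?_⟩ <;> by_contra hlt
  · have h₁ := hσ hij
    have h₂ := huniq (σ i) (σ j)
    simp only [not_le] at h₁ hlt
    set u := (a (σ i) - a (σ j) : ℝ) with hu
    set D := u - (b (σ i) - b (σ j) : ℝ) with hD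
    have k₁ : l * D ≤ u := by rw [hD, hu]; linarith
    have k₂ : u < θ * D := by rw [hD, hu]; linarith
    have hpos : 0 < D := by
      by_contra hneg
      nlinarith [hθ.1, not_lt.1 hneg]
    have := h₂ (u / D) ⟨(le_div_iff₀ hpos).2 k₁, (div_le_iff₀ hpos).2
      (k₂.le.trans (mul_le_mul_of_nonneg_right hθ.2 hpos.le))⟩ hpos.ne'
      (div_mul_cancel₀ _ hpos.ne').symm
    rw [div_eq_iff hpos.ne'] at this
    linarith
  · have h₁ := hτ hij
    have h₂ := huniq (τ j) (τ i)
    simp only [not_le] at h₁ hlt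
    set u := (a (τ j) - a (τ i) : ℝ) with hu
    set D := u - (b (τ j) - b (τ i) : ℝ) with hD
    have k₁ : u ≤ h * D := by rw [hD, hu]; linarith
    have k₂ : θ * D < u := by rw [hD, hu]; linarith
    have hpos : 0 < D := by
      by_contra hneg
      nlinarith [hθ.2, not_lt.1 hneg]
    have := h₂ (u / D) ⟨(le_div_iff₀ hpos).2 ((mul_le_mul_of_nonneg_right hθ.1 hpos.le).trans
      k₂.le), (div_le_iff₀ hpos).2 k₁⟩ hpos.ne'
      (div_mul_cancel₀ _ hpos.ne').symm
    rw [div_eq_iff hpos.ne'] at this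
    linarith

/-- Midpoints keep the length equal to a power of 1/2 exactly. The potential reads the exponent back
from the state, as the binary logarithm of the inverse length. -/
theorem wp_bisect {M : ℝ} {B : ℕ} (hI : Instance S f O w a b) (hM : 1 ≤ M) (hMB : M ≤ B)
    (hs : s.rv 31 = M) (h₆ : s.rv 6 = 0) (h₇ : s.rv 7 = 1)
    (hB : ∃ σ τ, Bracket S f w a b s σ τ) :
    wp O bisect s fun t s' => t ≤ (Nat.log 2 (4 * B ^ 2) + 2) * (104 * unit n) ∧
      (s'.rv 7 - s'.rv 6) * (4 * (M * M)) < 1 ∧ ∃ σ τ, Bracket S f w a b s' σ τ := by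
  have hu : 1 ≤ unit n := hI.pos.trans (le_unit n)
  refine (wp_loop (fun s => s.rv 31 = M ∧ (∃ r : ℕ, s.rv 7 - s.rv 6 = (2 ^ r)⁻¹) ∧
    ∃ σ τ, Bracket S f w a b s σ τ)
    (fun s => (Nat.log 2 (4 * B ^ 2) + 1 - Nat.log 2 ⌊(s.rv 7 - s.rv 6)⁻¹⌋₊) * (104 * unit n))
    ?_ ?_).mono ?_
  · rintro s ⟨hs, ⟨r, hr⟩, σ, τ, hB⟩ hb
    have hlt : s.rv 6 < s.rv 7 := hB.lt
    have hlog : ∀ (s : State) (r : ℕ), s.rv 7 - s.rv 6 = (2 ^ r)⁻¹ →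
        Nat.log 2 ⌊(s.rv 7 - s.rv 6)⁻¹⌋₊ = r := by
      intro s r hr
      rw [hr, inv_inv, show ((2 : ℝ) ^ r) = ((2 ^ r : ℕ) : ℝ) by push_cast; rfl, Nat.floor_natCast,
        Nat.log_pow one_lt_two]
    have hrle : r ≤ Nat.log 2 (4 * B ^ 2) := by
      simp only [Test.eval, RExpr.eval, hs, hr, not_lt] at hb
      refine Nat.le_log_of_pow_le one_lt_two ?_
      rw [inv_mul_eq_div, le_div_iff₀ (by positivity)] at hb
      have : ((2 ^ r : ℕ) : ℝ) ≤ ((4 * B ^ 2 : ℕ) : ℝ) := by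
        push_cast at hb ⊢
        nlinarith
      exact_mod_cast this
    refine wp_seq (wp_rset ?_)
    have hB' : Bracket S f w a b (s.setRv 8
        (RExpr.eval s (.div (.add (.var 6) (.var 7)) (.const 2)))) σ τ :=
      ⟨hB.loaded.setRv _ _, hB.lo, hB.hi, hB.lo_le, hB.lt_hi, hB.lt, hB.crossings⟩
    refine (hB'.wp_probe hI ?_ ?_).mono ?_
    · simp [RExpr.eval]; linarith
    · simp [RExpr.eval]; linarith
    rintro t s' hF ⟨ht, ρ, -, h⟩
    have hr' : s'.rv 7 - s'.rv 6 = (2 ^ (r + 1))⁻¹ := by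
      have e : ((2 : ℝ) ^ (r + 1))⁻¹ = (2 ^ r)⁻¹ / 2 := by rw [pow_succ, mul_inv]; ring
      simp only [State.setRv_rv, if_true, Nat.reduceEqDiff, if_false, RExpr.eval] at h
      rw [e, ← hr]
      obtain ⟨-, h₁, h₂⟩ | ⟨-, h₁, h₂⟩ := h <;> rw [h₁, h₂] <;> push_cast <;> ring
    refine ⟨⟨?_, ⟨r + 1, hr'⟩, ?_⟩, ?_⟩
    · rw [hF.rv 31 rfl]
      exact hs
    · obtain ⟨h, -⟩ | ⟨h, -⟩ := h
      exacts [⟨_, _, h⟩, ⟨_, _, h⟩]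
    · rw [hlog _ _ hr, hlog _ _ hr']
      obtain ⟨d, hd⟩ := Nat.exists_eq_add_of_le hrle
      rw [hd, show r + d + 1 - r = d + 1 by omega, show r + d + 1 - (r + 1) = d by omega]
      nlinarith
  · exact ⟨hs, ⟨0, by rw [h₆, h₇]; norm_num⟩, hB⟩
  · rintro t s' - ⟨ht, ⟨hs', -, hB'⟩, hb⟩
    refine ⟨?_, ?_, hB'⟩
    · have : (Nat.log 2 (4 * B ^ 2) + 1 - Nat.log 2 ⌊(s.rv 7 - s.rv 6)⁻¹⌋₊) * (104 * unit n) ≤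
          (Nat.log 2 (4 * B ^ 2) + 1) * (104 * unit n) := Nat.mul_le_mul_right _ (Nat.sub_le _ _)
      linarith
    · simpa [Test.eval, RExpr.eval, hs'] using hb

theorem loaded_start (prog : Cmd) : Loaded w a b (start prog a b w).2 :=
  ⟨by simp [start], by simp [start], by simp [start], by simp [start]⟩

theorem wp_exactProgram {a b : Fin n → ℤ} {B : ℕ}
    (hI : Instance S f O w (fun j => (a j : ℝ)) (fun j => (b j : ℝ))) (hB : 1 ≤ B)
    (ha : ∀ j, |a j| ≤ (B : ℤ)) (hb : ∀ j, |b j| ≤ (B : ℤ)) :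
    wp O exactProgram (start exactProgram (fun j => (a j : ℝ)) (fun j => (b j : ℝ)) w).2
      fun t s' => t ≤ unit n * (700 + 104 * Nat.log 2 (4 * B ^ 2)) ∧
        Correct S f w (fun j => (a j : ℝ)) (fun j => (b j : ℝ)) s' := by
  have hu : n ≤ unit n := le_unit n
  have hn := hI.pos
  have ha' : ∀ j, (a j : ℝ) ≤ B := fun j => by exact_mod_cast (abs_le.1 (ha j)).2
  have hb' : ∀ j, (b j : ℝ) ≤ B := fun j => by exact_mod_cast (abs_le.1 (hb j)).2
  refine wp_seq ((wp_initBracket hI (loaded_start _) rfl).mono ?_)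
  rintro t₁ s₁ hF₁ ⟨ht₁, h₆, h₇, σ, τ, hB₁⟩
  refine wp_seq ((wp_maxScore hB₁.loaded (B := B) (by exact_mod_cast hB) ha' hb').mono ?_)
  rintro t₂ s₂ hF₂ ⟨ht₂, hM₁, hMB, hMa, hMb⟩
  have hB₂ := hB₁.frame hF₂ (State.lo_eq_of_frame hF₂ rfl) (State.hi_eq_of_frame hF₂ rfl) rfl rfl
  refine wp_seq ((wp_bisect hI hM₁ hMB rfl (by rw [hF₂.rv 6 rfl, h₆]) (by rw [hF₂.rv 7 rfl, h₇])
    ⟨σ, τ, hB₂⟩).mono ?_)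
  rintro t₃ s₃ hF₃ ⟨ht₃, hgap, σ', τ', hB₃⟩
  obtain ⟨θ, hσ, hτ⟩ := exists_common_sorts hM₁ hI.nonneg_a hI.nonneg_b hMa hMb hB₃.lt hgap
    hB₃.lo.sorts hB₃.hi.sorts
  refine (wp_finish hI hB₃ hσ hτ).mono ?_
  rintro t₄ s₄ - ⟨ht₄, hc⟩
  refine ⟨?_, hc⟩
  nlinarith

/-! ### Running times in natural logarithms -/

theorem natLog_le_log (n : ℕ) : (Nat.log 2 n : ℝ) ≤ 2 * Real.log n := by
  refine (Real.natLog_le_logb n 2).trans ?_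
  rw [Real.logb, div_le_iff₀ (by positivity)]
  have h₁ : (0 : ℝ) ≤ Real.log n := Real.log_natCast_nonneg n
  have h₂ : (1 / 2 : ℝ) ≤ Real.log (2 : ℕ) := by
    have := Real.log_two_gt_d9
    push_cast
    linarith
  calc Real.log n = 2 * (Real.log n * (1 / 2)) := by ring
    _ ≤ 2 * (Real.log n * Real.log (2 : ℕ)) := by gcongr
    _ = 2 * Real.log n * Real.log (2 : ℕ) := by ring

theorem one_le_two_mul_log {n : ℕ} (hn : 1 ≤ n) : 1 ≤ 2 * Real.log (n + 1) := by
  have h₁ : Real.log 2 ≤ Real.log (n + 1) :=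
    Real.log_le_log (by norm_num) (by have : (1 : ℝ) ≤ n := by exact_mod_cast hn
                                      linarith)
  have := Real.log_two_gt_d9
  linarith

theorem log_le_log_succ {n : ℕ} (hn : 1 ≤ n) : Real.log n ≤ Real.log (n + 1) :=
  Real.log_le_log (by exact_mod_cast hn) (by linarith)

theorem unit_le {n : ℕ} (hn : 1 ≤ n) : (unit n : ℝ) ≤ 4 * (n * Real.log (n + 1)) := by
  rw [unit]
  push_cast
  have h₁ := natLog_le_log n
  have h₂ := one_le_two_mul_log hn
  have h₃ := log_le_log_succ hn
  have h₄ : (0 : ℝ) ≤ n := Nat.cast_nonneg n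
  have : (Nat.log 2 n + 1 : ℝ) ≤ 4 * Real.log (n + 1) := by linarith
  nlinarith

theorem exactProgram_time {n B t : ℕ} (hn : 1 ≤ n) (hB : 1 ≤ B)
    (ht : t ≤ unit n * (700 + 104 * Nat.log 2 (4 * B ^ 2))) :
    (t : ℝ) ≤ 20000 * n * Real.log (n + 1) * Real.log (B + 1) := by
  have h₁ := natLog_le_log (4 * B ^ 2)
  have hB' : (B : ℝ) ≠ 0 := by positivity
  have h₂ : Real.log ((4 * B ^ 2 : ℕ) : ℝ) = Real.log 4 + 2 * Real.log B := by
    push_cast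
    rw [Real.log_mul (by norm_num) (by positivity), Real.log_pow]
    push_cast
    ring
  have h₃ : Real.log 4 ≤ 2 := by
    rw [show (4 : ℝ) = 2 ^ 2 by norm_num, Real.log_pow]
    have := Real.log_two_lt_d9
    push_cast
    linarith
  have h₄ := one_le_two_mul_log hB
  have h₅ := log_le_log_succ hB
  have h₆ : (700 + 104 * Nat.log 2 (4 * B ^ 2) : ℝ) ≤ 5000 * Real.log (B + 1) := by
    rw [h₂] at h₁
    linarith
  have h₇ : (t : ℝ) ≤ unit n * (700 + 104 * Nat.log 2 (4 * B ^ 2)) := by exact_mod_cast ht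
  calc (t : ℝ) ≤ unit n * (700 + 104 * Nat.log 2 (4 * B ^ 2)) := h₇
    _ ≤ (4 * (n * Real.log (n + 1))) * (5000 * Real.log (B + 1)) :=
        mul_le_mul (unit_le hn) h₆ (by positivity) (by
          have := one_le_two_mul_log hn
          have : (0 : ℝ) ≤ Real.log (n + 1) := by linarith
          positivity)
    _ = _ := by ring

theorem exists_exact_program : ∃ prog : Cmd, prog.RandFree ∧ ∃ K : ℝ,
    ∀ (n B : ℕ) (a b : Fin n → ℤ) (w : Fin n → ℝ)
      (S : Set (ℝ × ℝ)) (f : ℝ × ℝ → ℝ) (O : Oracle),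
      Instance S f O w (fun j => (a j : ℝ)) (fun j => (b j : ℝ)) →
      1 ≤ B → (∀ j, |a j| ≤ (B : ℤ)) → (∀ j, |b j| ≤ (B : ℤ)) →
      ∃ T : ℕ, (T : ℝ) ≤ K * n * Real.log (n + 1) * Real.log (B + 1) ∧
        ∀ y ∈ (run O T (start prog (fun j => (a j : ℝ)) (fun j => (b j : ℝ)) w)).support,
          y.1 = [] ∧ Correct S f w (fun j => (a j : ℝ)) (fun j => (b j : ℝ)) y.2 := by
  refine ⟨exactProgram, ?_, 20000, ?_⟩
  · simp [exactProgram, initBracket, probe, resetItems, sortBy, setKeys, mergeSort, mergePass,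
      mergeBlocks, mergeLoop, mergeStep, copyLoop, score, keepHi, keepLo, maxScore, bisect, finish,
      chooseMix, setPrices, forN, Cmd.RandFree]
  · intro n B a b w S f O hI hB ha hb
    obtain ⟨t, s', hE, ht, hc⟩ := wp_exactProgram hI hB ha hb
    refine ⟨t, exactProgram_time hI.pos hB ht, fun y hy => ?_⟩
    have hrun := hE.run_eq [] 0
    rw [add_zero] at hrun
    replace hrun : run O t (start exactProgram (fun j => (a j : ℝ)) (fun j => (b j : ℝ)) w) =
      run O 0 ([], s') := hrun
    rw [hrun, run, PMF.support_pure, Set.mem_singleton_iff] at hy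
    rw [hy]
    exact ⟨rfl, hc⟩

end

/-! ### Runs of randomized programs -/

section
variable {O : Oracle}

theorem run_halted (O : Oracle) (t : ℕ) (s : State) : run O t ([], s) = PMF.pure ([], s) := by
  induction t with
  | zero => rfl
  | succ t ih => rw [run_succ, step, PMF.pure_bind, ih]

theorem run_add (O : Oracle) (t u : ℕ) (x : Config) :
    run O (t + u) x = (run O t x).bind (run O u) := by
  induction t generalizing x with
  | zero => rw [zero_add, run, PMF.pure_bind]
  | succ t ih =>
    rw [show t + 1 + u = (t + u) + 1 by ring, run_succ, run_succ, PMF.bind_bind]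
    congr 1
    funext y
    exact ih y

/-- Whenever the machine, started in `x`, halts, the memory satisfies `C`. -/
def Safe (O : Oracle) (C : State → Prop) (x : Config) : Prop :=
  ∀ t, ∀ y ∈ (run O t x).support, y.1 = [] → C y.2

theorem safe_halted {C : State → Prop} {s : State} (h : C s) : Safe O C ([], s) := by
  intro t y hy _
  rw [run_halted, PMF.support_pure, Set.mem_singleton_iff] at hy
  rwa [hy]

theorem safe_of_step {C : State → Prop} {x : Config} (hx : x.1 ≠ [])
    (h : ∀ y ∈ (step O x).support, Safe O C y) : Safe O C x := by
  intro t y hy hy₀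
  cases t with
  | zero =>
    rw [run, PMF.support_pure, Set.mem_singleton_iff] at hy
    exact absurd (hy ▸ hy₀) hx
  | succ t =>
    rw [run_succ, PMF.mem_support_bind_iff] at hy
    obtain ⟨z, hz, hy⟩ := hy
    exact h z hz t y hy hy₀

/-- A halted configuration stays put, so a run that halts after `u` steps can be prolonged by `t`
steps; then the deterministic prefix can be peeled off. -/
theorem Exec.safe {C : State → Prop} {c : Cmd} {s s' : State} {t : ℕ} {L : List Cmd}
    (h : Exec O c s t s') (hs : Safe O C (L, s')) : Safe O C (c :: L, s) := by
  intro u y hy hy₀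
  have hmem : y ∈ (run O (u + t) (c :: L, s)).support := by
    rw [run_add, PMF.mem_support_bind_iff]
    refine ⟨y, hy, ?_⟩
    obtain ⟨L', s''⟩ := y
    obtain rfl : L' = [] := hy₀
    rw [run_halted, PMF.support_pure]
    rfl
  rw [add_comm, h.run_eq L u] at hmem
  exact hs u y hmem hy₀

theorem probRunning_succ (t : ℕ) (x : Config) :
    probRunning O (t + 1) x = ∑' y, step O x y * probRunning O t y := by
  rw [probRunning, run_succ, PMF.toOuterMeasure_bind_apply]
  rfl

theorem probRunning_le_one (t : ℕ) (x : Config) : probRunning O t x ≤ 1 := by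
  rw [probRunning, PMF.toOuterMeasure_apply]
  calc _ ≤ ∑' y, run O t x y := ENNReal.tsum_le_tsum fun y => Set.indicator_le_self _ _ y
    _ = 1 := PMF.tsum_coe _

theorem probRunning_halted (t : ℕ) (s : State) : probRunning O t ([], s) = 0 := by
  rw [probRunning, run_halted, PMF.toOuterMeasure_pure_apply]
  simp

theorem probRunning_antitone (x : Config) : Antitone fun t => probRunning O t x := by
  refine antitone_nat_of_succ_le fun t => ?_
  induction t generalizing x with
  | zero =>
    obtain ⟨L, s⟩ := x
    cases L with
    | nil => rw [probRunning_halted]; exact zero_le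
    | cons c L =>
      refine (probRunning_le_one _ _).trans ?_
      rw [probRunning, run, PMF.toOuterMeasure_pure_apply]
      simp
  | succ t ih =>
    rw [probRunning_succ, probRunning_succ t]
    exact ENNReal.tsum_le_tsum fun y => by gcongr; exact ih y

theorem Exec.probRunning_eq {c : Cmd} {s s' : State} {t : ℕ} (h : Exec O c s t s')
    (L : List Cmd) (u : ℕ) : probRunning O (t + u) (c :: L, s) = probRunning O u (L, s') := by
  rw [probRunning, probRunning, h.run_eq]

theorem Exec.probRunning_le {c : Cmd} {s s' : State} {t T : ℕ} (h : Exec O c s t s')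
    (hT : t ≤ T) (L : List Cmd) (u : ℕ) :
    probRunning O (T + u) (c :: L, s) ≤ probRunning O u (L, s') := by
  rw [← h.probRunning_eq L u]
  exact probRunning_antitone _ (by omega)

theorem probRunning_seq (t : ℕ) (c d : Cmd) (L : List Cmd) (s : State) :
    probRunning O (t + 1) (.seq c d :: L, s) = probRunning O t (c :: d :: L, s) := by
  rw [probRunning, run_succ, step, PMF.pure_bind, probRunning]

theorem probRunning_loop (t : ℕ) {b : Test} {c : Cmd} (L : List Cmd) {s : State}
    (hb : b.eval s) :
    probRunning O (t + 1) (.loop b c :: L, s) = probRunning O t (c :: .loop b c :: L, s) := by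
  rw [probRunning, run_succ, step, if_pos hb, PMF.pure_bind, probRunning]

theorem probRunning_rand (t x : ℕ) (e : IExpr) (L : List Cmd) (s : State) :
    probRunning O (t + 1) (.rand x e :: L, s) = ∑ v ∈ Finset.range (e.eval s + 1),
      ((e.eval s + 1 : ℕ) : ℝ≥0∞)⁻¹ * probRunning O t (L, s.setIv x v) := by
  classical
  rw [probRunning, run_succ, step, PMF.bind_map, PMF.toOuterMeasure_bind_apply,
    tsum_eq_sum (s := Finset.range (e.eval s + 1))]
  · refine Finset.sum_congr rfl fun v hv => ?_
    rw [PMF.uniformOfFinset_apply_of_mem _ hv, Finset.card_range]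
    rfl
  · intro v hv
    rw [PMF.uniformOfFinset_apply_of_notMem _ hv, zero_mul]

theorem safe_rand {C : State → Prop} {x : ℕ} {e : IExpr} {L : List Cmd} {s : State}
    (h : ∀ v < e.eval s + 1, Safe O C (L, s.setIv x v)) : Safe O C (.rand x e :: L, s) := by
  refine safe_of_step (by simp) fun y hy => ?_
  rw [step, PMF.mem_support_map_iff] at hy
  obtain ⟨v, hv, rfl⟩ := hy
  rw [PMF.support_uniformOfFinset, Finset.coe_range] at hv
  exact h v hv

theorem safe_seq {C : State → Prop} {c d : Cmd} {L : List Cmd} {s : State}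
    (h : Safe O C (c :: d :: L, s)) : Safe O C (.seq c d :: L, s) := by
  refine safe_of_step (by simp) fun y hy => ?_
  rw [step, PMF.support_pure, Set.mem_singleton_iff] at hy
  rwa [hy]

theorem safe_loop {C : State → Prop} {b : Test} {c : Cmd} {L : List Cmd} {s : State}
    (hb : b.eval s) (h : Safe O C (c :: .loop b c :: L, s)) : Safe O C (.loop b c :: L, s) := by
  refine safe_of_step (by simp) fun y hy => ?_
  rw [step, if_pos hb, PMF.support_pure, Set.mem_singleton_iff] at hy
  rwa [hy]

/-- The time until a process halts, counted in blocks of `b` steps. -/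
theorem tsum_le_mul_tsum_of_antitone {f : ℕ → ℝ≥0∞} (hf : Antitone f) {b : ℕ} (hb : 1 ≤ b) :
    ∑' t, f t ≤ b * ∑' m, f (m * b) := by
  have : NeZero b := ⟨by omega⟩
  rw [← (Nat.divModEquiv b).symm.tsum_eq,
    ENNReal.tsum_prod (f := fun m i => f ((Nat.divModEquiv b).symm (m, i))),
    ← ENNReal.tsum_mul_left]
  refine ENNReal.tsum_le_tsum fun m => ?_
  rw [tsum_fintype]
  calc ∑ i : Fin b, f ((Nat.divModEquiv b).symm (m, i)) ≤ ∑ _i : Fin b, f (m * b) :=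
        Finset.sum_le_sum fun i _ => hf (by simp [Nat.divModEquiv])
    _ = _ := by simp

/-- The first `M` terms cost at most 1 each, and the geometric tail sums to 4. -/
theorem tsum_le_add_of_geometric {f : ℕ → ℝ≥0∞} {M : ℕ} (h₁ : ∀ m, f m ≤ 1)
    (h : ∀ m, f (M + m) ≤ (3 / 4) ^ m) : ∑' m, f m ≤ M + 4 := by
  rw [← ENNReal.summable.sum_add_tsum_nat_add' (k := M)]
  refine add_le_add ?_ ?_
  · calc ∑ i ∈ Finset.range M, f i ≤ ∑ _i ∈ Finset.range M, 1 :=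
          Finset.sum_le_sum fun i _ => h₁ i
      _ = M := by simp
  · calc ∑' i, f (i + M) ≤ ∑' i, (3 / 4 : ℝ≥0∞) ^ i :=
          ENNReal.tsum_le_tsum fun i => by rw [add_comm]; exact h i
      _ = 4 := by
          rw [ENNReal.tsum_geometric]
          have : (1 : ℝ≥0∞) - 3 / 4 = 4⁻¹ := by
            refine ENNReal.sub_eq_of_eq_add (ENNReal.div_ne_top (by simp) (by simp)) ?_
            rw [ENNReal.div_eq_inv_mul, ← mul_one (4⁻¹ : ℝ≥0∞), mul_assoc, ← mul_add, one_mul,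
              show (1 + 3 : ℝ≥0∞) = 4 by norm_num]
            exact (ENNReal.inv_mul_cancel (by simp) (by simp)).symm
          rw [this, inv_inv]

end

/-! ### Random pivots -/

/-- A pivot of rank `r` leaves at most `max r (N - 1 - r)` elements. Going from `N` to `N + 2` adds
the two extreme ranks, with value `N + 1` each, and raises every other term by 1. -/
theorem four_mul_sum_max_le (N : ℕ) :
    4 * ∑ r ∈ Finset.range N, max r (N - 1 - r) ≤ 3 * N ^ 2 := by
  induction N using Nat.twoStepInduction with
  | zero => simp
  | one => simp
  | more N ih _ =>
    rw [Finset.sum_range_succ, Finset.sum_range_succ']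
    have : ∑ r ∈ Finset.range N, max (r + 1) (N + 2 - 1 - (r + 1)) =
        ∑ r ∈ Finset.range N, (max r (N - 1 - r) + 1) :=
      Finset.sum_congr rfl fun r hr => by
        have := Finset.mem_range.1 hr
        omega
    rw [this, Finset.sum_add_distrib, Finset.sum_const, Finset.card_range]
    simp only [smul_eq_mul, mul_one]
    have h₁ : max 0 (N + 2 - 1 - 0) = N + 1 := by omega
    have h₂ : max (N + 1) (N + 2 - 1 - (N + 1)) = N + 1 := by omega
    rw [h₁, h₂]
    nlinarith

open Classical in
/-- If splitting at the pivot `v` leaves at most the elements on one side of it, a uniformly random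
pivot leaves three quarters of the elements on average. -/
theorem four_mul_sum_le_of_pivot {N : ℕ} (g : Fin N → ℝ) (m : Fin N → ℕ)
    (hm : ∀ v, m v ≤ (Finset.univ.filter fun u => g u < g v).card ∨
      m v ≤ (Finset.univ.filter fun u => g v < g u).card) :
    4 * ∑ v, m v ≤ 3 * N ^ 2 := by
  have hsort : Monotone (g ∘ Tuple.sort g) := Tuple.monotone_sort g
  -- Elements strictly below (above) the pivot come before (after) it in the sorted order; ties only
  -- help.
  have hle : ∀ r : Fin N, m (Tuple.sort g r) ≤ max (r : ℕ) (N - 1 - r) := by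
    intro r
    have h₁ : (Finset.univ.filter fun u => g u < g (Tuple.sort g r)).card ≤ r := by
      calc _ ≤ ((Finset.Iio r).map (Tuple.sort g).toEmbedding).card := by
            refine Finset.card_le_card fun u hu => ?_
            simp only [Finset.mem_filter, Finset.mem_univ, true_and] at hu
            refine Finset.mem_map.2 ⟨(Tuple.sort g).symm u, ?_, by simp⟩
            rw [Finset.mem_Iio]
            by_contra hlt
            have := hsort (not_lt.1 hlt)
            simp only [Function.comp_apply, Equiv.apply_symm_apply] at this
            linarith
        _ = r := by rw [Finset.card_map, Fin.card_Iio]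
    have h₂ : (Finset.univ.filter fun u => g (Tuple.sort g r) < g u).card ≤ N - 1 - r := by
      calc _ ≤ ((Finset.Ioi r).map (Tuple.sort g).toEmbedding).card := by
            refine Finset.card_le_card fun u hu => ?_
            simp only [Finset.mem_filter, Finset.mem_univ, true_and] at hu
            refine Finset.mem_map.2 ⟨(Tuple.sort g).symm u, ?_, by simp⟩
            rw [Finset.mem_Ioi]
            by_contra hlt
            have := hsort (not_lt.1 hlt)
            simp only [Function.comp_apply, Equiv.apply_symm_apply] at this
            linarith
        _ = N - 1 - r := by rw [Finset.card_map, Fin.card_Ioi]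
    obtain h | h := hm (Tuple.sort g r)
    · exact (h.trans h₁).trans (le_max_left _ _)
    · exact (h.trans h₂).trans (le_max_right _ _)
  calc 4 * ∑ v, m v = 4 * ∑ r, m (Tuple.sort g r) := by
        rw [Equiv.sum_comp (Tuple.sort g) m]
    _ ≤ 4 * ∑ r : Fin N, max (r : ℕ) (N - 1 - r) := by
        gcongr with r
        exact hle r
    _ = 4 * ∑ r ∈ Finset.range N, max r (N - 1 - r) := by
        rw [Finset.sum_range fun r => max r (N - 1 - r)]
    _ ≤ _ := four_mul_sum_max_le N

/-! ### Real scores: random pivots -/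

/-- Move an end of the search interval to the crossing whose number is in index variable `10`. -/
def splitAtCrossing : Cmd := .seq pick (.seq probe count)

def searchLoop : Cmd :=
  .loop (.ilt (.const 0) (.var 9))
    (.seq (.rand 10 (.sub (.var 9) (.const 1))) splitAtCrossing)

/-- Solve the problem when there are no crossings inside the search interval. -/
def solveInside : Cmd :=
  .seq (.seq (.rset 8 (.div (.add (.var 6) (.var 7)) (.const 2))) probe) finish

def randomizedProgram : Cmd :=
  .seq (.seq initBracket count) (.seq searchLoop solveInside)

/-- The invariant of the randomized search. -/
def Search {n : ℕ} (S : Set (ℝ × ℝ)) (f : ℝ × ℝ → ℝ) (w a b : Fin n → ℝ) (s : State) : Prop :=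
  (∃ σ τ, Bracket S f w a b s σ τ) ∧ Counted a b s

section
variable {O : Oracle} {s : State} {n : ℕ} {w a b : Fin n → ℝ} {S : Set (ℝ × ℝ)} {f : ℝ × ℝ → ℝ}

theorem numCross_le (l h : ℝ) : numCross a b l h ≤ n ^ 2 := by
  calc numCross a b l h ≤ ∑ _j ∈ Finset.range n, n := Finset.sum_le_sum fun j _ => by
        classical
        exact (Finset.card_filter_le _ _).trans_eq (Finset.card_range n)
    _ = n ^ 2 := by simp [sq]

/-- The crossings between the directions `l` and `h`. -/
noncomputable def crossPairs (a b : Fin n → ℝ) (l h : ℝ) : Finset (Σ _ : ℕ, ℕ) :=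
  (Finset.range n).sigma fun j => crossers a b l h n j

theorem card_crossPairs (l h : ℝ) : (crossPairs a b l h).card = numCross a b l h :=
  Finset.card_sigma _ _

theorem mem_crossPairs {l h : ℝ} {x : Σ _ : ℕ, ℕ} :
    x ∈ crossPairs a b l h ↔ x.1 < n ∧ x.2 < n ∧ Crosses a b l h x.2 x.1 := by
  simp [crossPairs, mem_crossers]

open Classical in
/-- Crossings in the half interval below (above) the crossing number `v` have a smaller (larger)
direction. -/
theorem four_mul_sum_numCross_le {l h : ℝ} {N : ℕ} (hN : N = numCross a b l h) (hlh : l < h)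
    (p : Fin N → Σ _ : ℕ, ℕ) (hp : Function.Injective p) (hmem : ∀ v, p v ∈ crossPairs a b l h)
    (m : Fin N → ℕ)
    (hm : ∀ v, m v = numCross a b l (crossDir a b (p v).2 (p v).1) ∨
      m v = numCross a b (crossDir a b (p v).2 (p v).1) h) :
    (∀ v, m v < N) ∧ 4 * ∑ v, m v ≤ 3 * N ^ 2 := by
  -- An injection into a set of the same size: the draw is uniform over all crossings.
  have himage : Finset.univ.image p = crossPairs a b l h := by
    refine Finset.eq_of_subset_of_card_le ?_ ?_
    · intro x hx
      obtain ⟨v, -, rfl⟩ := Finset.mem_image.1 hx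
      exact hmem v
    · rw [Finset.card_image_of_injective _ hp, card_crossPairs, Finset.card_univ,
        Fintype.card_fin, hN]
  set g : Fin N → ℝ := fun v => crossDir a b (p v).2 (p v).1 with hg
  have hdir : ∀ v, l < g v ∧ g v < h := fun v =>
    (mem_crossPairs.1 (hmem v)).2.2.crossDir_mem hlh
  have hbound : ∀ v, m v ≤ (Finset.univ.filter fun u => g u < g v).card ∨
      m v ≤ (Finset.univ.filter fun u => g v < g u).card := by
    intro v
    obtain h₁ | h₁ := hm v
    · left
      rw [h₁, ← card_crossPairs]
      refine (Finset.card_le_card (t := (Finset.univ.filter fun u => g u < g v).image p) ?_).trans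
        Finset.card_image_le
      intro x hx
      obtain ⟨h₂, h₃, h₄⟩ := mem_crossPairs.1 hx
      obtain ⟨h₅, h₆⟩ := h₄.of_left (hdir v).1 (hdir v).2
      have : x ∈ Finset.univ.image p := himage ▸ mem_crossPairs.2 ⟨h₂, h₃, h₅⟩
      obtain ⟨u, -, rfl⟩ := Finset.mem_image.1 this
      exact Finset.mem_image_of_mem _ (Finset.mem_filter.2 ⟨Finset.mem_univ _, h₆⟩)
    · right
      rw [h₁, ← card_crossPairs]
      refine (Finset.card_le_card (t := (Finset.univ.filter fun u => g v < g u).image p) ?_).trans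
        Finset.card_image_le
      intro x hx
      obtain ⟨h₂, h₃, h₄⟩ := mem_crossPairs.1 hx
      obtain ⟨h₅, h₆⟩ := h₄.of_right (hdir v).1 (hdir v).2
      have : x ∈ Finset.univ.image p := himage ▸ mem_crossPairs.2 ⟨h₂, h₃, h₅⟩
      obtain ⟨u, -, rfl⟩ := Finset.mem_image.1 this
      exact Finset.mem_image_of_mem _ (Finset.mem_filter.2 ⟨Finset.mem_univ _, h₆⟩)
  refine ⟨fun v => ?_, four_mul_sum_le_of_pivot g m hbound⟩
  obtain h₁ | h₁ := hbound v
  · refine h₁.trans_lt ((Finset.card_lt_univ_of_notMem (x := v) (by simp)).trans_eq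
      (Fintype.card_fin N))
  · refine h₁.trans_lt ((Finset.card_lt_univ_of_notMem (x := v) (by simp)).trans_eq
      (Fintype.card_fin N))

theorem Search.setIv (h : Search S f w a b s) (v : ℕ) : Search S f w a b (s.setIv 10 v) := by
  obtain ⟨⟨σ, τ, hB⟩, hc⟩ := h
  exact ⟨⟨σ, τ, hB.loaded.setIv (by decide) _, hB.lo, hB.hi, hB.lo_le, hB.lt_hi, hB.lt,
    hB.crossings⟩, hc.count, hc.total⟩

theorem wp_splitAtCrossing (hI : Instance S f O w a b) (hs : Search S f w a b s)
    (hv : s.iv 10 < s.iv 9) :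
    wp O splitAtCrossing s fun t s' => t ≤ 315 * unit n ∧ Search S f w a b s' ∧
      ∃ j < n, ∃ i < n, Crosses a b (s.rv 6) (s.rv 7) i j ∧
        s.iv 10 = ∑ j' ∈ Finset.range j, (crossers a b (s.rv 6) (s.rv 7) n j').card +
          (crossers a b (s.rv 6) (s.rv 7) i j).card ∧
        (s'.iv 9 = numCross a b (s.rv 6) (crossDir a b i j) ∨
          s'.iv 9 = numCross a b (crossDir a b i j) (s.rv 7)) := by
  have hu := le_unit n
  have hn := hI.pos
  obtain ⟨⟨σ, τ, hB⟩, hc⟩ := hs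
  refine wp_seq ((wp_pick hB.loaded hc (hc.total ▸ hv)).mono ?_)
  rintro t₁ s₁ hF₁ ⟨ht₁, j, hj, i, hi, hx, hnum, h₈⟩
  have hB₁ := hB.frame hF₁ (State.lo_eq_of_frame hF₁ rfl) (State.hi_eq_of_frame hF₁ rfl) rfl rfl
  have e₆ : s₁.rv 6 = s.rv 6 := hF₁.rv 6 rfl
  have e₇ : s₁.rv 7 = s.rv 7 := hF₁.rv 7 rfl
  have hdir := hx.crossDir_mem hB.lt
  refine wp_seq ((hB₁.wp_probe hI (by rw [e₆, h₈]; exact hdir.1)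
    (by rw [e₇, h₈]; exact hdir.2)).mono ?_)
  rintro t₂ s₂ hF₂ ⟨ht₂, ρ, -, h⟩
  rw [e₆, e₇, h₈] at h
  have hl₂ : Loaded w a b s₂ := hB₁.loaded.frame hF₂ rfl
  refine (wp_count hn hl₂).mono ?_
  rintro t₃ s₃ hF₃ ⟨ht₃, hc₃⟩
  have e₆' : s₃.rv 6 = s₂.rv 6 := hF₃.rv 6 rfl
  have e₇' : s₃.rv 7 = s₂.rv 7 := hF₃.rv 7 rfl
  have htot := hc₃.total
  rw [e₆', e₇'] at htot
  have hfr : ∀ {σ τ}, Bracket S f w a b s₂ σ τ → Bracket S f w a b s₃ σ τ := fun hB =>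
    hB.frame hF₃ (State.lo_eq_of_frame hF₃ rfl) (State.hi_eq_of_frame hF₃ rfl) rfl rfl
  refine ⟨by omega, ⟨?_, hc₃⟩, j, hj, i, hi, hx, hnum, ?_⟩
  · obtain ⟨h, -⟩ | ⟨h, -⟩ := h
    exacts [⟨_, _, hfr h⟩, ⟨_, _, hfr h⟩]
  · obtain ⟨-, h₁, h₂⟩ | ⟨-, h₁, h₂⟩ := h <;> rw [h₁, h₂] at htot
    exacts [Or.inr htot, Or.inl htot]

/-- After the draw a round is deterministic, so its outcome is a function of the number drawn, and
the average over the draw becomes a finite sum. The numbering in `wp_pick` makes the chosen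
crossings distinct. -/
theorem exists_splits (hI : Instance S f O w a b) (hs : Search S f w a b s) :
    ∃ S' : Fin (s.iv 9) → State, (∀ v, Search S f w a b (S' v) ∧ (S' v).iv 9 < s.iv 9 ∧
      ∃ t ≤ 315 * unit n, Exec O splitAtCrossing (s.setIv 10 v) t (S' v)) ∧
      4 * ∑ v, (S' v).iv 9 ≤ 3 * s.iv 9 ^ 2 := by
  have hsplit : ∀ v : Fin (s.iv 9), _ := fun v =>
    wp_splitAtCrossing hI (hs.setIv v) (by simp)
  choose t S' hE ht hS j hj i hi hx hnum hm using hsplit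
  simp only [State.setIv_rv, State.setIv_iv, if_true] at hx hnum hm
  obtain ⟨⟨σ, τ, hB⟩, hc⟩ := hs
  obtain ⟨hlt, hsum⟩ := four_mul_sum_numCross_le (l := s.rv 6) (h := s.rv 7) hc.total hB.lt
    (fun v => ⟨j v, i v⟩) (fun u v huv => by
      simp only [Sigma.mk.injEq, heq_eq_eq] at huv
      rw [Fin.ext_iff, hnum u, hnum v, huv.1, huv.2])
    (fun v => mem_crossPairs.2 ⟨hj v, hi v, hx v⟩) (fun v => (S' v).iv 9) hm
  exact ⟨S', fun v => ⟨hS v, hlt v, t v, ht v, hE v⟩, hsum⟩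

/-- Ties may be broken differently at the two ends, so their rankings need not share a direction
even without crossings inside. The ranking at the midpoint is sorted for both ends; whichever end it
replaces, it shares the direction of the other. -/
theorem wp_solveInside (hI : Instance S f O w a b) (hs : Search S f w a b s) (h₉ : s.iv 9 = 0) :
    wp O solveInside s fun t s' => t ≤ 235 * unit n ∧ Correct S f w a b s' := by
  have hu := le_unit n
  have hn := hI.pos
  obtain ⟨⟨σ, τ, hB⟩, hc⟩ := hs
  rw [hc.total] at h₉
  have hlt : s.rv 6 < s.rv 7 := hB.lt
  have hB' : Bracket S f w a b (s.setRv 8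
      (RExpr.eval s (.div (.add (.var 6) (.var 7)) (.const 2)))) σ τ :=
    ⟨hB.loaded.setRv _ _, hB.lo, hB.hi, hB.lo_le, hB.lt_hi, hB.lt, hB.crossings⟩
  have h₁ : s.rv 6 < (s.rv 6 + s.rv 7) / 2 := by linarith
  have h₂ : (s.rv 6 + s.rv 7) / 2 < s.rv 7 := by linarith
  refine wp_seq (wp_seq (wp_rset ((hB'.wp_probe hI ?_ ?_).mono ?_)))
  · simpa [RExpr.eval] using h₁
  · simpa [RExpr.eval] using h₂
  rintro t₁ s₁ hF₁ ⟨ht₁, ρ, hρ, h⟩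
  simp only [State.setRv_rv, if_true, RExpr.eval, Rat.cast_ofNat] at hρ
  obtain ⟨hρ₁, hρ₂⟩ := hρ.of_numCross_eq_zero h₉ h₁ h₂
  obtain ⟨h, -⟩ | ⟨h, -⟩ := h
  · refine (wp_finish hI h hρ₂ hB.hi.sorts).mono ?_
    rintro t₂ s₂ - ⟨ht₂, hc⟩
    exact ⟨by omega, hc⟩
  · refine (wp_finish hI h hB.lo.sorts hρ₁).mono ?_
    rintro t₂ s₂ - ⟨ht₂, hc⟩
    exact ⟨by omega, hc⟩

theorem wp_initSearch (hI : Instance S f O w a b) (hl : Loaded w a b s) (hx : s.crossings = 0) :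
    wp O (.seq initBracket count) s fun t s' => t ≤ 396 * unit n ∧ Search S f w a b s' := by
  have hu := le_unit n
  have hn := hI.pos
  refine wp_seq ((wp_initBracket hI hl hx).mono ?_)
  rintro t₁ s₁ - ⟨ht₁, -, -, σ, τ, hB⟩
  refine (wp_count hn hB.loaded).mono ?_
  rintro t₂ s₂ hF ⟨ht₂, hc⟩
  exact ⟨by omega, ⟨σ, τ, hB.frame hF (State.lo_eq_of_frame hF rfl)
    (State.hi_eq_of_frame hF rfl) rfl rfl⟩, hc⟩

/-- Correctness does not depend on the draws: induct on the number of crossings, which drops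
strictly in every round. -/
theorem safe_search (hI : Instance S f O w a b) (hs : Search S f w a b s) :
    Safe O (Correct S f w a b) ([searchLoop, solveInside], s) := by
  induction hN : s.iv 9 using Nat.strong_induction_on generalizing s with
  | _ N ih =>
    obtain h₀ | hpos := N.eq_zero_or_pos
    · obtain ⟨t, s', hE, -, hc⟩ := wp_solveInside hI hs (hN.trans h₀)
      exact (Exec.loop_false (by simp [Test.eval, IExpr.eval, hN, h₀])).safe
        (hE.safe (safe_halted hc))
    · obtain ⟨S', hS', -⟩ := exists_splits hI hs
      refine safe_loop (by simp [Test.eval, IExpr.eval, hN, hpos]) (safe_seq (safe_rand ?_))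
      intro v hv
      simp only [IExpr.eval] at hv
      obtain ⟨h₁, h₂, t, -, hE⟩ := hS' ⟨v, by omega⟩
      exact hE.safe (ih _ (hN ▸ h₂) h₁ rfl)

/-- The right side bounds the expected number of crossings after `m` rounds; by Markov's inequality
it bounds the probability that any is left. The extra `240 * unit n` steps pay for the final phase.
In the induction the average over one draw supplies the factor 3/4. -/
theorem probRunning_search_le (hI : Instance S f O w a b) (hs : Search S f w a b s) (m : ℕ) :
    probRunning O (m * (320 * unit n) + 240 * unit n) ([searchLoop, solveInside], s) ≤
      s.iv 9 * (3 / 4) ^ m := by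
  have hu : 1 ≤ unit n := hI.pos.trans (le_unit n)
  induction m generalizing s with
  | zero =>
    obtain h₀ | hpos := (s.iv 9).eq_zero_or_pos
    · obtain ⟨t, s', hE, ht, hc⟩ := wp_solveInside hI hs h₀
      have h₁ : Exec O searchLoop s 1 s :=
        Exec.loop_false (by simp [Test.eval, IExpr.eval, h₀])
      rw [show 0 * (320 * unit n) + 240 * unit n = 1 + (t + (240 * unit n - 1 - t)) by omega,
        h₁.probRunning_eq, hE.probRunning_eq, probRunning_halted]
      exact zero_le
    · rw [pow_zero, mul_one]
      exact (probRunning_le_one _ _).trans (by exact_mod_cast hpos)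
  | succ m ih =>
    obtain h₀ | hpos := (s.iv 9).eq_zero_or_pos
    · obtain ⟨t, s', hE, ht, hc⟩ := wp_solveInside hI hs h₀
      have h₁ : Exec O searchLoop s 1 s :=
        Exec.loop_false (by simp [Test.eval, IExpr.eval, h₀])
      have : 240 * unit n ≤ (m + 1) * (320 * unit n) + 240 * unit n := by omega
      obtain ⟨u, hu'⟩ := Nat.exists_eq_add_of_le
        ((show 1 + t ≤ 240 * unit n by omega).trans this)
      rw [hu', add_assoc, h₁.probRunning_eq, hE.probRunning_eq, probRunning_halted]
      exact zero_le
    · obtain ⟨S', hS', hsum⟩ := exists_splits hI hs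
      -- Loop test, sequencing and draw take one step each; the rest of the block suffices for the
      -- deterministic part of the round.
      rw [show (m + 1) * (320 * unit n) + 240 * unit n =
        ((320 * unit n - 3) + (m * (320 * unit n) + 240 * unit n)) + 1 + 1 + 1 by
          rw [add_mul]; omega, searchLoop, probRunning_loop _ _
          (by simp [Test.eval, IExpr.eval, hpos]), probRunning_seq, probRunning_rand]
      simp only [IExpr.eval, Nat.sub_add_cancel hpos]
      rw [← Finset.mul_sum, Finset.sum_range]
      have hle : ∑ v : Fin (s.iv 9), probRunning O
          ((320 * unit n - 3) + (m * (320 * unit n) + 240 * unit n))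
          ([splitAtCrossing, searchLoop, solveInside], s.setIv 10 v) ≤
          ∑ v, ((S' v).iv 9 : ℝ≥0∞) * (3 / 4) ^ m := by
        refine Finset.sum_le_sum fun v _ => ?_
        obtain ⟨h₁, -, t, ht, hE⟩ := hS' v
        exact (hE.probRunning_le (by omega) _ _).trans (ih h₁)
      rw [← Finset.sum_mul] at hle
      have hN₀ : (s.iv 9 : ℝ≥0∞) ≠ 0 := by exact_mod_cast hpos.ne'
      have hsum' : ∑ v, ((S' v).iv 9 : ℝ≥0∞) ≤ s.iv 9 * (s.iv 9 * (3 / 4)) := by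
        have h4 : (4 : ℝ≥0∞) * ∑ v, ((S' v).iv 9 : ℝ≥0∞) ≤ 3 * (s.iv 9 : ℝ≥0∞) ^ 2 := by
          exact_mod_cast hsum
        calc ∑ v, ((S' v).iv 9 : ℝ≥0∞) = 4⁻¹ * (4 * ∑ v, ((S' v).iv 9 : ℝ≥0∞)) := by
              rw [← mul_assoc, ENNReal.inv_mul_cancel (by simp) (by simp), one_mul]
          _ ≤ 4⁻¹ * (3 * (s.iv 9 : ℝ≥0∞) ^ 2) := by gcongr
          _ = _ := by rw [ENNReal.div_eq_inv_mul]; ring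
      calc _ ≤ (s.iv 9 : ℝ≥0∞)⁻¹ * ((∑ v, ((S' v).iv 9 : ℝ≥0∞)) * (3 / 4) ^ m) := by
            gcongr
            exact hle
        _ ≤ (s.iv 9 : ℝ≥0∞)⁻¹ * ((s.iv 9 * (s.iv 9 * (3 / 4))) * (3 / 4) ^ m) := by gcongr
        _ = ((s.iv 9 : ℝ≥0∞)⁻¹ * s.iv 9) * (s.iv 9 * (3 / 4) ^ (m + 1)) := by rw [pow_succ]; ring
        _ = _ := by rw [ENNReal.inv_mul_cancel hN₀ (by simp), one_mul]

/-! ### The randomized program as a whole -/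

theorem safe_randomizedProgram (hI : Instance S f O w a b) :
    Safe O (Correct S f w a b) (start randomizedProgram a b w) := by
  obtain ⟨t, s', hE, -, hs⟩ := wp_initSearch hI (loaded_start randomizedProgram) rfl
  exact safe_seq (hE.safe (safe_seq (safe_search hI hs)))

/-- The two extra blocks, `640 * unit n` steps, cover the initialization and the final phase. -/
theorem probRunning_randomizedProgram_le (hI : Instance S f O w a b) (m : ℕ) :
    probRunning O ((2 + m) * (320 * unit n)) (start randomizedProgram a b w) ≤
      (n : ℝ≥0∞) ^ 2 * (3 / 4) ^ m := by
  have hu : 1 ≤ unit n := hI.pos.trans (le_unit n)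
  obtain ⟨t, s', hE, ht, hs⟩ := wp_initSearch hI (loaded_start randomizedProgram) rfl
  have h₁ := probRunning_search_le hI hs m
  have h₂ : (s'.iv 9 : ℝ≥0∞) ≤ (n : ℝ≥0∞) ^ 2 := by
    exact_mod_cast hs.2.total.trans_le (numCross_le _ _)
  refine le_trans ?_ (h₁.trans (by gcongr))
  rw [show (2 + m) * (320 * unit n) =
    (400 * unit n - 2 + (m * (320 * unit n) + 240 * unit n + 1)) + 1 by rw [add_mul]; omega]
  refine (probRunning_seq _ _ _ _ _).trans_le ((hE.probRunning_le (by omega) _ _).trans ?_)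
  rw [probRunning_seq]

theorem natLog_succ_le {n : ℕ} (hn : 1 ≤ n) : (Nat.log 2 n + 1 : ℝ) ≤ 4 * Real.log (n + 1) := by
  have h₁ := natLog_le_log n
  have h₂ := one_le_two_mul_log hn
  have h₃ := log_le_log_succ hn
  linarith

/-- Since (3/4)³ ≤ 1/2, three rounds per binary digit of `n` gain a factor `n`, and `d + 2` times as
many beat the n² initial crossings with n^(-d) to spare. The remaining `k` rounds give the geometric
tail. -/
theorem sq_mul_pow_le {n : ℕ} (hn : 1 ≤ n) (d k : ℕ) :
    (n : ℝ≥0∞) ^ 2 * (3 / 4) ^ (3 * (d + 2) * (Nat.log 2 n + 1) + k) ≤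
      ENNReal.ofReal (1 / (n : ℝ) ^ d) * (3 / 4) ^ k := by
  have h₁ : (n : ℝ) ≤ 2 ^ (Nat.log 2 n + 1) := by
    exact_mod_cast (Nat.lt_pow_succ_log_self one_lt_two n).le
  have hn' : (0 : ℝ) < n := by exact_mod_cast hn
  have h₂ : (n : ℝ) ^ 2 * (3 / 4) ^ (3 * (d + 2) * (Nat.log 2 n + 1)) ≤ 1 / (n : ℝ) ^ d := by
    rw [le_div_iff₀ (by positivity)]
    calc (n : ℝ) ^ 2 * (3 / 4) ^ (3 * (d + 2) * (Nat.log 2 n + 1)) * (n : ℝ) ^ d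
        = (n : ℝ) ^ (d + 2) * (((3 / 4) ^ 3) ^ (Nat.log 2 n + 1)) ^ (d + 2) := by
          rw [← pow_mul, ← pow_mul]
          ring
      _ ≤ (2 ^ (Nat.log 2 n + 1)) ^ (d + 2) * ((1 / 2) ^ (Nat.log 2 n + 1)) ^ (d + 2) := by
          gcongr
          norm_num
      _ = 1 := by
          rw [← mul_pow, ← mul_pow]
          norm_num
  have h₃ : (3 / 4 : ℝ≥0∞) = ENNReal.ofReal (3 / 4) := by
    rw [ENNReal.ofReal_div_of_pos (by norm_num)]
    norm_num
  rw [pow_add, ← mul_assoc]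
  gcongr
  rw [h₃, ← ENNReal.ofReal_natCast, ← ENNReal.ofReal_pow (by positivity),
    ← ENNReal.ofReal_pow (by positivity), ← ENNReal.ofReal_mul (by positivity)]
  exact ENNReal.ofReal_le_ofReal h₂

theorem mul_unit_le {n : ℕ} (hn : 1 ≤ n) {c T : ℕ} (hT : T ≤ c * (Nat.log 2 n + 1) * unit n) :
    (T : ℝ) ≤ 16 * c * n * Real.log (n + 1) ^ 2 := by
  have h₁ := natLog_succ_le hn
  have h₂ := unit_le hn
  have h₃ : (T : ℝ) ≤ c * (Nat.log 2 n + 1) * unit n := by exact_mod_cast hT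
  calc (T : ℝ) ≤ c * (Nat.log 2 n + 1) * unit n := h₃
    _ ≤ c * (4 * Real.log (n + 1)) * (4 * (n * Real.log (n + 1))) := by
        gcongr
        exact mul_nonneg (Nat.cast_nonneg c) ((by positivity : (0:ℝ) ≤ _).trans h₁)
    _ = _ := by ring

/-- Time is counted in blocks of one round. The case `d = 0` of `sq_mul_pow_le` says that after
O(log n) blocks the tail is geometric. -/
theorem expectedTime_randomizedProgram_le (hI : Instance S f O w a b) :
    expectedTime O (start randomizedProgram a b w) ≤
      ((12 * 320 * (Nat.log 2 n + 1) * unit n : ℕ) : ℝ≥0∞) := by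
  have hu : 1 ≤ unit n := hI.pos.trans (le_unit n)
  refine (tsum_le_mul_tsum_of_antitone (probRunning_antitone _)
    (b := 320 * unit n) (by omega)).trans ?_
  have h := tsum_le_add_of_geometric (M := 2 + 3 * 2 * (Nat.log 2 n + 1))
    (f := fun m => probRunning O (m * (320 * unit n)) (start randomizedProgram a b w))
    (fun m => probRunning_le_one _ _) fun m => by
      have h₁ := sq_mul_pow_le hI.pos 0 m
      rw [pow_zero, div_one, ENNReal.ofReal_one, one_mul] at h₁
      refine le_trans ?_ h₁
      rw [add_assoc]
      exact probRunning_randomizedProgram_le hI _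
  calc _ ≤ ((320 * unit n : ℕ) : ℝ≥0∞) * (((2 + 3 * 2 * (Nat.log 2 n + 1) : ℕ) : ℝ≥0∞) + 4) := by
        gcongr
    _ = ((320 * unit n * (2 + 3 * 2 * (Nat.log 2 n + 1) + 4) : ℕ) : ℝ≥0∞) := by push_cast; ring
    _ ≤ _ := by
        refine Nat.cast_le.2 ?_
        calc 320 * unit n * (2 + 3 * 2 * (Nat.log 2 n + 1) + 4)
            ≤ 320 * unit n * (12 * (Nat.log 2 n + 1)) := Nat.mul_le_mul_left _ (by omega)
          _ = _ := by ring

theorem exists_randomized_program : ∃ prog : Cmd,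
    (∀ (n : ℕ) (a b w : Fin n → ℝ) (S : Set (ℝ × ℝ)) (f : ℝ × ℝ → ℝ) (O : Oracle),
      Instance S f O w a b →
      ∀ t : ℕ, ∀ y ∈ (run O t (start prog a b w)).support, y.1 = [] → Correct S f w a b y.2) ∧
    (∃ K : ℝ, ∀ (n : ℕ) (a b w : Fin n → ℝ) (S : Set (ℝ × ℝ)) (f : ℝ × ℝ → ℝ) (O : Oracle),
      Instance S f O w a b →
      expectedTime O (start prog a b w) ≤ ENNReal.ofReal (K * n * Real.log (n + 1) ^ 2)) ∧
    (∀ d : ℕ, ∃ K : ℝ, ∀ (n : ℕ) (a b w : Fin n → ℝ) (S : Set (ℝ × ℝ)) (f : ℝ × ℝ → ℝ)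
      (O : Oracle), Instance S f O w a b →
      ∃ T : ℕ, (T : ℝ) ≤ K * n * Real.log (n + 1) ^ 2 ∧
        probRunning O T (start prog a b w) ≤ ENNReal.ofReal (1 / (n : ℝ) ^ d)) := by
  refine ⟨randomizedProgram, fun n a b w S f O hI => safe_randomizedProgram hI,
    ⟨16 * (12 * 320 : ℕ), fun n a b w S f O hI => ?_⟩, fun d => ⟨16 * (320 * (2 + 3 * (d + 2)) : ℕ),
    fun n a b w S f O hI => ?_⟩⟩
  · refine (expectedTime_randomizedProgram_le hI).trans ?_
    rw [← ENNReal.ofReal_natCast]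
    exact ENNReal.ofReal_le_ofReal (mul_unit_le hI.pos le_rfl)
  · refine ⟨(2 + 3 * (d + 2) * (Nat.log 2 n + 1)) * (320 * unit n), mul_unit_le hI.pos ?_, ?_⟩
    · calc (2 + 3 * (d + 2) * (Nat.log 2 n + 1)) * (320 * unit n)
          ≤ ((2 + 3 * (d + 2)) * (Nat.log 2 n + 1)) * (320 * unit n) :=
            Nat.mul_le_mul_right _ (by rw [add_mul]; omega)
        _ = _ := by ring
    · refine (probRunning_randomizedProgram_le hI _).trans ?_
      simpa using sq_mul_pow_le hI.pos d 0

end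

end RankOpt

theorem mainTheorem5 :
    (∃ prog : RankOpt.Cmd, prog.RandFree ∧ ∃ K : ℝ,
      ∀ (n B : ℕ) (a b : Fin n → ℤ) (w : Fin n → ℝ)
        (S : Set (ℝ × ℝ)) (f : ℝ × ℝ → ℝ) (O : RankOpt.Oracle),
        RankOpt.Instance S f O w (fun j => (a j : ℝ)) (fun j => (b j : ℝ)) →
        1 ≤ B → (∀ j, |a j| ≤ (B : ℤ)) → (∀ j, |b j| ≤ (B : ℤ)) →
        ∃ T : ℕ, (T : ℝ) ≤ K * n * Real.log (n + 1) * Real.log (B + 1) ∧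
          ∀ y ∈ (RankOpt.run O T
              (RankOpt.start prog (fun j => (a j : ℝ)) (fun j => (b j : ℝ)) w)).support,
            y.1 = [] ∧
              RankOpt.Correct S f w (fun j => (a j : ℝ)) (fun j => (b j : ℝ)) y.2) ∧
    (∃ prog : RankOpt.Cmd,
      (∀ (n : ℕ) (a b w : Fin n → ℝ)
        (S : Set (ℝ × ℝ)) (f : ℝ × ℝ → ℝ) (O : RankOpt.Oracle),
        RankOpt.Instance S f O w a b →
        ∀ t : ℕ, ∀ y ∈ (RankOpt.run O t (RankOpt.start prog a b w)).support,
          y.1 = [] → RankOpt.Correct S f w a b y.2) ∧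
      (∃ K : ℝ, ∀ (n : ℕ) (a b w : Fin n → ℝ)
        (S : Set (ℝ × ℝ)) (f : ℝ × ℝ → ℝ) (O : RankOpt.Oracle),
        RankOpt.Instance S f O w a b →
        RankOpt.expectedTime O (RankOpt.start prog a b w) ≤
          ENNReal.ofReal (K * n * Real.log (n + 1) ^ 2)) ∧
      (∀ d : ℕ, ∃ K : ℝ, ∀ (n : ℕ) (a b w : Fin n → ℝ)
        (S : Set (ℝ × ℝ)) (f : ℝ × ℝ → ℝ) (O : RankOpt.Oracle),
        RankOpt.Instance S f O w a b →
        ∃ T : ℕ, (T : ℝ) ≤ K * n * Real.log (n + 1) ^ 2 ∧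
          RankOpt.probRunning O T (RankOpt.start prog a b w) ≤ ENNReal.ofReal (1 / (n : ℝ) ^ d))) :=
  ⟨RankOpt.exists_exact_program, RankOpt.exists_randomized_program⟩
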